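/- **Notation.** $\mathbb R^n$ carries the box norm $\|x\|=\max_i|x_i|$ and diameters are taken in it; $A\Subset B$ means $\overline A\subset \mathrm{int}(B)$. Let $M$ be a (Hausdorff, second countable) manifold of dimension $d\ge 2$ and $N\subset M$ open (the same definitions are used for $\mathbb R^{m+n}\times M$). *Pairs and rectangles.* For $C^1$ maps $P:N\to\mathbb R^p$, $Q:N\to\mathbb R^q$ put $\mathfrak X=(P,Q)$, $\mathfrak X^t=(Q,P)$. $\mathfrak X$ is a $(p,q)$-splitting of $N$ if it is a $C^1$ diffeomorphism onto its image. $R$ is a $(P,Q)$-rectangle if $(P,Q)$ is a diffeomorphism (between neighbourhoods) taking $R$ onto $P(R)\times Q(R)$. *Domination.* $C_\theta(x,\mathfrak X)=\{v\in T_xM:\|DQ(v)\|\le\theta\|DP(v)\|\}$. A $C^1$ embedding $f$ satisfies the $(\mathfrak X_1,\mathfrak X_2,\theta)$-cone invariance condition on $R$ if for some $0<\theta'<\theta$ and all $x\in R$, $Df^{-1}(C_\theta(f(x),\mathfrak X_2))\subset C_{\theta'}(x,\mathfrak X_1)$ and $Df(C_\theta(x,\mathfrak X_1^t))\subset C_{\theta'}(f(x),\mathfrak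 X_2^t)$. It is $(\mathfrak X_1,\mathfrak X_2,\mu,\gamma)$-dominated on $R$ ($\mu,\gamma>0$) if for every $\theta>0$ this holds and, for all $x\in R$, $\|D(P_1\circ f^{-1})(w)\|>\mu\|DP_2(w)\|$ for $0\ne w\in C_\theta(f(x),\mathfrak X_2)$ and $\|D(Q_2\circ f)(v)\|>\gamma\|DQ_1(v)\|$ for $0\neq v\in C_\theta(x,\mathfrak X_1^t)$. One writes $(\mathfrak X,\mu,\gamma)$ if $\mathfrak X_1=\mathfrak X_2=\mathfrak X$. A number $\nu$ is $(\mathfrak X_1,\mathfrak X_2)$-adapted to $f$ on $R$ if $f$ is $(\mathfrak X_1,\mathfrak X_2,\mu,\gamma)$-dominated on $R$ for some $\mu,\gamma>0$ with $\nu<\mu^{-1}<\gamma<\nu^{-1}$. *Preblending machines.* Let $\mathcal F=\{\phi_i:U_i\to M\}_{i=1}^k$ be $C^1$ local diffeomorphisms, $U_i$ open. For a word $\mathtt i=i_0\dots i_n$ ($n\geq 0$) let $|\mathtt i|=n+1$ and $\phi_{\mathtt i}=\phi_{i_n}\circ\dots\circ\phi_{i_0}$ on its maximal domain $U_{\mathtt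 i}$. A preblending machine $\mathfrak D=(\{R_{\mathtt i}\}_{\mathtt i\in I},B,\mathfrak X)$ for $\mathcal F$ in $N$ consists of a finite set $I$ of words, $|I|\ge2$, non-empty compact sets $R_{\mathtt i}\subset N\cap U_{\mathtt i}$, a splitting $\mathfrak X=(P,Q)$ of $N$ and an $\mathfrak X$-rectangle $B\subset N$ such that: (PB1) for each $\mathtt i\in I$, $\phi_{\mathtt i}$ is a $C^1$ embedding from a neighbourhood of $R_{\mathtt i}$ into $N$ and is $(\mathfrak X,\mu_{\mathtt i},\gamma_{\mathtt i})$-dominated on $R_{\mathtt i}$ for some $0<\mu_{\mathtt i}^{-1}<\gamma_{\mathtt i}$; (PB2) $R_{\mathtt i}$ is a $(P,Q\circ\phi_{\mathtt i})$-rectangle, $Q(R_{\mathtt i})\Subset Q(B)$, $Q(\phi_{\mathtt i}(R_{\mathtt i}))=Q(B)$ and $P(\phi_{\mathtt i}(R_{\mathtt i}))\Subset P(B)$; (PB3) the sets $\mathrm{int}\,P(R_{\mathtt i})$ cover $\overline{P(B)}$. A Lebesgue number of $\mathfrak D$ is a $\Delta>0$ such that every subset of $\overline{P(B)}$ of diameter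 $<\Delta$ lies in one $\mathrm{int}\,P(R_{\mathtt i})$. A number $\nu$ is adapted to $\mathfrak D$ if $\nu^{|\mathtt i|}$ is $(\mathfrak X,\mathfrak X)$-adapted to $\phi_{\mathtt i}$ on $R_{\mathtt i}$ for every $\mathtt i\in I$. *Horseshoe maps.* Let $\nu\in(0,1)$, $H=[0,1]^m$, $V=[0,1]^n$. A $(k,m,n,\nu)$-horseshoe map is a diffeomorphism $A$ of $\mathbb R^{m+n}$ with invertible affine maps $A_i^s$ of $\mathbb R^m$ and $A^u_i$ of $\mathbb R^n$, $i=1,\dots,k$, such that $\|DA_i^s\|,\|(DA_i^u)^{-1}\|<\nu$, the sets $H_i=A_i^s(H)\subset\mathrm{int}(H)$ are pairwise disjoint, the sets $V_i=(A_i^u)^{-1}(V)\subset\mathrm{int}(V)$ are pairwise disjoint, and $A=A_i^s\times A_i^u$ on $H\times V_i$. For a word $\mathtt i$ put $A_{\mathtt i}=A_{\mathtt i}^s\times A_{\mathtt i}^u$ (compositions as above) and let $\mathsf H_{\mathtt i}=H\times (A^u_{\mathtt i})^{-1}(V)$ be the corresponding leg. *Split blending machines.* A split blending machine for a map $f$ in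 an open set $\mathbf N$ is a tuple $(\{\mathbf R_i\}_{i\in I},Z,\mathfrak S,\mathfrak C,\theta)$ with $I$ finite, $|I|\ge 2$, $\mathbf R_i$ compact, $\mathfrak S=(P_{cs},Q_u)$ a $(d_s+d_c,d_u)$-splitting of $\mathbf N$, $\mathfrak C=(P_s,P_c)$ a $(d_s,d_c)$-splitting of $\mathbb R^{d_s+d_c}$, $Z\subset\mathbf N$ an $\mathfrak S$-rectangle, $0<\theta<1$, and, for all $i$: (BM1) on a neighbourhood of $\mathbf R_i$ contained in $\mathbf N$, $f$ is a $C^1$ embedding into $\mathbf N$ satisfying the $(\mathfrak S,\mathfrak S,\theta)$-cone invariance condition; (BM2) $\mathbf R_i$ is a $(P_{cs},Q_u\circ f)$-rectangle, $Q_u(\mathbf R_i)\Subset Q_u(Z)$, $Q_u(f(\mathbf R_i))=Q_u(Z)$, $P_{cs}(f(\mathbf R_i))\Subset P_{cs}(Z)$; (BM3) $P_{cs}(\mathbf R_i)$ is a $\mathfrak C$-rectangle and $P_s(P_{cs}(Z))\subset P_s(P_{cs}(\mathbf R_i))$; (BM4) the sets $\mathrm{int}\,P_c(P_{cs}(\mathbf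 R_i))$ cover $\overline{P_c(P_{cs}(Z))}$, with a Lebesgue number $\Delta>\theta\,\|DP_c\|\,\mathrm{diam}\,Q_u(Z)$. *Maximal forward invariant sets.* $\Lambda^s(K,f)=\bigcap_{n\ge0}f^{-n}(K)$. **Hypotheses.** Let $0<d_c<d$, $d_s,d_u\ge1$, $k_1,k_2\ge2$, and let $N_1,N_2\subset M$ be open. For $\tau=1,2$ let $\mathcal F_\tau=\{\phi_{\tau,i}\}_{i=1}^{k_\tau}$ be a family of $C^1$ local diffeomorphisms and $\mathfrak D_\tau=(\{R_{\tau,\mathtt i}\}_{\mathtt i\in I_\tau},B_\tau,\mathfrak X_\tau)$ a preblending machine for $\mathcal F_\tau$ in $N_\tau$, where $\mathfrak X_1=(P_1,Q_1)$ is a $(d_c,d-d_c)$-splitting of $N_1$ and $\mathfrak X_2=(Q_2,P_2)$ is a $(d-d_c,d_c)$-splitting of $N_2$. Assume that $Q_1(B_1)$ and $P_2(B_2)$ are convex. Let $(R_\sharp,U_\sharp,\phi_\sharp)$ be an adapted transition: $R_\sharp\subset N_2$ is compact, $U_\sharp$ is an open neighbourhood of $R_\sharp$, $\phi_\sharp:U_\sharp\to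 N_1$ is a $C^1$ embedding, and there are $\mu_\tau,\gamma_\tau>0$, $\tau=1,2,\sharp$, such that (at1) $\mu_1\gamma_2>1$ and $\mu_2\gamma_1>1$; (at2) for $\tau=1,2$ and $\mathtt i\in I_\tau$, $\phi_{\tau,\mathtt i}$ is $(\mathfrak X_\tau,\mu_\tau,\gamma_\tau)$-dominated on $R_{\tau,\mathtt i}$; (at3) $R_\sharp$ is a $(P_2,Q_1\circ\phi_\sharp)$-rectangle, $Q_2(R_\sharp)\Subset Q_2(B_2)$, $P_2(R_\sharp)=P_2(B_2)$, $P_1(\phi_\sharp(R_\sharp))\Subset P_1(B_1)$ and $Q_1(\phi_\sharp(R_\sharp))=Q_1(B_1)$; (at4) $\phi_\sharp$ is $(\mathfrak X_2^t,\mathfrak X_1,\mu_\sharp,\gamma_\sharp)$-dominated on $R_\sharp$; (at5) $\mu_\sharp^{-1}\,\mathrm{diam}\,P_2(B_2)<\Delta_1$ and $\gamma_\sharp^{-1}\,\mathrm{diam}\,Q_1(B_1)<\Delta_2$ for some Lebesgue numbers $\Delta_\tau$ of $\mathfrak D_\tau$. Let $A_1,A_2,A_\sharp$ be horseshoe maps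 of types $(k_1,d_s,d_u,\nu_1)$, $(k_2,d_u,d_s,\nu_2)$, $(1,d_s,d_u,\nu_\sharp)$ such that $\nu_1$, $\nu_2$ are adapted to $\mathfrak D_1$, $\mathfrak D_2$ and $\nu_\sharp$ is $(\mathfrak X_2^t,\mathfrak X_1)$-adapted to $\phi_\sharp$ on $R_\sharp$. The factors of $\mathbb R^{d_u}\times\mathbb R^{d_s}$ (where $A_2$ acts) and of $\mathbb R^{d_s}\times\mathbb R^{d_u}$ are identified by interchanging them. Put $\mathbf R_{\tau,\mathtt i}=\mathsf H_{\tau,\mathtt i}\times R_{\tau,\mathtt i}$ and $\mathbf R_\sharp=\mathsf H_\sharp\times R_\sharp$. Let $F_\tau$ ($\tau=1,2$) be the tower map, equal to $A_{\tau,\mathtt i}\times\phi_{\tau,\mathtt i}$ on $\mathbf R_{\tau,\mathtt i}$ for $\mathtt i\in I_\tau$ (it is assumed that this defines a map, i.e. that the $\mathbf R_{\tau,\mathtt i}$, $\mathtt i\in I_\tau$, are pairwise disjoint), and let $F_\sharp=A_\sharp\times\phi_\sharp$ on $\mathbf R_\sharp$. Let these maps be extended in any way to $C^1$ maps on open neighbourhoods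 $\mathbf U_\tau$ of $\bigcup_{\mathtt i}\mathbf R_{\tau,\mathtt i}$, respectively $\mathbf U_\sharp$ of $\mathbf R_\sharp$, with the same derivatives as $A_{\tau,\mathtt i}\times\phi_{\tau,\mathtt i}$ on $\mathbf R_{\tau,\mathtt i}$ and as $A_\sharp\times\phi_\sharp$ on $\mathbf R_\sharp$. **Theorem.** There is $\theta_0>0$ such that for every $0<\theta\le\theta_0$ the tuples $\mathfrak B_\tau=(\{\mathbf R_{\tau,\mathtt i}\}_{\mathtt i\in I_\tau},[0,1]^{d_s+d_u}\times B_\tau,\mathfrak S_\tau,\mathfrak C_\tau,\theta)$, $\tau=1,2$, are split blending machines for $F_\tau$ in $\mathbb R^{d_s+d_u}\times N_\tau$, where, for $x^s\in\mathbb R^{d_s}$, $x^u\in\mathbb R^{d_u}$, $x\in N_\tau$, $$\mathfrak S_1(x^s,x^u,x)=\big((x^s,P_1(x)),(Q_1(x),x^u)\big),\qquad \mathfrak S_2(x^s,x^u,x)=\big((x^u,Q_2(x)),(P_2(x),x^s)\big),$$ and $\mathfrak C_1$, $\mathfrak C_2$ are given by the standard projections of $\mathbb R^{d_s}\times\mathbb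 R^{d_c}$ and of $\mathbb R^{d_u}\times\mathbb R^{d-d_c}$ onto their factors. Moreover, with $\Lambda^s(\mathfrak B_\tau)=\Lambda^s(\bigcup_{\mathtt i}\mathbf R_{\tau,\mathtt i},F_\tau)$, $$\Lambda^s(\mathfrak B_1)\cap F_\sharp\big(\mathbf R_\sharp\cap\Lambda^s(\mathfrak B_2)\big)\neq\emptyset .$$ This intersection is robust: for all compact neighbourhoods $K_\tau\subset\mathbf U_\tau$ of $\bigcup_{\mathtt i}\mathbf R_{\tau,\mathtt i}$, $\tau=1,2$, there are neighbourhoods $\mathcal U_\tau$ of $F_\tau$, $\tau=1,2,\sharp$, in the compact-open $C^1$ topology on $C^1$ maps defined on $\mathbf U_\tau$, such that $$\Lambda^s(K_1,G_1)\cap G_\sharp\big(\mathbf U_\sharp\cap\Lambda^s(K_2,G_2)\big)\ne\emptyset\quad\text{for all } C^1\text{ maps } G_\tau\in\mathcal U_\tau,\ \tau=1,2,\sharp .$$ -/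

import Mathlib

open Set Function Filter Topology
open scoped Manifold ContDiff

noncomputable section

/-! ### General notions -/

/-- `A ⋐ B`: the closure of `A` is contained in the interior of `B`. -/
def InsideInterior {α : Type*} [TopologicalSpace α] (A B : Set α) : Prop :=
  closure A ⊆ interior B

/-- `Δ` is a Lebesgue number of the covering `(V i)`, `i ∈ S`, of the set `C`: every bounded
subset of `C` of diameter less than `Δ` lies in a single member of the covering. -/
def IsLebesgueNumber {α ι : Type*} [PseudoMetricSpace α] (C : Set α) (S : Finset ι)
    (V : ι → Set α) (Δ : ℝ) : Prop :=
  0 < Δ ∧ ∀ K : Set α, K ⊆ C → Bornology.IsBounded K → Metric.diam K < Δ → ∃ i ∈ S, K ⊆ V i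

/-- The maximal forward invariant set `⋂ n ≥ 0, f⁻ⁿ(K)`. Only the values of `f` on `K` matter. -/
def maximalForwardInvariantSet {X : Type*} (K : Set X) (f : X → X) : Set X :=
  {x | ∀ n : ℕ, f^[n] x ∈ K}

/-- For a word `w = i₀ … iₙ`, the composition `f_w = f_{iₙ} ∘ ⋯ ∘ f_{i₀}`. -/
def wordMap {κ α : Type*} (f : κ → α → α) : List κ → α → α
  | [], x => x
  | i :: w, x => wordMap f w (f i x)

/-- The domain of `f_w`, when `f i` is defined on `U i`: for `w = i₀ … iₙ` it is the set of
`x ∈ U_{i₀}` such that `f_{i₀ … i_j} x ∈ U_{i_{j+1}}` for `0 ≤ j < n`. -/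
def wordDomain {κ α : Type*} (U : κ → Set α) (f : κ → α → α) : List κ → Set α
  | [] => univ
  | i :: w => {x | x ∈ U i ∧ f i x ∈ wordDomain U f w}

/-! ### Pairs, splittings, rectangles, cones and domination

A pair on an open subset of a manifold `X` is given by two maps `P : X → F` and `Q : X → G` into
finite dimensional normed spaces (such as `Fin p → ℝ`, whose norm is the box norm). -/

section Manifold

variable {E H : Type*} [NormedAddCommGroup E] [NormedSpace ℝ E] [TopologicalSpace H]
  (I : ModelWithCorners ℝ E H)
  {E' H' : Type*} [NormedAddCommGroup E'] [NormedSpace ℝ E'] [TopologicalSpace H']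
  (I' : ModelWithCorners ℝ E' H')
  {X : Type*} [TopologicalSpace X] [ChartedSpace H X]
  {Y : Type*} [TopologicalSpace Y] [ChartedSpace H' Y]
  {F G : Type*} [NormedAddCommGroup F] [NormedSpace ℝ F]
  [NormedAddCommGroup G] [NormedSpace ℝ G]

/-- `f` restricts to a `C¹` diffeomorphism from the open set `W` onto its (open) image. -/
def IsDiffeoOntoImage (f : X → Y) (W : Set X) : Prop :=
  IsOpen W ∧ InjOn f W ∧ IsLocalDiffeomorphOn I I' 1 f W

/-- `(P, Q)` is a splitting of the open set `N`. -/
def IsSplitting (P : X → F) (Q : X → G) (N : Set X) : Prop :=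
  IsDiffeoOntoImage I 𝓘(ℝ, F × G) (fun x => (P x, Q x)) N

/-- `R` is a `(P, Q)`-rectangle: `(P, Q)` is a diffeomorphism between `R` and `P(R) × Q(R)`. -/
def IsRectangle (P : X → F) (Q : X → G) (R : Set X) : Prop :=
  (∃ W : Set X, R ⊆ W ∧ IsDiffeoOntoImage I 𝓘(ℝ, F × G) (fun x => (P x, Q x)) W) ∧
    (fun x => (P x, Q x)) '' R = (P '' R) ×ˢ (Q '' R)

/-- The derivative `D_x P (v)` of a vector valued map, as an element of `F`. -/
def tangentDeriv (P : X → F) (x : X) (v : TangentSpace I x) : F :=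
  mfderiv I 𝓘(ℝ, F) P x v

/-- The cone `C_θ(x, (P, Q)) = {v ∈ T_x X : ‖DQ(v)‖ ≤ θ ‖DP(v)‖}`. -/
def cone (P : X → F) (Q : X → G) (θ : ℝ) (x : X) : Set (TangentSpace I x) :=
  {v | ‖tangentDeriv I Q x v‖ ≤ θ * ‖tangentDeriv I P x v‖}

/-- The `((P₁, Q₁), (P₂, Q₂), θ)`-cone invariance condition of `f` on `R`. (The derivative of `f`
is invertible on `R` where this is used, so that preimages under `Df` are images under `Df⁻¹`.) -/
def ConeInvariance (P₁ : X → F) (Q₁ : X → G) (P₂ : X → F) (Q₂ : X → G) (θ : ℝ)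
    (f : X → X) (R : Set X) : Prop :=
  ∃ θ' : ℝ, 0 < θ' ∧ θ' < θ ∧ ∀ x ∈ R, ∀ v : TangentSpace I x,
    (mfderiv I I f x v ∈ cone I P₂ Q₂ θ (f x) → v ∈ cone I P₁ Q₁ θ' x) ∧
    (v ∈ cone I Q₁ P₁ θ x → mfderiv I I f x v ∈ cone I Q₂ P₂ θ' (f x))

/-- The `((P₁, Q₁), (P₂, Q₂), θ, μ, γ)`-dilatation condition of `f` on `R`. In the first part the
vector `w` at `f x` is written as `w = Df(v)`. -/
def DilatationCondition (P₁ : X → F) (Q₁ : X → G) (P₂ : X → F) (Q₂ : X → G) (θ μ γ : ℝ)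
    (f : X → X) (R : Set X) : Prop :=
  ∀ x ∈ R, ∀ v : TangentSpace I x, v ≠ 0 →
    (mfderiv I I f x v ∈ cone I P₂ Q₂ θ (f x) →
      μ * ‖tangentDeriv I P₂ (f x) (mfderiv I I f x v)‖ < ‖tangentDeriv I P₁ x v‖) ∧
    (v ∈ cone I Q₁ P₁ θ x →
      γ * ‖tangentDeriv I Q₁ x v‖ < ‖tangentDeriv I Q₂ (f x) (mfderiv I I f x v)‖)

/-- `f` is `((P₁, Q₁), (P₂, Q₂), μ, γ)`-dominated on `R`: the cone invariance and the dilatation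
condition hold for every cone width `θ > 0`. -/
def Dominated (P₁ : X → F) (Q₁ : X → G) (P₂ : X → F) (Q₂ : X → G) (μ γ : ℝ)
    (f : X → X) (R : Set X) : Prop :=
  ∀ θ : ℝ, 0 < θ → ConeInvariance I P₁ Q₁ P₂ Q₂ θ f R ∧
    DilatationCondition I P₁ Q₁ P₂ Q₂ θ μ γ f R

/-- The stretching `ν` is `((P₁, Q₁), (P₂, Q₂))`-adapted to `f` on `R`. -/
def AdaptedStretching (ν : ℝ) (P₁ : X → F) (Q₁ : X → G) (P₂ : X → F) (Q₂ : X → G)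
    (f : X → X) (R : Set X) : Prop :=
  ∃ μ γ : ℝ, 0 < μ ∧ 0 < γ ∧ Dominated I P₁ Q₁ P₂ Q₂ μ γ f R ∧
    ν < μ⁻¹ ∧ μ⁻¹ < γ ∧ γ < ν⁻¹

/-! ### The `C¹` topology -/

/-- The compact-open `C¹` topology on maps `X → Y` that are of class `C¹` on the open set `U`: the
topology induced by `f ↦ Df` from the compact-open topology on maps `TU → TY`. -/
abbrev c1Topology [IsManifold I 1 X] [IsManifold I' 1 Y] (U : Set X) : TopologicalSpace (X → Y) :=
  TopologicalSpace.generateFrom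
    {𝒱 | ∃ (C : Set (TangentBundle I X)) (O : Set (TangentBundle I' Y)),
      IsCompact C ∧ (∀ v ∈ C, v.proj ∈ U) ∧ IsOpen O ∧
      𝒱 = {f : X → Y | MapsTo (tangentMap I I' f) C O}}

/-- `f` has the same values and the same derivatives as `g` at the points of `S`. -/
def AgreeToFirstOrder (f g : X → Y) (S : Set X) : Prop :=
  ∀ v : TangentBundle I X, v.proj ∈ S → tangentMap I I' f v = tangentMap I I' g v

/-! ### Split blending machines -/

/-- `((R i)_{i ∈ S}, Z, (Pcs, Qu), (Ps, Pc), θ)` is a split blending machine for `f` in the open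
set `N`; here `Ecs`, `Eu`, `Es`, `Ec` are the Euclidean spaces (with box norms) of dimensions
`d_s + d_c`, `d_u`, `d_s`, `d_c`. -/
structure IsSplitBlendingMachine {ι Ecs Eu Es Ec : Type*}
    [NormedAddCommGroup Ecs] [NormedSpace ℝ Ecs] [NormedAddCommGroup Eu] [NormedSpace ℝ Eu]
    [NormedAddCommGroup Es] [NormedSpace ℝ Es] [NormedAddCommGroup Ec] [NormedSpace ℝ Ec]
    (f : X → X) (N : Set X) (S : Finset ι) (R : ι → Set X) (Z : Set X)
    (Pcs : X → Ecs) (Qu : X → Eu) (Ps : Ecs → Es) (Pc : Ecs → Ec) (θ : ℝ) : Prop where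
  two_le_card : 2 ≤ S.card
  isCompact : ∀ i ∈ S, IsCompact (R i)
  stableCenterSplitting : IsSplitting I Pcs Qu N
  centerSplitting : IsSplitting 𝓘(ℝ, Ecs) Ps Pc univ
  superposition_subset : Z ⊆ N
  superposition_rectangle : IsRectangle I Pcs Qu Z
  theta_pos : 0 < θ
  theta_lt_one : θ < 1
  bm1 : ∀ i ∈ S, ∃ W : Set X, R i ⊆ W ∧ W ⊆ N ∧ IsDiffeoOntoImage I I f W ∧ MapsTo f W N ∧
    ConeInvariance I Pcs Qu Pcs Qu θ f W
  bm2_rectangle : ∀ i ∈ S, IsRectangle I Pcs (Qu ∘ f) (R i)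
  bm2 : ∀ i ∈ S, InsideInterior (Qu '' R i) (Qu '' Z) ∧ (Qu ∘ f) '' R i = Qu '' Z ∧
    InsideInterior ((Pcs ∘ f) '' R i) (Pcs '' Z)
  bm3 : ∀ i ∈ S, IsRectangle 𝓘(ℝ, Ecs) Ps Pc (Pcs '' R i) ∧
    (Ps ∘ Pcs) '' Z ⊆ (Ps ∘ Pcs) '' R i
  bm4_cover : closure ((Pc ∘ Pcs) '' Z) ⊆ ⋃ i ∈ S, interior ((Pc ∘ Pcs) '' R i)
  bm4_lebesgue : ∃ Δ L : ℝ,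
    IsLebesgueNumber (closure ((Pc ∘ Pcs) '' Z)) S (fun i => interior ((Pc ∘ Pcs) '' R i)) Δ ∧
    (∀ y, ‖fderiv ℝ Pc y‖ ≤ L) ∧ θ * L * Metric.diam (Qu '' Z) < Δ

end Manifold

/-! ### Affine horseshoe maps -/

/-- The unit cube `[0, 1]ⁿ`. -/
def unitCube (n : ℕ) : Set (Fin n → ℝ) := Icc 0 1

/-- A locally affine `(k, m, n, ν)`-horseshoe map of `ℝᵐ × ℝⁿ`. Its disks are
`H_i = A_i^s([0,1]^m)` and `V_i = (A_i^u)⁻¹([0,1]^n)`, so that `A(H × V_i) = H_i × V`. -/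
structure AffineHorseshoe (k m n : ℕ) (ν : ℝ) where
  toDiffeo : Diffeomorph 𝓘(ℝ, (Fin m → ℝ) × (Fin n → ℝ)) 𝓘(ℝ, (Fin m → ℝ) × (Fin n → ℝ))
    ((Fin m → ℝ) × (Fin n → ℝ)) ((Fin m → ℝ) × (Fin n → ℝ)) 1
  stableMap : Fin k → ((Fin m → ℝ) ≃ᵃ[ℝ] (Fin m → ℝ))
  unstableMap : Fin k → ((Fin n → ℝ) ≃ᵃ[ℝ] (Fin n → ℝ))
  nu_pos : 0 < ν
  nu_lt_one : ν < 1
  stable_norm_lt : ∀ i,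
    ‖LinearMap.toContinuousLinearMap ((stableMap i).linear : (Fin m → ℝ) →ₗ[ℝ] (Fin m → ℝ))‖ < ν
  unstable_norm_lt : ∀ i,
    ‖LinearMap.toContinuousLinearMap
      ((unstableMap i).linear.symm : (Fin n → ℝ) →ₗ[ℝ] (Fin n → ℝ))‖ < ν
  stable_inside : ∀ i, stableMap i '' unitCube m ⊆ interior (unitCube m)
  unstable_inside : ∀ i, unstableMap i ⁻¹' unitCube n ⊆ interior (unitCube n)
  stable_disjoint : Pairwise fun i j => Disjoint (stableMap i '' unitCube m)
    (stableMap j '' unitCube m)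
  unstable_disjoint : Pairwise fun i j => Disjoint (unstableMap i ⁻¹' unitCube n)
    (unstableMap j ⁻¹' unitCube n)
  apply_eq : ∀ i, ∀ x ∈ unitCube m, ∀ y ∈ unstableMap i ⁻¹' unitCube n,
    toDiffeo (x, y) = (stableMap i x, unstableMap i y)

namespace AffineHorseshoe

variable {k m n : ℕ} {ν : ℝ} (A : AffineHorseshoe k m n ν)

/-- The affine map `A_w = A_w^s × A_w^u`. -/
def wordAffine (w : List (Fin k)) (z : (Fin m → ℝ) × (Fin n → ℝ)) :
    (Fin m → ℝ) × (Fin n → ℝ) :=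
  (wordMap (fun i => ⇑(A.stableMap i)) w z.1, wordMap (fun i => ⇑(A.unstableMap i)) w z.2)

/-- The leg `𝖧_w = [0,1]^m × V_w` with `V_w = (A_w^u)⁻¹([0,1]^n)`. -/
def leg (w : List (Fin k)) : Set ((Fin m → ℝ) × (Fin n → ℝ)) :=
  unitCube m ×ˢ (wordMap (fun i => ⇑(A.unstableMap i)) w ⁻¹' unitCube n)

end AffineHorseshoe

/-! ### Fiber maps, preblending machines and their transitions -/

section Fiber

variable {d : ℕ} {M : Type*} [TopologicalSpace M] [ChartedSpace (EuclideanSpace ℝ (Fin d)) M]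

/-- A finite family of `C¹` local diffeomorphisms `φ i : U i → M`, with `U i ⊆ M` open. -/
structure LocalDiffeoFamily (d k : ℕ) (M : Type*) [TopologicalSpace M]
    [ChartedSpace (EuclideanSpace ℝ (Fin d)) M] where
  dom : Fin k → Set M
  map : Fin k → M → M
  isOpen_dom : ∀ i, IsOpen (dom i)
  isLocalDiffeo : ∀ i, IsLocalDiffeomorphOn (𝓡 d) (𝓡 d) 1 (map i) (dom i)

/-- The composition `φ_w`. -/
def LocalDiffeoFamily.word {k : ℕ} (𝓕 : LocalDiffeoFamily d k M) (w : List (Fin k)) : M → M :=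
  wordMap 𝓕.map w

/-- The domain `U_w` of `φ_w`. -/
def LocalDiffeoFamily.wordDom {k : ℕ} (𝓕 : LocalDiffeoFamily d k M) (w : List (Fin k)) : Set M :=
  wordDomain 𝓕.dom 𝓕.map w

/-- `((R w)_{w ∈ S}, B, (P, Q))` is a preblending machine for `𝓕` in the open set `N`, with
`(P, Q)` a `(p, q)`-splitting of `N`. -/
structure IsPreblendingMachine {k p q : ℕ} (𝓕 : LocalDiffeoFamily d k M) (N : Set M)
    (S : Finset (List (Fin k))) (R : List (Fin k) → Set M) (B : Set M)
    (P : M → Fin p → ℝ) (Q : M → Fin q → ℝ) : Prop where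
  two_le_card : 2 ≤ S.card
  word_ne_nil : ∀ w ∈ S, w ≠ []
  nonempty : ∀ w ∈ S, (R w).Nonempty
  isCompact : ∀ w ∈ S, IsCompact (R w)
  subset_open : ∀ w ∈ S, R w ⊆ N
  subset_wordDom : ∀ w ∈ S, R w ⊆ 𝓕.wordDom w
  splitting : IsSplitting (𝓡 d) P Q N
  region_subset : B ⊆ N
  region_rectangle : IsRectangle (𝓡 d) P Q B
  pb1 : ∀ w ∈ S,
    (∃ W : Set M, R w ⊆ W ∧ W ⊆ 𝓕.wordDom w ∧
      IsDiffeoOntoImage (𝓡 d) (𝓡 d) (𝓕.word w) W ∧ MapsTo (𝓕.word w) W N) ∧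
    ∃ μ γ : ℝ, 0 < μ⁻¹ ∧ μ⁻¹ < γ ∧ Dominated (𝓡 d) P Q P Q μ γ (𝓕.word w) (R w)
  pb2_rectangle : ∀ w ∈ S, IsRectangle (𝓡 d) P (Q ∘ 𝓕.word w) (R w)
  pb2 : ∀ w ∈ S, InsideInterior (Q '' R w) (Q '' B) ∧ (Q ∘ 𝓕.word w) '' R w = Q '' B ∧
    InsideInterior ((P ∘ 𝓕.word w) '' R w) (P '' B)
  pb3 : closure (P '' B) ⊆ ⋃ w ∈ S, interior (P '' R w)

/-- The stretching `ν` is adapted to the preblending machine with rectangles `R w`, `w ∈ S`: for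
every `w ∈ S`, the stretching `ν ^ |w|` is adapted to `φ_w` on `R w`. -/
def AdaptedToMachine {k p q : ℕ} (ν : ℝ) (𝓕 : LocalDiffeoFamily d k M)
    (S : Finset (List (Fin k))) (R : List (Fin k) → Set M)
    (P : M → Fin p → ℝ) (Q : M → Fin q → ℝ) : Prop :=
  ∀ w ∈ S, AdaptedStretching (𝓡 d) (ν ^ w.length) P Q P Q (𝓕.word w) (R w)

/-- `(R, U, φ)` is an adapted transition between a preblending machine
`((R₁ w)_{w ∈ S₁}, B₁, (P₁, Q₁))` for `𝓕₁` in `N₁` and a preblending machine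
`((R₂ w)_{w ∈ S₂}, B₂, (Q₂, P₂))` for `𝓕₂` in `N₂`. -/
structure IsAdaptedTransition {k₁ k₂ p q : ℕ}
    (𝓕₁ : LocalDiffeoFamily d k₁ M) (N₁ : Set M) (S₁ : Finset (List (Fin k₁)))
    (R₁ : List (Fin k₁) → Set M) (B₁ : Set M) (P₁ : M → Fin p → ℝ) (Q₁ : M → Fin q → ℝ)
    (𝓕₂ : LocalDiffeoFamily d k₂ M) (N₂ : Set M) (S₂ : Finset (List (Fin k₂)))
    (R₂ : List (Fin k₂) → Set M) (B₂ : Set M) (Q₂ : M → Fin q → ℝ) (P₂ : M → Fin p → ℝ)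
    (R U : Set M) (φ : M → M) : Prop where
  isCompact : IsCompact R
  subset_open : R ⊆ N₂
  subset_dom : R ⊆ U
  embedding : IsDiffeoOntoImage (𝓡 d) (𝓡 d) φ U
  mapsTo : MapsTo φ U N₁
  at3_rectangle : IsRectangle (𝓡 d) P₂ (Q₁ ∘ φ) R
  at3_a : InsideInterior (Q₂ '' R) (Q₂ '' B₂)
  at3_b : P₂ '' R = P₂ '' B₂
  at3_c : InsideInterior ((P₁ ∘ φ) '' R) (P₁ '' B₁)
  at3_d : (Q₁ ∘ φ) '' R = Q₁ '' B₁
  constants : ∃ μ₁ γ₁ μ₂ γ₂ μ γ : ℝ,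
    0 < μ₁ ∧ 0 < γ₁ ∧ 0 < μ₂ ∧ 0 < γ₂ ∧ 0 < μ ∧ 0 < γ ∧
    -- (at1)
    1 < μ₁ * γ₂ ∧ 1 < μ₂ * γ₁ ∧
    -- (at2)
    (∀ w ∈ S₁, Dominated (𝓡 d) P₁ Q₁ P₁ Q₁ μ₁ γ₁ (𝓕₁.word w) (R₁ w)) ∧
    (∀ w ∈ S₂, Dominated (𝓡 d) Q₂ P₂ Q₂ P₂ μ₂ γ₂ (𝓕₂.word w) (R₂ w)) ∧
    -- (at4)
    Dominated (𝓡 d) P₂ Q₂ P₁ Q₁ μ γ φ R ∧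
    -- (at5)
    ∃ Δ₁ Δ₂ : ℝ,
      IsLebesgueNumber (closure (P₁ '' B₁)) S₁ (fun w => interior (P₁ '' R₁ w)) Δ₁ ∧
      IsLebesgueNumber (closure (Q₂ '' B₂)) S₂ (fun w => interior (Q₂ '' R₂ w)) Δ₂ ∧
      μ⁻¹ * Metric.diam (P₂ '' B₂) < Δ₁ ∧ γ⁻¹ * Metric.diam (Q₁ '' B₁) < Δ₂

end Fiber

/-! ### Skew-product tower maps -/

/-- The ambient space `ℝᵐ × ℝⁿ × M` of a skew-product over a horseshoe map. -/
abbrev SkewSpace (m n : ℕ) (M : Type*) : Type _ := ((Fin m → ℝ) × (Fin n → ℝ)) × M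

/-- The model with corners of `ℝᵐ × ℝⁿ × M`, for a `d`-dimensional manifold `M`. -/
abbrev skewModel (m n d : ℕ) :=
  (𝓘(ℝ, (Fin m → ℝ) × (Fin n → ℝ))).prod (𝓡 d)

section Tower

variable {d : ℕ} {M : Type*} [TopologicalSpace M] [ChartedSpace (EuclideanSpace ℝ (Fin d)) M]
  {k m n : ℕ} {ν : ℝ}

/-- The rectangle `𝐑_w = 𝖧_w × R_w`. -/
def towerRect (A : AffineHorseshoe k m n ν) (R : List (Fin k) → Set M) (w : List (Fin k)) :
    Set (SkewSpace m n M) :=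
  A.leg w ×ˢ R w

/-- The branch `A_w × φ_w`. -/
def towerBranch (A : AffineHorseshoe k m n ν) (𝓕 : LocalDiffeoFamily d k M) (w : List (Fin k))
    (z : SkewSpace m n M) : SkewSpace m n M :=
  (A.wordAffine w z.1, 𝓕.word w z.2)

/-- `F` is (a `C¹` extension to the open set `U` of) the skew-product tower map: on every `𝐑_w`,
`w ∈ S`, it coincides with `A_w × φ_w`, and so do the derivatives. -/
structure IsTowerMap (A : AffineHorseshoe k m n ν) (𝓕 : LocalDiffeoFamily d k M)
    (S : Finset (List (Fin k))) (R : List (Fin k) → Set M)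
    (F : SkewSpace m n M → SkewSpace m n M) (U : Set (SkewSpace m n M)) : Prop where
  isOpen : IsOpen U
  subset : ∀ w ∈ S, towerRect A R w ⊆ U
  contMDiffOn : ContMDiffOn (skewModel m n d) (skewModel m n d) 1 F U
  agree : ∀ w ∈ S, AgreeToFirstOrder (skewModel m n d) (skewModel m n d) F (towerBranch A 𝓕 w)
    (towerRect A R w)

/-- The stable set `Λ^s` of the machine with rectangles `𝐑_w`, `w ∈ S`, for the map `F`. -/
def machineStableSet (A : AffineHorseshoe k m n ν) (S : Finset (List (Fin k)))
    (R : List (Fin k) → Set M) (F : SkewSpace m n M → SkewSpace m n M) :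
    Set (SkewSpace m n M) :=
  maximalForwardInvariantSet (⋃ w ∈ S, towerRect A R w) F

/-- The tuple `((𝐑_w)_{w ∈ S}, [0,1]^{m+n} × B, (P_cs, Q_u), (π_s, π_c), θ)` associated with the
preblending machine `((R w)_{w ∈ S}, B, (P, Q))` is a split blending machine for `F` in
`ℝᵐ × ℝⁿ × N`, where `P_cs(x^s, x^u, x) = (x^s, P x)` and `Q_u(x^s, x^u, x) = (Q x, x^u)`. -/
def IsAssociatedSplitBlendingMachine {p q : ℕ} (A : AffineHorseshoe k m n ν) (N : Set M)
    (S : Finset (List (Fin k))) (R : List (Fin k) → Set M) (B : Set M)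
    (P : M → Fin p → ℝ) (Q : M → Fin q → ℝ) (F : SkewSpace m n M → SkewSpace m n M)
    (θ : ℝ) : Prop :=
  IsSplitBlendingMachine (skewModel m n d) F (univ ×ˢ N) S (towerRect A R)
    ((unitCube m ×ˢ unitCube n) ×ˢ B)
    (fun z => (z.1.1, P z.2)) (fun z => (Q z.2, z.1.2))
    (Prod.fst : (Fin m → ℝ) × (Fin p → ℝ) → (Fin m → ℝ)) Prod.snd θ

/-- The rectangle `𝐑_♯ = 𝖧_♯ × R_♯` of the transition, as a subset of the space of the second
machine, whose base is `ℝⁿ × ℝᵐ`. -/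
def transitionRect (A : AffineHorseshoe 1 m n ν) (R : Set M) : Set (SkewSpace n m M) :=
  {z | (z.1.2, z.1.1) ∈ A.leg [0] ∧ z.2 ∈ R}

/-- The map `A_♯ × φ_♯` from the space of the second machine to that of the first one. -/
def transitionBranch (A : AffineHorseshoe 1 m n ν) (φ : M → M) (z : SkewSpace n m M) :
    SkewSpace m n M :=
  (A.wordAffine [0] (z.1.2, z.1.1), φ z.2)

/-- `F` is (a `C¹` extension to the open set `U` of) the tower map of the transition. -/
structure IsTransitionTowerMap (d : ℕ) {M : Type*} [TopologicalSpace M]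
    [ChartedSpace (EuclideanSpace ℝ (Fin d)) M] (A : AffineHorseshoe 1 m n ν) (φ : M → M)
    (R : Set M) (F : SkewSpace n m M → SkewSpace m n M) (U : Set (SkewSpace n m M)) : Prop where
  isOpen : IsOpen U
  subset : transitionRect A R ⊆ U
  contMDiffOn : ContMDiffOn (skewModel n m d) (skewModel m n d) 1 F U
  agree : AgreeToFirstOrder (skewModel n m d) (skewModel m n d) F (transitionBranch A φ)
    (transitionRect A R)

end Tower

end

/-!
Both claims of the theorem rest on one observation. If cone invariance holds for *all* cone widths,
then the derivative of a dominated map is block diagonal in the coordinates `(P, Q)`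
(`exists_prodMap_of_cones`, `exists_prodMap_of_dominated`), and the dilatation condition bounds the two
blocks. A tower map is a skew product of such a map and an affine map, so in the coordinates
`((x, P), (y, Q))` of `skewCoordinates` its derivative on every rectangle is block diagonal as well
(`IsSkewExtension`). Below, `(x, P)` is called the contracted and `(y, Q)` the expanded coordinate; the
`P`-block need not contract and the `Q`-block need not expand, but adaptedness of the stretching makes
the `(y, Q)`-block expand more than the `(x, P)`-block.

*Split blending machines.* On the rectangles the derivative maps every cone strictly into a narrower
one, and by continuity so do the derivatives at nearby points (`exists_cone_bounds_of_close`,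
`IsSkewExtension.exists_coneInvariance`). The remaining conditions concern products of the given
rectangles with cubes, and the cone width has to be small only compared with the Lebesgue number.

*Intersection of the stable sets.* Every rectangle contributes a branch: for a contracted coordinate
`c` of the rectangle and an expanded coordinate `s` of the whole region there is exactly one point of
the rectangle with contracted coordinate `c` whose image has expanded coordinate `s`. A map that is
`C¹` close still has such branches, with almost the same block estimates at a small scale
(`exists_branches_of_close`, `IsSkewExtension.exists_hasBranch`). Hence one argument covers the tower
maps and their perturbations.

That argument follows families of pairs of orbits, parametrized by the expanded coordinates `(s, t)` of
their end points, `s` for the second machine and `t` for the first one (`OrbitFamily`). The transition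
map provides the initial family: its stable direction is the expanded direction of the second machine,
its unstable direction that of the first one. The contracted coordinate of either end point depends
mainly on the expanded coordinate of the *other* one, so its extent is the diameter of the other
machine's region multiplied by a rate of the transition. As long as the extent in the direction of the
fiber is below the Lebesgue number, a word can be chosen whose rectangle contains the whole family
(`BranchModel.Selects`), and the family is advanced along the branch of that word; the new expanded
coordinate is the solution of a fixed point equation (`exists_implicit_reparametrization`). Advancing
the second machine multiplies the extent for the second machine by its contraction rate and that for
the first machine by its inverse expansion rate.

First both machines are advanced simultaneously. The products of a contraction rate of one machine and
an inverse expansion rate of the other are less than `1`, so the extents become as small as desired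
(`exists_block_orbitFamily`). Afterwards the words are chosen one machine at a time. Now only domination
within each machine is used: every step decreases the product of the two extents, and each extent can be
lowered by advancing a suitable one of the machines (`exists_schedule`). Both can therefore be continued
forever, while the error terms of a perturbed map form a geometric series (`WidthState`). Finally,
compactness turns arbitrarily long orbits into infinite ones
(`exists_mem_maximalForwardInvariantSet`).
-/

noncomputable section

/-! ### Estimates at a small scale -/

/-- A map on a convex set whose increments at some scale `δ` are bounded by a positively
homogeneous function of the displacement satisfies the same bound at all scales: subdivide the
segment. -/
theorem norm_sub_le_of_small_scale {E F : Type*} [NormedAddCommGroup E] [NormedSpace ℝ E]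
    [NormedAddCommGroup F] {s : Set E} (hs : Convex ℝ s) {f : E → F} {N : E → ℝ}
    (hN : ∀ (r : ℝ) (v : E), 0 ≤ r → N (r • v) = r * N v) {δ : ℝ} (hδ : 0 < δ)
    (h : ∀ x ∈ s, ∀ y ∈ s, ‖x - y‖ < δ → ‖f x - f y‖ ≤ N (x - y))
    {x y : E} (hx : x ∈ s) (hy : y ∈ s) : ‖f x - f y‖ ≤ N (x - y) := by
  obtain ⟨k, hk⟩ := exists_nat_gt (‖x - y‖ / δ)
  have hk0 : (0 : ℝ) < k := lt_of_le_of_lt (by positivity) hk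
  have hkn : k ≠ 0 := by
    rintro rfl
    simp at hk0
  set p : ℕ → E := fun j => y + ((j : ℝ) / k) • (x - y) with hp
  have hmem : ∀ j ≤ k, p j ∈ s := fun j hj =>
    hs.add_smul_sub_mem hy hx ⟨by positivity, by
      rw [div_le_one hk0]
      exact_mod_cast hj⟩
  have hstep : ∀ j, p (j + 1) - p j = (1 / (k : ℝ)) • (x - y) := by
    intro j
    simp only [hp, add_sub_add_left_eq_sub, ← sub_smul]
    congr 1
    push_cast
    ring
  have hb : ∀ j < k, ‖f (p (j + 1)) - f (p j)‖ ≤ 1 / k * N (x - y) := by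
    intro j hj
    rw [← hN _ _ (by positivity), ← hstep j]
    refine h _ (hmem _ hj) _ (hmem _ hj.le) ?_
    rw [hstep, norm_smul, Real.norm_of_nonneg (by positivity), one_div, inv_mul_lt_iff₀ hk0]
    rwa [div_lt_iff₀ hδ] at hk
  have h0 : p 0 = y := by simp [hp]
  have h1 : p k = x := by simp [hp, div_self hk0.ne']
  calc ‖f x - f y‖ = ‖∑ j ∈ Finset.range k, (f (p (j + 1)) - f (p j))‖ := by
        rw [Finset.sum_range_sub (fun j => f (p j)), h0, h1]
    _ ≤ ∑ j ∈ Finset.range k, ‖f (p (j + 1)) - f (p j)‖ := norm_sum_le _ _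
    _ ≤ ∑ _j ∈ Finset.range k, 1 / k * N (x - y) :=
        Finset.sum_le_sum fun j hj => hb j (Finset.mem_range.1 hj)
    _ = N (x - y) := by
        rw [Finset.sum_const, Finset.card_range, nsmul_eq_mul]
        field_simp

/-- The two components of `v` are bounded by multiples of the corresponding components of `w`, up
to the error `e`. -/
def BlockBound {V V' W W' : Type*} [Norm V] [Norm V'] [Norm W] [Norm W']
    (v : V × V') (w : W × W') (l l' e : ℝ) : Prop :=
  ‖v.1‖ ≤ l * ‖w.1‖ + e ∧ ‖v.2‖ ≤ l' * ‖w.2‖ + e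

theorem BlockBound.norm_le {V V' W W' : Type*} [NormedAddCommGroup V] [NormedAddCommGroup V']
    [NormedAddCommGroup W] [NormedAddCommGroup W'] {v : V × V'} {w : W × W'} {l l' e a : ℝ}
    (h : BlockBound v w l l' e) (ha : 0 ≤ a) (hl : l ≤ a) (hl' : l' ≤ a) :
    ‖v‖ ≤ a * ‖w‖ + e := by
  rw [Prod.norm_def]
  refine max_le (h.1.trans ?_) (h.2.trans ?_)
  · gcongr
    exact norm_fst_le w
  · gcongr
    exact norm_snd_le w

theorem BlockBound.mono {V V' W W' : Type*} [NormedAddCommGroup V] [NormedAddCommGroup V']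
    [NormedAddCommGroup W] [NormedAddCommGroup W'] {v : V × V'} {w : W × W'}
    {l l' e k k' e' : ℝ} (h : BlockBound v w l l' e) (hl : l ≤ k) (hl' : l' ≤ k') (he : e ≤ e') :
    BlockBound v w k k' e' :=
  ⟨h.1.trans (by gcongr), h.2.trans (by gcongr)⟩

section Advance

variable {C U V : Type*} [NormedAddCommGroup C] [NormedAddCommGroup U] [NormedSpace ℝ U]
  [NormedAddCommGroup V]

/-- The equation `σ = h (c (σ, t), s)` has a solution `σ (s, t)`, depending uniformly continuously
on `(s, t)`, as soon as `h` depends sufficiently weakly on its first argument. -/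
theorem exists_implicit_reparametrization {Zu : Set U} {Zv : Set V} (hZ : IsComplete Zu)
    (hconv : Convex ℝ Zu) (hne : Zu.Nonempty) {D : Set C} {h : C → U → U} {c : U → V → C}
    (hc : ∀ s ∈ Zu, ∀ t ∈ Zv, c s t ∈ D) (hmem : ∀ x ∈ D, ∀ s ∈ Zu, h x s ∈ Zu)
    {κ b δ θ L δ₀ : ℝ} (hκ : 0 ≤ κ) (hb : 0 ≤ b) (hθ : 0 ≤ θ) (hL : 0 ≤ L) (hκθ : κ * θ < 1)
    (hδ : 0 < δ) (hδ₀ : 0 < δ₀)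
    (hh : ∀ x ∈ D, ∀ x' ∈ D, ∀ s ∈ Zu, ∀ s' ∈ Zu, ‖x - x'‖ < δ → ‖s - s'‖ < δ →
      ‖h x s - h x' s'‖ ≤ b * ‖s - s'‖ + κ * ‖x - x'‖)
    (hcl : ∀ s ∈ Zu, ∀ s' ∈ Zu, ∀ t ∈ Zv, ∀ t' ∈ Zv, ‖s - s'‖ < δ₀ → ‖t - t'‖ < δ₀ →
      ‖c s t - c s' t'‖ ≤ θ * ‖s - s'‖ + L * ‖t - t'‖) :
    ∃ σ : U → V → U,
      (∀ s ∈ Zu, ∀ t ∈ Zv, σ s t ∈ Zu ∧ h (c (σ s t) t) s = σ s t) ∧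
      ∀ ε > 0, ∃ δ' > 0, ∀ s ∈ Zu, ∀ s' ∈ Zu, ∀ t ∈ Zv, ∀ t' ∈ Zv,
        ‖s - s'‖ < δ' → ‖t - t'‖ < δ' →
        ‖σ s t - σ s' t'‖ < ε ∧ ‖c (σ s t) t - c (σ s' t') t'‖ < ε := by
  -- for fixed `s`, `t` the right hand side is a `κ θ`-contraction of `Zu`
  have hlip : ∀ s ∈ Zu, ∀ t ∈ Zv, ∀ x ∈ Zu, ∀ y ∈ Zu,
      ‖h (c x t) s - h (c y t) s‖ ≤ κ * θ * ‖x - y‖ := by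
    intro s hs t ht x hx y hy
    have hpos : 0 < min δ₀ (δ / (θ + 1)) := lt_min hδ₀ (by positivity)
    refine norm_sub_le_of_small_scale (f := fun x => h (c x t) s) (N := fun v => κ * θ * ‖v‖)
      hconv ?_ hpos ?_ hx hy
    · intro r v hr
      simp only [norm_smul, Real.norm_of_nonneg hr]
      ring
    · intro x hx y hy hxy
      have h1 : ‖c x t - c y t‖ ≤ θ * ‖x - y‖ := by
        have := hcl x hx y hy t ht t ht (hxy.trans_le (min_le_left _ _)) (by simpa using hδ₀)
        simpa using this
      have h2 : ‖c x t - c y t‖ < δ := by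
        have h3 : ‖x - y‖ < δ / (θ + 1) := hxy.trans_le (min_le_right _ _)
        rw [lt_div_iff₀ (by positivity)] at h3
        nlinarith [norm_nonneg (x - y)]
      have h4 := hh _ (hc x hx t ht) _ (hc y hy t ht) s hs s hs h2 (by simpa using hδ)
      simp only [sub_self, norm_zero, mul_zero, zero_add] at h4
      calc _ ≤ κ * ‖c x t - c y t‖ := h4
        _ ≤ κ * (θ * ‖x - y‖) := by gcongr
        _ = _ := by ring
  have hex : ∀ s t, ∃ x, s ∈ Zu → t ∈ Zv → x ∈ Zu ∧ h (c x t) s = x := by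
    intro s t
    by_cases hst : s ∈ Zu ∧ t ∈ Zv
    · obtain ⟨hs, ht⟩ := hst
      have : CompleteSpace Zu := hZ.completeSpace_coe
      have : Nonempty Zu := hne.to_subtype
      let Φ : Zu → Zu := fun x => ⟨h (c x t) s, hmem _ (hc _ x.2 _ ht) _ hs⟩
      have hΦ : ContractingWith ⟨κ * θ, by positivity⟩ Φ := by
        refine ⟨?_, LipschitzWith.of_dist_le_mul fun x y => ?_⟩
        · exact_mod_cast hκθ
        · rw [Subtype.dist_eq, Subtype.dist_eq, dist_eq_norm, dist_eq_norm]
          exact hlip s hs t ht x x.2 y y.2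
      refine ⟨(ContractingWith.fixedPoint Φ hΦ : Zu), fun _ _ => ⟨Subtype.property _, ?_⟩⟩
      exact congrArg Subtype.val hΦ.fixedPoint_isFixedPt
    · exact ⟨s, fun hs ht => absurd ⟨hs, ht⟩ hst⟩
  choose σ hσ using hex
  refine ⟨σ, fun s hs t ht => hσ s t hs ht, fun ε hε => ?_⟩
  -- the solutions depend on the parameters in a Lipschitz way at a small scale
  set q : ℝ := 1 - κ * θ with hq
  have hq0 : 0 < q := by linarith
  set M : ℝ := (b + κ * L) / q with hM
  have hM0 : 0 ≤ M := by positivity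
  set δ' : ℝ := min (min δ δ₀) (min (δ / (L + 1))
    (min (δ₀ / (M + 1)) (ε / (M + θ * M + L + 1)))) with hδ'
  have hδ'0 : 0 < δ' := by
    refine lt_min (lt_min hδ hδ₀) (lt_min ?_ (lt_min ?_ ?_)) <;> positivity
  refine ⟨δ', hδ'0, fun s hs s' hs' t ht t' ht' hss htt => ?_⟩
  obtain ⟨hx, hxe⟩ := hσ s t hs ht
  obtain ⟨hy, hye⟩ := hσ s' t' hs' ht'
  set x := σ s t
  set y := σ s' t'
  have e1 : δ' ≤ δ := (min_le_left _ _).trans (min_le_left _ _)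
  have e2 : δ' ≤ δ₀ := (min_le_left _ _).trans (min_le_right _ _)
  have e3 : δ' * (L + 1) ≤ δ := by
    rw [← le_div_iff₀ (by positivity)]
    exact (min_le_right _ _).trans (min_le_left _ _)
  have e4 : δ' * (M + 1) ≤ δ₀ := by
    rw [← le_div_iff₀ (by positivity)]
    exact (min_le_right _ _).trans ((min_le_right _ _).trans (min_le_left _ _))
  have e5 : δ' * (M + θ * M + L + 1) ≤ ε := by
    rw [← le_div_iff₀ (by positivity)]
    exact (min_le_right _ _).trans ((min_le_right _ _).trans (min_le_right _ _))
  have h1 : ‖c y t - c y t'‖ ≤ L * ‖t - t'‖ := by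
    have := hcl y hy y hy t ht t' ht' (by simpa using hδ₀) (htt.trans_le e2)
    simpa using this
  have h1' : ‖c y t - c y t'‖ < δ := by nlinarith [norm_nonneg (t - t')]
  have h2 := hh _ (hc y hy t ht) _ (hc y hy t' ht') s hs s' hs' h1' (hss.trans_le e1)
  have h3 := hlip s hs t ht x hx y hy
  have h4 : ‖x - y‖ ≤ κ * θ * ‖x - y‖ + (b * ‖s - s'‖ + κ * ‖c y t - c y t'‖) := by
    calc ‖x - y‖ = ‖(h (c x t) s - h (c y t) s) + (h (c y t) s - h (c y t') s')‖ := by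
          rw [sub_add_sub_cancel, hxe, hye]
      _ ≤ _ := (norm_add_le _ _).trans (add_le_add h3 h2)
  have h5 : q * ‖x - y‖ ≤ (b + κ * L) * δ' := by
    have : κ * ‖c y t - c y t'‖ ≤ κ * (L * δ') := by
      gcongr
      exact h1.trans (by gcongr)
    have : b * ‖s - s'‖ ≤ b * δ' := by gcongr
    nlinarith
  have h6 : ‖x - y‖ ≤ M * δ' := by
    rw [hM, div_mul_eq_mul_div, le_div_iff₀ hq0]
    linarith
  have h7 : ‖x - y‖ < δ₀ := by nlinarith
  have h8 := hcl x hx y hy t ht t' ht' h7 (htt.trans_le e2)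
  constructor
  · nlinarith [mul_nonneg hθ hM0, mul_nonneg (mul_nonneg hθ hM0) hδ'0.le, mul_nonneg hL hδ'0.le]
  · have : θ * ‖x - y‖ ≤ θ * (M * δ') := by gcongr
    have : L * ‖t - t'‖ ≤ L * δ' := by gcongr
    nlinarith [mul_nonneg hM0 hδ'0.le]

end Advance

/-! ### Scheduling the two machines -/

/-- If a step lowers `x` by the factor `lam`, does not increase the product of the widths and
increases `y` at most by the factor `D`, then repeating it makes `x` smaller than `X / D`. As `y` is
multiplied by `D` at most and `Y` is small, `y` stays below `X / D` as long as `x` is above it. -/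
theorem exists_lowered_state {Good : ℕ → ℕ → ℝ → ℝ → Prop} {X Y D lam : ℝ} (hD : 1 ≤ D)
    (hX : 0 < X) (hY : Y * D ^ 3 ≤ X ^ 2) (hlam0 : 0 < lam) (hlam1 : lam < 1)
    (pos : ∀ n m x y, Good n m x y → 0 < x ∧ 0 < y)
    (step : ∀ n m x y, Good n m x y → x ≤ X → y ≤ X → ∃ n' m' a b, n ≤ n' ∧ m ≤ m' ∧
      Good n' m' (a * x) (b * y) ∧ a ≤ lam ∧ b ≤ D ∧ a * b ≤ lam)
    {n m : ℕ} {x y : ℝ} (h : Good n m x y) (hx : x ≤ X) (hy : y ≤ X / D) (hxy : x * y ≤ Y) :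
    ∃ n' m' x' y', n ≤ n' ∧ m ≤ m' ∧ Good n' m' x' y' ∧ x' ≤ X / D ∧ y' ≤ X / D ∧
      x' * y' ≤ Y := by
  have hD0 : 0 < D := by linarith
  have main : ∀ k n m x y, Good n m x y → x ≤ X → y ≤ X / D → x * y ≤ Y →
      x * lam ^ k ≤ X / D → ∃ n' m' x' y', n ≤ n' ∧ m ≤ m' ∧ Good n' m' x' y' ∧
        x' ≤ X / D ∧ y' ≤ X / D ∧ x' * y' ≤ Y := by
    intro k
    induction k with
    | zero => exact fun n m x y h hx hy hxy hk => ⟨n, m, x, y, le_rfl, le_rfl, h, by simpa using hk,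
        hy, hxy⟩
    | succ k ih =>
      intro n m x y h hx hy hxy hk
      by_cases hxs : x ≤ X / D
      · exact ⟨n, m, x, y, le_rfl, le_rfl, h, hxs, hy, hxy⟩
      push Not at hxs
      obtain ⟨hx0, hy0⟩ := pos _ _ _ _ h
      have hXD : X / D ≤ X := div_le_self hX.le hD
      obtain ⟨n', m', a, b, hn, hm, h', ha, hb, hab⟩ := step n m x y h hx (hy.trans hXD)
      have hax : a * x ≤ lam * x := by gcongr
      have hx1 : a * x ≤ X := by nlinarith
      have hy1 : b * y ≤ X / D := by
        rw [div_lt_iff₀ hD0] at hxs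
        have h1 : X * y ≤ Y * D := by nlinarith
        have h2 : b * y ≤ D * y := by gcongr
        rw [le_div_iff₀ hD0]
        have h3 : X * (D * y * D) ≤ X * X := by nlinarith [mul_pos hD0 hD0]
        have h4 := le_of_mul_le_mul_left h3 hX
        nlinarith
      have hxy1 : a * x * (b * y) ≤ Y := by
        have : a * x * (b * y) = (a * b) * (x * y) := by ring
        rw [this]
        nlinarith [mul_pos hx0 hy0]
      obtain ⟨n'', m'', x', y', hn', hm', r⟩ := ih n' m' _ _ h' hx1 hy1 hxy1 (by
        calc a * x * lam ^ k ≤ lam * x * lam ^ k := by gcongr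
          _ = x * lam ^ (k + 1) := by ring
          _ ≤ _ := hk)
      exact ⟨n'', m'', x', y', hn.trans hn', hm.trans hm', r⟩
  obtain ⟨k, hk⟩ := exists_pow_lt_of_lt_one (show 0 < X / D / X by positivity) hlam1
  refine main k n m x y h hx hy hxy ?_
  rw [lt_div_iff₀ hX] at hk
  have := pos _ _ _ _ h
  have : 0 < lam ^ k := by positivity
  nlinarith

/-- Two machines are advanced one at a time, `n` and `m` counting the steps and `x`, `y` being the
widths that must stay below `X`. Advancing the second machine along `i` multiplies `(x, y)` by
`(A₂ i, B₂ i)`, advancing the first one along `j` multiplies it by `(B₁ j, A₁ j)`; one does not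
choose `i` and `j`. Both machines can be advanced arbitrarily often if the product `x y`
always decreases, and each of `x`, `y` is lowered by advancing a suitable one of the machines. -/
theorem exists_schedule {ι₁ ι₂ : Type*} {S₁ : Finset ι₁} {S₂ : Finset ι₂} {A₁ B₁ : ι₁ → ℝ}
    {A₂ B₂ : ι₂ → ℝ} {Good : ℕ → ℕ → ℝ → ℝ → Prop} {X Y D lam : ℝ} (hD : 1 ≤ D)
    (hX : 0 < X) (hY : Y * D ^ 3 ≤ X ^ 2) (hlam0 : 0 < lam) (hlam1 : lam < 1)
    (hA₁ : ∀ j ∈ S₁, A₁ j ≤ D) (hB₁ : ∀ j ∈ S₁, B₁ j ≤ D) (hAB₁ : ∀ j ∈ S₁, A₁ j * B₁ j ≤ lam)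
    (hA₂ : ∀ i ∈ S₂, A₂ i ≤ D) (hB₂ : ∀ i ∈ S₂, B₂ i ≤ D) (hAB₂ : ∀ i ∈ S₂, A₂ i * B₂ i ≤ lam)
    (hx : (∀ i ∈ S₂, A₂ i ≤ lam) ∨ ∀ j ∈ S₁, B₁ j ≤ lam)
    (hy : (∀ j ∈ S₁, A₁ j ≤ lam) ∨ ∀ i ∈ S₂, B₂ i ≤ lam)
    (pos : ∀ n m x y, Good n m x y → 0 < x ∧ 0 < y)
    (adv₂ : ∀ n m x y, Good n m x y → x ≤ X → y ≤ X →
      ∃ i ∈ S₂, Good (n + 1) m (A₂ i * x) (B₂ i * y))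
    (adv₁ : ∀ n m x y, Good n m x y → x ≤ X → y ≤ X →
      ∃ j ∈ S₁, Good n (m + 1) (B₁ j * x) (A₁ j * y))
    {n₀ m₀ : ℕ} {x₀ y₀ : ℝ} (start : Good n₀ m₀ x₀ y₀) (hx₀ : x₀ ≤ X) (hy₀ : y₀ ≤ X)
    (hxy₀ : x₀ * y₀ ≤ Y) (N : ℕ) : ∃ n m x y, N ≤ n ∧ N ≤ m ∧ Good n m x y := by
  have hD0 : 0 < D := by linarith
  have hXD : X / D ≤ X := div_le_self hX.le hD
  have stepx : ∀ n m x y, Good n m x y → x ≤ X → y ≤ X → ∃ n' m' a b, n ≤ n' ∧ m ≤ m' ∧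
      Good n' m' (a * x) (b * y) ∧ a ≤ lam ∧ b ≤ D ∧ a * b ≤ lam := by
    intro n m x y h hxX hyX
    rcases hx with hx | hx
    · obtain ⟨i, hi, h'⟩ := adv₂ n m x y h hxX hyX
      exact ⟨n + 1, m, A₂ i, B₂ i, by omega, le_rfl, h', hx i hi, hB₂ i hi, hAB₂ i hi⟩
    · obtain ⟨j, hj, h'⟩ := adv₁ n m x y h hxX hyX
      exact ⟨n, m + 1, B₁ j, A₁ j, le_rfl, by omega, h', hx j hj, hA₁ j hj, by
        rw [mul_comm]
        exact hAB₁ j hj⟩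
  have stepy : ∀ n m y x, Good n m x y → y ≤ X → x ≤ X → ∃ n' m' a b, n ≤ n' ∧ m ≤ m' ∧
      Good n' m' (b * x) (a * y) ∧ a ≤ lam ∧ b ≤ D ∧ a * b ≤ lam := by
    intro n m y x h hyX hxX
    rcases hy with hy | hy
    · obtain ⟨j, hj, h'⟩ := adv₁ n m x y h hxX hyX
      exact ⟨n, m + 1, A₁ j, B₁ j, le_rfl, by omega, h', hy j hj, hB₁ j hj, hAB₁ j hj⟩
    · obtain ⟨i, hi, h'⟩ := adv₂ n m x y h hxX hyX
      exact ⟨n + 1, m, B₂ i, A₂ i, by omega, le_rfl, h', hy i hi, hA₂ i hi, by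
        rw [mul_comm]
        exact hAB₂ i hi⟩
  -- from every admissible state both widths can be made smaller than `X / D`
  have prep : ∀ n m x y, Good n m x y → x ≤ X → y ≤ X → x * y ≤ Y →
      ∃ n' m' x' y', n ≤ n' ∧ m ≤ m' ∧ Good n' m' x' y' ∧ x' ≤ X / D ∧ y' ≤ X / D ∧
        x' * y' ≤ Y := by
    intro n m x y h hxX hyX hxy
    have key : ∀ u v : ℝ, 0 < u → 0 < v → u * v ≤ Y → X / D < u → v ≤ X / D := by
      intro u v hu hv huv hlt
      rw [div_lt_iff₀ hD0] at hlt
      rw [le_div_iff₀ hD0]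
      have h1 : X * v ≤ Y * D := by nlinarith
      have hD2 : D ^ 2 ≤ D ^ 3 := pow_le_pow_right₀ hD (by norm_num)
      have hY0 : 0 < Y := lt_of_lt_of_le (mul_pos hu hv) huv
      have h3 : X * (v * D) ≤ X * X := by nlinarith
      exact le_of_mul_le_mul_left h3 hX
    obtain ⟨hx0, hy0⟩ := pos _ _ _ _ h
    by_cases hy' : y ≤ X / D
    · exact exists_lowered_state hD hX hY hlam0 hlam1 pos stepx h hxX hy' hxy
    · have hx' : x ≤ X / D := key y x hy0 hx0 (by rwa [mul_comm]) (not_le.1 hy')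
      obtain ⟨n', m', y', x', hn, hm, h', h1, h2, h3⟩ :=
        exists_lowered_state (Good := fun n m y x => Good n m x y) hD hX hY hlam0 hlam1
          (fun n m y x h => (pos n m x y h).symm) stepy h hyX hx' (by rwa [mul_comm])
      exact ⟨n', m', x', y', hn, hm, h', h2, h1, by rwa [mul_comm]⟩
  have grow : ∀ n m x y, Good n m x y → x ≤ X → y ≤ X → x * y ≤ Y →
      ∃ n' m' x' y', n + 1 ≤ n' ∧ m + 1 ≤ m' ∧ Good n' m' x' y' ∧ x' ≤ X ∧ y' ≤ X ∧
        x' * y' ≤ Y := by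
    have bound : ∀ a u : ℝ, 0 < u → a ≤ D → u ≤ X / D → a * u ≤ X := by
      intro a u hu ha hle
      rw [le_div_iff₀ hD0] at hle
      nlinarith
    have prod : ∀ a b u v : ℝ, 0 < u → 0 < v → a * b ≤ lam → u * v ≤ Y →
        a * u * (b * v) ≤ Y := by
      intro a b u v hu hv hab huv
      have : a * u * (b * v) = a * b * (u * v) := by ring
      rw [this]
      nlinarith [mul_pos hu hv]
    intro n m x y h h1 h2 h3
    obtain ⟨n₁, m₁, x₁, y₁, hn₁, hm₁, g₁, p₁, q₁, r₁⟩ := prep n m x y h h1 h2 h3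
    obtain ⟨hx1, hy1⟩ := pos _ _ _ _ g₁
    obtain ⟨i, hi, g₂⟩ := adv₂ _ _ _ _ g₁ (p₁.trans hXD) (q₁.trans hXD)
    obtain ⟨n₂, m₂, x₂, y₂, hn₂, hm₂, g₃, p₃, q₃, r₃⟩ := prep _ _ _ _ g₂
      (bound _ _ hx1 (hA₂ i hi) p₁) (bound _ _ hy1 (hB₂ i hi) q₁)
      (prod _ _ _ _ hx1 hy1 (hAB₂ i hi) r₁)
    obtain ⟨hx2, hy2⟩ := pos _ _ _ _ g₃
    obtain ⟨j, hj, g₄⟩ := adv₁ _ _ _ _ g₃ (p₃.trans hXD) (q₃.trans hXD)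
    exact ⟨n₂, m₂ + 1, _, _, by omega, by omega, g₄, bound _ _ hx2 (hB₁ j hj) p₃,
      bound _ _ hy2 (hA₁ j hj) q₃, prod _ _ _ _ hx2 hy2 (by
        rw [mul_comm]
        exact hAB₁ j hj) r₃⟩
  have main : ∀ N : ℕ, ∃ n m x y, N ≤ n ∧ N ≤ m ∧ Good n m x y ∧ x ≤ X ∧ y ≤ X ∧ x * y ≤ Y := by
    intro N
    induction N with
    | zero => exact ⟨n₀, m₀, x₀, y₀, Nat.zero_le _, Nat.zero_le _, start, hx₀, hy₀, hxy₀⟩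
    | succ N ih =>
      obtain ⟨n, m, x, y, hn, hm, h, h1, h2, h3⟩ := ih
      obtain ⟨n', m', x', y', hn', hm', r⟩ := grow n m x y h h1 h2 h3
      exact ⟨n', m', x', y', by omega, by omega, r⟩
  obtain ⟨n, m, x, y, hn, hm, h, -⟩ := main N
  exact ⟨n, m, x, y, hn, hm, h⟩

/-! ### Machines in coordinates -/

/-- The data of a blending machine in coordinates that do not change under perturbations. Points
have a contracted coordinate in `Cx × Cq` and an expanded coordinate in `Ux × Uq`; the first
factors belong to the horseshoe map, the second ones to the fiber. The branch `i` is defined where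
the contracted coordinate lies in `dom i` and its image covers all of `fiber` in the expanded
direction; its images have contracted coordinate in `base`. The rates are those of the horseshoe
(`strong`, contraction of `Cx` and of the inverse on `Ux`), of the contraction of `Cq` (`contr`) and
of the contraction of the inverse on `Uq` (`inv`). -/
structure BranchModel (ι Cx Cq Ux Uq : Type*) where
  index : Finset ι
  dom : ι → Set (Cx × Cq)
  base : Set (Cx × Cq)
  fiber : Set (Ux × Uq)
  strong : ι → ℝ
  contr : ι → ℝ
  inv : ι → ℝ

/-- A map of `X` with local coordinates, `point` being the inverse of the coordinate map, together
with its branches: `branchU i c s` is the expanded coordinate of the point that has contracted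
coordinate `c` and whose image has expanded coordinate `s`, and `branchC i c s` is the contracted
coordinate of that image. Orbits are required to stay in `K`. -/
structure BranchDynamics (ι X Cx Cq Ux Uq : Type*) where
  map : X → X
  K : Set X
  point : Cx × Cq → Ux × Uq → X
  branchU : ι → Cx × Cq → Ux × Uq → Ux × Uq
  branchC : ι → Cx × Cq → Ux × Uq → Cx × Cq

section Model

variable {ι Cx Cq Ux Uq X : Type*} [NormedAddCommGroup Cx] [NormedAddCommGroup Cq]
  [NormedAddCommGroup Ux] [NormedAddCommGroup Uq]

/-- The dynamics `d` has the branches prescribed by the model, and at a small scale these are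
block diagonal with the rates of the model, up to an error `κ`. -/
structure BranchModel.Realizes (m : BranchModel ι Cx Cq Ux Uq)
    (d : BranchDynamics ι X Cx Cq Ux Uq) (κ : ℝ) : Prop where
  mem_fiber : ∀ i ∈ m.index, ∀ c ∈ m.dom i, ∀ s ∈ m.fiber, d.branchU i c s ∈ m.fiber
  mem_base : ∀ i ∈ m.index, ∀ c ∈ m.dom i, ∀ s ∈ m.fiber, d.branchC i c s ∈ m.base
  mem_K : ∀ i ∈ m.index, ∀ c ∈ m.dom i, ∀ s ∈ m.fiber, d.point c (d.branchU i c s) ∈ d.K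
  map_eq : ∀ i ∈ m.index, ∀ c ∈ m.dom i, ∀ s ∈ m.fiber,
    d.map (d.point c (d.branchU i c s)) = d.point (d.branchC i c s) s
  estimates : ∀ i ∈ m.index, ∃ δ > 0, ∀ c ∈ m.dom i, ∀ c' ∈ m.dom i, ∀ s ∈ m.fiber,
    ∀ s' ∈ m.fiber, ‖c - c'‖ < δ → ‖s - s'‖ < δ →
    BlockBound (d.branchU i c s - d.branchU i c' s') (s - s') (m.strong i) (m.inv i)
      (κ * max ‖c - c'‖ ‖s - s'‖) ∧
    BlockBound (d.branchC i c s - d.branchC i c' s') (c - c') (m.strong i) (m.contr i)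
      (κ * max ‖c - c'‖ ‖s - s'‖)

/-- Every subset of the base whose extent in the `Cq` direction is smaller than `Δ` lies in the
domain of a single branch. -/
def BranchModel.Selects (m : BranchModel ι Cx Cq Ux Uq) (Δ : ℝ) : Prop :=
  ∀ T ⊆ m.base, ∀ e : ℝ, 0 ≤ e → e < Δ → (∀ x ∈ T, ∀ y ∈ T, ‖(x - y).2‖ ≤ e) →
    ∃ i ∈ m.index, T ⊆ m.dom i

variable [NormedSpace ℝ Ux] [NormedSpace ℝ Uq]

theorem BranchModel.Realizes.exists_reparametrization {V : Type*} [NormedAddCommGroup V]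
    {m : BranchModel ι Cx Cq Ux Uq} {d : BranchDynamics ι X Cx Cq Ux Uq} {κ : ℝ}
    (hd : m.Realizes d κ) (hcomp : IsComplete m.fiber) (hconv : Convex ℝ m.fiber)
    (hne : m.fiber.Nonempty) {i : ι} (hi : i ∈ m.index) (hstrong : 0 ≤ m.strong i)
    {Zv : Set V} {c : Ux × Uq → V → Cx × Cq} (hc : ∀ s ∈ m.fiber, ∀ t ∈ Zv, c s t ∈ m.dom i)
    {θ L δ₀ : ℝ} (hκ : 0 ≤ κ) (hθ : 0 ≤ θ) (hL : 0 ≤ L) (hκθ : κ * θ < 1) (hδ₀ : 0 < δ₀)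
    (hcl : ∀ s ∈ m.fiber, ∀ s' ∈ m.fiber, ∀ t ∈ Zv, ∀ t' ∈ Zv, ‖s - s'‖ < δ₀ → ‖t - t'‖ < δ₀ →
      ‖c s t - c s' t'‖ ≤ θ * ‖s - s'‖ + L * ‖t - t'‖) :
    ∃ σ : Ux × Uq → V → Ux × Uq,
      (∀ s ∈ m.fiber, ∀ t ∈ Zv, σ s t ∈ m.fiber ∧ d.branchU i (c (σ s t) t) s = σ s t) ∧
      ∀ ε > 0, ∃ δ > 0, ∀ s ∈ m.fiber, ∀ s' ∈ m.fiber, ∀ t ∈ Zv, ∀ t' ∈ Zv,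
        ‖s - s'‖ < δ → ‖t - t'‖ < δ → ‖σ s t - σ s' t'‖ < ε ∧
        BlockBound (σ s t - σ s' t') (s - s') (m.strong i) (m.inv i)
          (κ * max ‖c (σ s t) t - c (σ s' t') t'‖ ‖s - s'‖) ∧
        BlockBound (d.branchC i (c (σ s t) t) s - d.branchC i (c (σ s' t') t') s')
          (c (σ s t) t - c (σ s' t') t') (m.strong i) (m.contr i)
          (κ * max ‖c (σ s t) t - c (σ s' t') t'‖ ‖s - s'‖) := by
  obtain ⟨δ, hδ, hest⟩ := hd.estimates i hi
  set b : ℝ := max (m.strong i) (m.inv i) with hb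
  have hb0 : 0 ≤ b := le_max_of_le_left hstrong
  obtain ⟨σ, hσ, hσu⟩ := exists_implicit_reparametrization (h := d.branchU i) (b := b + κ)
    hcomp hconv hne hc (hd.mem_fiber i hi) hκ (by positivity) hθ hL hκθ hδ hδ₀
    (fun x hx x' hx' s hs s' hs' h1 h2 => by
      have h := (hest x hx x' hx' s hs s' hs' h1 h2).1.norm_le hb0 (le_max_left _ _)
        (le_max_right _ _)
      have h3 : max ‖x - x'‖ ‖s - s'‖ ≤ ‖x - x'‖ + ‖s - s'‖ :=
        max_le_add_of_nonneg (norm_nonneg _) (norm_nonneg _)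
      nlinarith [mul_le_mul_of_nonneg_left h3 hκ]) hcl
  refine ⟨σ, hσ, fun ε hε => ?_⟩
  obtain ⟨δ', hδ', h⟩ := hσu (min ε δ) (lt_min hε hδ)
  refine ⟨min δ δ', lt_min hδ hδ', fun s hs s' hs' t ht t' ht' hss htt => ?_⟩
  obtain ⟨h1, h2⟩ := h s hs s' hs' t ht t' ht' (hss.trans_le (min_le_right _ _))
    (htt.trans_le (min_le_right _ _))
  have hx := hσ s hs t ht
  have hy := hσ s' hs' t' ht'
  have := hest _ (hc _ hx.1 t ht) _ (hc _ hy.1 t' ht') s hs s' hs'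
    (h2.trans_le (min_le_right _ _)) (hss.trans_le (min_le_left _ _))
  rw [hx.2, hy.2] at this
  exact ⟨h1.trans_le (min_le_left _ _), this⟩

end Model

/-! ### Families of joint orbits -/

/-- `x₂` and `x₁` are reached after `n` and `m` steps of two dynamics from a pair of points in the
relation `Rel`, the orbits staying in the prescribed sets `K`. -/
def JointOrbit {ι₁ ι₂ X₁ X₂ Cx₁ Cq₁ Ux₁ Uq₁ Cx₂ Cq₂ Ux₂ Uq₂ : Type*}
    (d₂ : BranchDynamics ι₂ X₂ Cx₂ Cq₂ Ux₂ Uq₂) (d₁ : BranchDynamics ι₁ X₁ Cx₁ Cq₁ Ux₁ Uq₁)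
    (Rel : X₂ → X₁ → Prop) (n m : ℕ) (x₂ : X₂) (x₁ : X₁) : Prop :=
  ∃ z w, Rel z w ∧ d₂.map^[n] z = x₂ ∧ d₁.map^[m] w = x₁ ∧ (∀ j < n, d₂.map^[j] z ∈ d₂.K) ∧
    ∀ j < m, d₁.map^[j] w ∈ d₁.K

/-- The graphs of `c₂` and `c₁` describe a family of joint orbits of lengths `n` and `m`,
parametrized by the expanded coordinates of their end points. -/
def OrbitFamily {ι₁ ι₂ X₁ X₂ Cx₁ Cq₁ Ux₁ Uq₁ Cx₂ Cq₂ Ux₂ Uq₂ : Type*}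
    (m₂ : BranchModel ι₂ Cx₂ Cq₂ Ux₂ Uq₂) (d₂ : BranchDynamics ι₂ X₂ Cx₂ Cq₂ Ux₂ Uq₂)
    (m₁ : BranchModel ι₁ Cx₁ Cq₁ Ux₁ Uq₁) (d₁ : BranchDynamics ι₁ X₁ Cx₁ Cq₁ Ux₁ Uq₁)
    (Rel : X₂ → X₁ → Prop) (n m : ℕ) (c₂ : Ux₂ × Uq₂ → Ux₁ × Uq₁ → Cx₂ × Cq₂)
    (c₁ : Ux₁ × Uq₁ → Ux₂ × Uq₂ → Cx₁ × Cq₁) : Prop :=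
  ∀ s ∈ m₂.fiber, ∀ t ∈ m₁.fiber, c₂ s t ∈ m₂.base ∧ c₁ t s ∈ m₁.base ∧
    JointOrbit d₂ d₁ Rel n m (d₂.point (c₂ s t) s) (d₁.point (c₁ t s) t)

/-- At a small scale, the components of `c s t` depend only on the corresponding components of `t`,
with Lipschitz constants `l` and `l'`, up to an error with Lipschitz constant `e`. -/
def SmallScaleBlock {Cx Cq U Vx Vq : Type*} [NormedAddCommGroup Cx] [NormedAddCommGroup Cq]
    [NormedAddCommGroup U] [NormedAddCommGroup Vx] [NormedAddCommGroup Vq] (Zu : Set U)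
    (Zv : Set (Vx × Vq)) (c : U → Vx × Vq → Cx × Cq) (l l' e : ℝ) : Prop :=
  ∃ δ > 0, ∀ s ∈ Zu, ∀ s' ∈ Zu, ∀ t ∈ Zv, ∀ t' ∈ Zv, ‖s - s'‖ < δ → ‖t - t'‖ < δ →
    BlockBound (c s t - c s' t') (t - t') l l' (e * max ‖s - s'‖ ‖t - t'‖)

/-- At a small scale, `c s t` is Lipschitz with constant `θ` in `s` and `L` in `t`. -/
def SmallScaleLipschitz {C U V : Type*} [NormedAddCommGroup C] [NormedAddCommGroup U]
    [NormedAddCommGroup V] (Zu : Set U) (Zv : Set V) (c : U → V → C) (θ L : ℝ) : Prop :=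
  ∃ δ > 0, ∀ s ∈ Zu, ∀ s' ∈ Zu, ∀ t ∈ Zv, ∀ t' ∈ Zv, ‖s - s'‖ < δ → ‖t - t'‖ < δ →
    ‖c s t - c s' t'‖ ≤ θ * ‖s - s'‖ + L * ‖t - t'‖

section Steps

variable {ι₁ ι₂ X₁ X₂ Cx₁ Cq₁ Ux₁ Uq₁ Cx₂ Cq₂ Ux₂ Uq₂ : Type*}
  {m₂ : BranchModel ι₂ Cx₂ Cq₂ Ux₂ Uq₂} {d₂ : BranchDynamics ι₂ X₂ Cx₂ Cq₂ Ux₂ Uq₂}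
  {m₁ : BranchModel ι₁ Cx₁ Cq₁ Ux₁ Uq₁} {d₁ : BranchDynamics ι₁ X₁ Cx₁ Cq₁ Ux₁ Uq₁}
  {Rel : X₂ → X₁ → Prop} {n m : ℕ} {c₂ : Ux₂ × Uq₂ → Ux₁ × Uq₁ → Cx₂ × Cq₂}
  {c₁ : Ux₁ × Uq₁ → Ux₂ × Uq₂ → Cx₁ × Cq₁}

theorem OrbitFamily.flip (h : OrbitFamily m₂ d₂ m₁ d₁ Rel n m c₂ c₁) :
    OrbitFamily m₁ d₁ m₂ d₂ (flip Rel) m n c₁ c₂ := by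
  intro t ht s hs
  obtain ⟨h1, h2, z, w, hzw, a, b, c, d⟩ := h s hs t ht
  exact ⟨h2, h1, w, z, hzw, b, a, d, c⟩

variable [NormedAddCommGroup Cx₂] [NormedAddCommGroup Cq₂] [NormedAddCommGroup Ux₂]
  [NormedAddCommGroup Uq₂]

/-- One step of the second machine along the branch `i`. The expanded coordinate of the old end point
is recovered from that of the new one, `s`, as a solution of a fixed point equation. -/
theorem OrbitFamily.advance (h : OrbitFamily m₂ d₂ m₁ d₁ Rel n m c₂ c₁) {κ : ℝ}
    (hd : m₂.Realizes d₂ κ) {i : ι₂} (hi : i ∈ m₂.index)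
    (hc : ∀ s ∈ m₂.fiber, ∀ t ∈ m₁.fiber, c₂ s t ∈ m₂.dom i)
    {σ : Ux₂ × Uq₂ → Ux₁ × Uq₁ → Ux₂ × Uq₂}
    (hσ : ∀ s ∈ m₂.fiber, ∀ t ∈ m₁.fiber, σ s t ∈ m₂.fiber ∧
      d₂.branchU i (c₂ (σ s t) t) s = σ s t) :
    OrbitFamily m₂ d₂ m₁ d₁ Rel (n + 1) m (fun s t => d₂.branchC i (c₂ (σ s t) t) s)
      (fun t s => c₁ t (σ s t)) := by
  intro s hs t ht
  obtain ⟨hσ1, hσ2⟩ := hσ s hs t ht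
  obtain ⟨-, h2, z, w, hzw, ez, ew, kz, kw⟩ := h _ hσ1 t ht
  have hdom := hc _ hσ1 t ht
  have hK := hd.mem_K i hi _ hdom s hs
  have hmap := hd.map_eq i hi _ hdom s hs
  rw [hσ2] at hK hmap
  refine ⟨hd.mem_base i hi _ hdom s hs, h2, z, w, hzw, ?_, ew, fun j hj => ?_, kw⟩
  · rw [iterate_succ_apply', ez, hmap]
  · rcases Nat.lt_succ_iff_lt_or_eq.1 hj with hj | rfl
    · exact kz j hj
    · rw [ez]
      exact hK

variable [NormedAddCommGroup Cx₁] [NormedAddCommGroup Cq₁] [NormedAddCommGroup Ux₁]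
  [NormedAddCommGroup Uq₁]

theorem SmallScaleBlock.lipschitz {l l' e ℓ : ℝ} {Zu : Set (Ux₂ × Uq₂)} {Zv : Set (Ux₁ × Uq₁)}
    (h : SmallScaleBlock Zu Zv c₂ l l' e) (hℓ : 0 ≤ ℓ) (hl : l ≤ ℓ) (hl' : l' ≤ ℓ) (he : 0 ≤ e) :
    SmallScaleLipschitz Zu Zv c₂ e (ℓ + e) := by
  obtain ⟨δ, hδ, h⟩ := h
  refine ⟨δ, hδ, fun s hs s' hs' t ht t' ht' h1 h2 => ?_⟩
  have h3 := (h s hs s' hs' t ht t' ht' h1 h2).norm_le hℓ hl hl'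
  have h4 : max ‖s - s'‖ ‖t - t'‖ ≤ ‖s - s'‖ + ‖t - t'‖ :=
    max_le_add_of_nonneg (norm_nonneg _) (norm_nonneg _)
  nlinarith [mul_le_mul_of_nonneg_left h4 he]

variable [NormedSpace ℝ Ux₂] [NormedSpace ℝ Uq₂]

/-- Two increments that are bounded in terms of each other are bounded by the increments `s`, `t` of
the independent variables. -/
theorem max_le_of_coupled_bounds {A ℓ e κ s t x y : ℝ} (hA : 0 ≤ A) (hℓ : 0 ≤ ℓ) (he1 : e ≤ 1)
    (hκ2 : κ ≤ 1 / 2) (hs : 0 ≤ s) (ht : 0 ≤ t) (hx : 0 ≤ x)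
    (hy : 0 ≤ y) (h1 : y ≤ ℓ * t + e * max x t) (h2 : x ≤ A * s + κ * max y s) :
    0 ≤ max s t ∧ max x t ≤ (2 * A + 2 * ℓ + 3) * max s t ∧
      max y s ≤ (2 * A + 2 * ℓ + 3) * max s t := by
  set D := max s t
  have hsD : s ≤ D := le_max_left _ _
  have htD : t ≤ D := le_max_right _ _
  have hD : 0 ≤ D := hs.trans hsD
  have m1 : max x t ≤ x + t := max_le_add_of_nonneg hx ht
  have m2 : max y s ≤ y + s := max_le_add_of_nonneg hy hs
  have m0 : 0 ≤ max x t := hx.trans (le_max_left _ _)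
  have m0' : 0 ≤ max y s := hy.trans (le_max_left _ _)
  have m1' : e * max x t ≤ x + D := (mul_le_of_le_one_left m0 he1).trans (by linarith)
  have m2' : κ * max y s ≤ 1 / 2 * (y + D) :=
    (mul_le_mul hκ2 m2 m0' (by norm_num)).trans (by linarith)
  have a1 : ℓ * t ≤ ℓ * D := by gcongr
  have a2 : A * s ≤ A * D := by gcongr
  have b1 := mul_nonneg hA hD
  have b2 := mul_nonneg hℓ hD
  exact ⟨hD, max_le (by linarith) (by linarith), max_le (by linarith) (by linarith)⟩

/-- One step of the second machine, with block estimates. The rates are multiplied by those of the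
branch, and the error grows by a factor independent of the number of steps. -/
theorem OrbitFamily.exists_block_advance (h : OrbitFamily m₂ d₂ m₁ d₁ Rel n m c₂ c₁) {κ : ℝ}
    (hd : m₂.Realizes d₂ κ) (hcomp : IsComplete m₂.fiber) (hconv : Convex ℝ m₂.fiber)
    (hne : m₂.fiber.Nonempty) {i : ι₂} (hi : i ∈ m₂.index)
    (hc : ∀ s ∈ m₂.fiber, ∀ t ∈ m₁.fiber, c₂ s t ∈ m₂.dom i)
    {l₂ l₂' l₁ l₁' e ℓ A : ℝ} (hκ : 0 ≤ κ) (hκ2 : κ ≤ 1 / 2) (he : 0 ≤ e) (he1 : e ≤ 1)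
    (hℓ : 0 ≤ ℓ) (hl₂ : l₂ ≤ ℓ) (hl₂' : l₂' ≤ ℓ) (hl₁0 : 0 ≤ l₁) (hl₁ : l₁ ≤ ℓ) (hl₁0' : 0 ≤ l₁')
    (hl₁' : l₁' ≤ ℓ) (hstrong : 0 ≤ m₂.strong i) (hstrongA : m₂.strong i ≤ A)
    (hcontr : 0 ≤ m₂.contr i) (hcontrA : m₂.contr i ≤ A) (hinvA : m₂.inv i ≤ A)
    (hc₂ : SmallScaleBlock m₂.fiber m₁.fiber c₂ l₂ l₂' e)
    (hc₁ : SmallScaleBlock m₁.fiber m₂.fiber c₁ l₁ l₁' e) :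
    ∃ c₂' c₁', OrbitFamily m₂ d₂ m₁ d₁ Rel (n + 1) m c₂' c₁' ∧
      SmallScaleBlock m₂.fiber m₁.fiber c₂' (m₂.strong i * l₂) (m₂.contr i * l₂')
        ((2 * A + 2 * ℓ + 3) * (A + ℓ + 1) * (e + κ)) ∧
      SmallScaleBlock m₁.fiber m₂.fiber c₁' (l₁ * m₂.strong i) (l₁' * m₂.inv i)
        ((2 * A + 2 * ℓ + 3) * (A + ℓ + 1) * (e + κ)) ∧
      ∀ s ∈ m₂.fiber, ∀ t ∈ m₁.fiber, ∃ s' ∈ m₂.fiber, c₁' t s = c₁ t s' := by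
  have hA : 0 ≤ A := hstrong.trans hstrongA
  obtain ⟨δ₀, hδ₀, hlip⟩ := hc₂.lipschitz hℓ hl₂ hl₂' he
  obtain ⟨σ, hσ, hσu⟩ := hd.exists_reparametrization hcomp hconv hne hi hstrong hc hκ he
    (by positivity) (by nlinarith) hδ₀ hlip
  obtain ⟨δ₂, hδ₂, hb₂⟩ := hc₂
  obtain ⟨δ₁, hδ₁, hb₁⟩ := hc₁
  obtain ⟨δ', hδ', hest⟩ := hσu (min δ₁ δ₂) (lt_min hδ₁ hδ₂)
  refine ⟨_, _, h.advance hd hi hc hσ, ?_, ?_, fun s hs t ht => ⟨_, (hσ s hs t ht).1, rfl⟩⟩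
  all_goals
    refine ⟨min δ' (min δ₁ δ₂), lt_min hδ' (lt_min hδ₁ hδ₂), ?_⟩
  · intro s hs s' hs' t ht t' ht' hss htt
    obtain ⟨p1, p2, p3⟩ := hest s hs s' hs' t ht t' ht' (hss.trans_le (min_le_left _ _))
      (htt.trans_le (min_le_left _ _))
    have q := hb₂ _ (hσ s hs t ht).1 _ (hσ s' hs' t' ht').1 t ht t' ht'
      (p1.trans_le (min_le_right _ _))
      (htt.trans_le ((min_le_right _ _).trans (min_le_right _ _)))
    have q' := q.norm_le hℓ hl₂ hl₂'
    have p2' := p2.norm_le hA hstrongA hinvA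
    obtain ⟨hD, hTx, hTy⟩ := max_le_of_coupled_bounds hA hℓ he1 hκ2 (norm_nonneg _)
      (norm_nonneg _) (norm_nonneg _) (norm_nonneg _) q' p2'
    set D := max ‖s - s'‖ ‖t - t'‖
    set T : ℝ := 2 * A + 2 * ℓ + 3 with hT
    have hTD : 0 ≤ T * D := by positivity
    have tot : ∀ a : ℝ, 0 ≤ a → a ≤ A → a * (e * (T * D)) + κ * (T * D)
        ≤ T * (A + ℓ + 1) * (e + κ) * D := by
      intro a ha0 ha
      have : a * (e * (T * D)) ≤ A * (e * (T * D)) := by gcongr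
      have e1 := mul_nonneg he hTD
      have e2 := mul_nonneg hκ hTD
      nlinarith [mul_nonneg hℓ e1, mul_nonneg hℓ e2, mul_nonneg hA e2]
    constructor
    · refine p3.1.trans ?_
      have : m₂.strong i * ‖(c₂ (σ s t) t - c₂ (σ s' t') t').1‖
          ≤ m₂.strong i * (l₂ * ‖(t - t').1‖ + e * (T * D)) := by
        gcongr
        exact q.1.trans (by gcongr)
      have k2 : κ * max ‖c₂ (σ s t) t - c₂ (σ s' t') t'‖ ‖s - s'‖ ≤ κ * (T * D) := by gcongr
      linarith [tot _ hstrong hstrongA]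
    · refine p3.2.trans ?_
      have : m₂.contr i * ‖(c₂ (σ s t) t - c₂ (σ s' t') t').2‖
          ≤ m₂.contr i * (l₂' * ‖(t - t').2‖ + e * (T * D)) := by
        gcongr
        exact q.2.trans (by gcongr)
      have k2 : κ * max ‖c₂ (σ s t) t - c₂ (σ s' t') t'‖ ‖s - s'‖ ≤ κ * (T * D) := by gcongr
      linarith [tot _ hcontr hcontrA]
  · intro t ht t' ht' s hs s' hs' htt hss
    obtain ⟨p1, p2, -⟩ := hest s hs s' hs' t ht t' ht' (hss.trans_le (min_le_left _ _))
      (htt.trans_le (min_le_left _ _))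
    have q := hb₂ _ (hσ s hs t ht).1 _ (hσ s' hs' t' ht').1 t ht t' ht'
      (p1.trans_le (min_le_right _ _))
      (htt.trans_le ((min_le_right _ _).trans (min_le_right _ _)))
    have r := hb₁ t ht t' ht' _ (hσ s hs t ht).1 _ (hσ s' hs' t' ht').1
      (htt.trans_le ((min_le_right _ _).trans (min_le_left _ _))) (p1.trans_le (min_le_left _ _))
    have q' := q.norm_le hℓ hl₂ hl₂'
    have p2' := p2.norm_le hA hstrongA hinvA
    rw [max_comm] at r
    obtain ⟨hD, hTx, hTy⟩ := max_le_of_coupled_bounds hA hℓ he1 hκ2 (norm_nonneg _)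
      (norm_nonneg _) (norm_nonneg _) (norm_nonneg _) q' p2'
    rw [max_comm ‖t - t'‖]
    set D := max ‖s - s'‖ ‖t - t'‖
    set T : ℝ := 2 * A + 2 * ℓ + 3 with hT
    have hTD : 0 ≤ T * D := by positivity
    have tot : ∀ l : ℝ, 0 ≤ l → l ≤ ℓ → l * (κ * (T * D)) + e * (T * D)
        ≤ T * (A + ℓ + 1) * (e + κ) * D := by
      intro l hl0 hl
      have : l * (κ * (T * D)) ≤ ℓ * (κ * (T * D)) := by gcongr
      have e1 := mul_nonneg he hTD
      have e2 := mul_nonneg hκ hTD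
      nlinarith [mul_nonneg hℓ e1, mul_nonneg hA e1, mul_nonneg hA e2]
    constructor
    · refine r.1.trans ?_
      have : l₁ * ‖(σ s t - σ s' t').1‖
          ≤ l₁ * (m₂.strong i * ‖(s - s').1‖ + κ * (T * D)) := by
        gcongr
        exact p2.1.trans (by gcongr)
      have k1 : e * max ‖σ s t - σ s' t'‖ ‖t - t'‖ ≤ e * (T * D) := by gcongr
      linarith [tot _ hl₁0 hl₁]
    · refine r.2.trans ?_
      have : l₁' * ‖(σ s t - σ s' t').2‖
          ≤ l₁' * (m₂.inv i * ‖(s - s').2‖ + κ * (T * D)) := by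
        gcongr
        exact p2.2.trans (by gcongr)
      have k1 : e * max ‖σ s t - σ s' t'‖ ‖t - t'‖ ≤ e * (T * D) := by gcongr
      linarith [tot _ hl₁0' hl₁']

/-- One step of the second machine, with scalar estimates. In contrast to the block estimates, the
errors do not grow with the number of steps: the own slope `θ₂` is contracted, and the addition to the
slope `θ₁` is proportional to the product of the widths. -/
theorem OrbitFamily.exists_advance (h : OrbitFamily m₂ d₂ m₁ d₁ Rel n m c₂ c₁) {κ : ℝ}
    (hd : m₂.Realizes d₂ κ) (hcomp : IsComplete m₂.fiber) (hconv : Convex ℝ m₂.fiber)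
    (hne : m₂.fiber.Nonempty) {i : ι₂} (hi : i ∈ m₂.index)
    (hc : ∀ s ∈ m₂.fiber, ∀ t ∈ m₁.fiber, c₂ s t ∈ m₂.dom i)
    {θ₂ x θ₁ y A B lam : ℝ} (hκ : 0 ≤ κ) (hθ₂ : 0 ≤ θ₂) (hκθ : κ * θ₂ ≤ 1 / 2) (hx : 0 ≤ x)
    (hy : 0 ≤ y) (hA : 0 ≤ A) (hB : 0 ≤ B) (hAB : A * B ≤ lam)
    (hstrong : 0 ≤ m₂.strong i) (hstrongA : m₂.strong i + κ ≤ A * (1 - κ * θ₂))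
    (hcontrA : m₂.contr i + κ ≤ A * (1 - κ * θ₂)) (hstrongB : m₂.strong i + κ ≤ B * (1 - κ * θ₂))
    (hinvB : m₂.inv i + κ ≤ B * (1 - κ * θ₂))
    (hc₂ : SmallScaleLipschitz m₂.fiber m₁.fiber c₂ θ₂ x)
    (hc₁ : SmallScaleLipschitz m₁.fiber m₂.fiber c₁ θ₁ y) :
    ∃ c₂' c₁', OrbitFamily m₂ d₂ m₁ d₁ Rel (n + 1) m c₂' c₁' ∧
      SmallScaleLipschitz m₂.fiber m₁.fiber c₂' (lam * θ₂ + κ) (A * x) ∧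
      SmallScaleLipschitz m₁.fiber m₂.fiber c₁' (θ₁ + 2 * κ * (x * y)) (B * y) := by
  obtain ⟨δ₂, hδ₂, hb₂⟩ := hc₂
  obtain ⟨σ, hσ, hσu⟩ := hd.exists_reparametrization hcomp hconv hne hi hstrong hc hκ hθ₂
    hx (by linarith) hδ₂ hb₂
  obtain ⟨δ₁, hδ₁, hb₁⟩ := hc₁
  obtain ⟨δ', hδ', hest⟩ := hσu (min δ₁ δ₂) (lt_min hδ₁ hδ₂)
  set q : ℝ := 1 - κ * θ₂ with hq
  have hq0 : 1 / 2 ≤ q := by linarith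
  have hqpos : 0 < q := by linarith
  set δ := min δ' (min δ₁ δ₂) with hδ
  have key : ∀ s ∈ m₂.fiber, ∀ s' ∈ m₂.fiber, ∀ t ∈ m₁.fiber, ∀ t' ∈ m₁.fiber,
      ‖s - s'‖ < δ → ‖t - t'‖ < δ →
      q * ‖σ s t - σ s' t'‖ ≤ q * B * ‖s - s'‖ + κ * x * ‖t - t'‖ ∧
      ‖d₂.branchC i (c₂ (σ s t) t) s - d₂.branchC i (c₂ (σ s' t') t') s'‖ ≤
        A * q * (θ₂ * ‖σ s t - σ s' t'‖ + x * ‖t - t'‖) + κ * ‖s - s'‖ ∧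
      ‖c₁ t (σ s t) - c₁ t' (σ s' t')‖ ≤ θ₁ * ‖t - t'‖ + y * ‖σ s t - σ s' t'‖ := by
    intro s hs s' hs' t ht t' ht' hss htt
    obtain ⟨p1, p2, p3⟩ := hest s hs s' hs' t ht t' ht' (hss.trans_le (min_le_left _ _))
      (htt.trans_le (min_le_left _ _))
    have q2 := hb₂ _ (hσ s hs t ht).1 _ (hσ s' hs' t' ht').1 t ht t' ht'
      (p1.trans_le (min_le_right _ _))
      (htt.trans_le ((min_le_right _ _).trans (min_le_right _ _)))
    have q1 := hb₁ t ht t' ht' _ (hσ s hs t ht).1 _ (hσ s' hs' t' ht').1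
      (htt.trans_le ((min_le_right _ _).trans (min_le_left _ _))) (p1.trans_le (min_le_left _ _))
    have a0 : 0 ≤ A * q - κ := by linarith
    have b0 : 0 ≤ B * q - κ := by linarith
    have p2' := p2.norm_le b0 (by linarith) (by linarith)
    have p3' := p3.norm_le a0 (by linarith) (by linarith)
    have m2 : max ‖c₂ (σ s t) t - c₂ (σ s' t') t'‖ ‖s - s'‖ ≤
        ‖c₂ (σ s t) t - c₂ (σ s' t') t'‖ + ‖s - s'‖ :=
      max_le_add_of_nonneg (norm_nonneg _) (norm_nonneg _)
    have m2' := mul_le_mul_of_nonneg_left m2 hκ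
    have q2' := mul_le_mul_of_nonneg_left q2 hκ
    have q2'' := mul_le_mul_of_nonneg_left q2 (mul_nonneg hA hqpos.le)
    refine ⟨?_, ?_, q1⟩
    · rw [hq] at p2' ⊢
      nlinarith
    · nlinarith
  refine ⟨_, _, h.advance hd hi hc hσ, ⟨δ, lt_min hδ' (lt_min hδ₁ hδ₂), ?_⟩,
    ⟨δ, lt_min hδ' (lt_min hδ₁ hδ₂), ?_⟩⟩
  · intro s hs s' hs' t ht t' ht' hss htt
    obtain ⟨k1, k2, -⟩ := key s hs s' hs' t ht t' ht' hss htt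
    refine k2.trans ?_
    have hs0 := norm_nonneg (s - s')
    have ht0 := norm_nonneg (t - t')
    have h1 : θ₂ * (q * ‖σ s t - σ s' t'‖) ≤ θ₂ * (q * B * ‖s - s'‖ + κ * x * ‖t - t'‖) := by
      gcongr
    have h2 : A * q * (θ₂ * ‖σ s t - σ s' t'‖ + x * ‖t - t'‖) ≤
        A * (θ₂ * (q * B * ‖s - s'‖ + κ * x * ‖t - t'‖) + q * x * ‖t - t'‖) := by
      have := mul_le_mul_of_nonneg_left h1 hA
      linarith
    have h3 : A * (θ₂ * (q * B * ‖s - s'‖ + κ * x * ‖t - t'‖) + q * x * ‖t - t'‖) =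
        A * B * (θ₂ * q * ‖s - s'‖) + A * x * ‖t - t'‖ := by
      rw [hq]
      ring
    have hq1 : q ≤ 1 := by
      rw [hq]
      nlinarith
    have h4 : A * B * (θ₂ * q * ‖s - s'‖) ≤ lam * (θ₂ * 1 * ‖s - s'‖) :=
      mul_le_mul hAB (by gcongr) (by positivity) (le_trans (by positivity) hAB)
    linarith
  · intro t ht t' ht' s hs s' hs' htt hss
    obtain ⟨k1, -, k3⟩ := key s hs s' hs' t ht t' ht' hss htt
    refine k3.trans ?_
    have ht0 := norm_nonneg (t - t')
    have h1 : ‖σ s t - σ s' t'‖ ≤ B * ‖s - s'‖ + 2 * κ * x * ‖t - t'‖ := by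
      have h0 : 0 ≤ κ * x * ‖t - t'‖ := by positivity
      have : q * ‖σ s t - σ s' t'‖ ≤ q * (B * ‖s - s'‖ + 2 * κ * x * ‖t - t'‖) := by nlinarith
      exact le_of_mul_le_mul_left this hqpos
    have h2 := mul_le_mul_of_nonneg_left h1 hy
    linarith

variable [NormedSpace ℝ Ux₁] [NormedSpace ℝ Uq₁]

theorem SmallScaleBlock.snd_sub_le {l l' e w W : ℝ} {Zu : Set (Ux₂ × Uq₂)} {Zv : Set (Ux₁ × Uq₁)}
    (h : SmallScaleBlock Zu Zv c₂ l l' e) (hu : Convex ℝ Zu) (hv : Convex ℝ Zv) (he : 0 ≤ e)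
    (hl' : 0 ≤ l') (hw : ∀ t ∈ Zv, ∀ t' ∈ Zv, ‖(t - t').2‖ ≤ w)
    (hWu : ∀ s ∈ Zu, ∀ s' ∈ Zu, ‖s - s'‖ ≤ W) (hWv : ∀ t ∈ Zv, ∀ t' ∈ Zv, ‖t - t'‖ ≤ W)
    {s s' : Ux₂ × Uq₂} {t t' : Ux₁ × Uq₁} (hs : s ∈ Zu) (hs' : s' ∈ Zu) (ht : t ∈ Zv)
    (ht' : t' ∈ Zv) : ‖(c₂ s t - c₂ s' t').2‖ ≤ l' * w + e * W := by
  obtain ⟨δ, hδ, h⟩ := h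
  have := norm_sub_le_of_small_scale (s := Zu ×ˢ Zv) (hu.prod hv)
    (f := fun p => (c₂ p.1 p.2).2) (N := fun v => l' * ‖v.2.2‖ + e * ‖v‖) (fun r v hr => by
      simp only [norm_smul, Prod.smul_snd, Real.norm_of_nonneg hr]
      ring) hδ (fun x hx y hy hxy => by
      rw [Prod.norm_def, max_lt_iff] at hxy
      exact (h x.1 hx.1 y.1 hy.1 x.2 hx.2 y.2 hy.2 hxy.1 hxy.2).2)
    (x := (s, t)) (y := (s', t')) ⟨hs, ht⟩ ⟨hs', ht'⟩
  have h1 : ‖((s, t) : (Ux₂ × Uq₂) × (Ux₁ × Uq₁)) - (s', t')‖ ≤ W :=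
    max_le (hWu s hs s' hs') (hWv t ht t' ht')
  refine this.trans (add_le_add ?_ ?_)
  · gcongr
    exact hw t ht t' ht'
  · gcongr

theorem SmallScaleLipschitz.norm_sub_le {θ L W : ℝ} {Zu : Set (Ux₂ × Uq₂)} {Zv : Set (Ux₁ × Uq₁)}
    (h : SmallScaleLipschitz Zu Zv c₂ θ L) (hu : Convex ℝ Zu) (hv : Convex ℝ Zv) (hθ : 0 ≤ θ)
    (hL : 0 ≤ L) (hWu : ∀ s ∈ Zu, ∀ s' ∈ Zu, ‖s - s'‖ ≤ W)
    (hWv : ∀ t ∈ Zv, ∀ t' ∈ Zv, ‖t - t'‖ ≤ W)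
    {s s' : Ux₂ × Uq₂} {t t' : Ux₁ × Uq₁} (hs : s ∈ Zu) (hs' : s' ∈ Zu) (ht : t ∈ Zv)
    (ht' : t' ∈ Zv) : ‖c₂ s t - c₂ s' t'‖ ≤ θ * W + L * W := by
  obtain ⟨δ, hδ, h⟩ := h
  have := norm_sub_le_of_small_scale (s := Zu ×ˢ Zv) (hu.prod hv)
    (f := fun p => c₂ p.1 p.2) (N := fun v => θ * ‖v.1‖ + L * ‖v.2‖) (fun r v hr => by
      simp only [norm_smul, Prod.smul_snd, Prod.smul_fst, Real.norm_of_nonneg hr]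
      ring) hδ (fun x hx y hy hxy => by
      rw [Prod.norm_def, max_lt_iff] at hxy
      exact h x.1 hx.1 y.1 hy.1 x.2 hx.2 y.2 hy.2 hxy.1 hxy.2)
    (x := (s, t)) (y := (s', t')) ⟨hs, ht⟩ ⟨hs', ht'⟩
  refine this.trans (add_le_add ?_ ?_)
  · gcongr
    exact hWu s hs s' hs'
  · gcongr
    exact hWv t ht t' ht'

end Steps

/-! ### Existence of long joint orbits -/

section Model

variable {ι Cx Cq Ux Uq : Type*} [NormedAddCommGroup Ux] [NormedAddCommGroup Uq]
  [NormedSpace ℝ Ux] [NormedSpace ℝ Uq]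

/-- Standing assumptions on a model: its fiber is complete, convex, non-empty and of diameter at
most `W`, with diameter at most `w` in the `Uq` direction, and its rates lie in `[0, A]`. -/
structure BranchModel.IsAdmissible (m : BranchModel ι Cx Cq Ux Uq) (A W w : ℝ) : Prop where
  complete : IsComplete m.fiber
  convex : Convex ℝ m.fiber
  nonempty : m.fiber.Nonempty
  norm_sub_le : ∀ s ∈ m.fiber, ∀ s' ∈ m.fiber, ‖s - s'‖ ≤ W
  norm_snd_sub_le : ∀ s ∈ m.fiber, ∀ s' ∈ m.fiber, ‖(s - s').2‖ ≤ w
  strong_nonneg : ∀ i ∈ m.index, 0 ≤ m.strong i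
  strong_le : ∀ i ∈ m.index, m.strong i ≤ A
  contr_nonneg : ∀ i ∈ m.index, 0 ≤ m.contr i
  contr_le : ∀ i ∈ m.index, m.contr i ≤ A
  inv_nonneg : ∀ i ∈ m.index, 0 ≤ m.inv i
  inv_le : ∀ i ∈ m.index, m.inv i ≤ A

end Model

variable {ι₁ ι₂ X₁ X₂ Cx₁ Cq₁ Ux₁ Uq₁ Cx₂ Cq₂ Ux₂ Uq₂ : Type*}
  [NormedAddCommGroup Cx₁] [NormedAddCommGroup Cq₁]
  [NormedAddCommGroup Ux₁] [NormedAddCommGroup Uq₁] [NormedAddCommGroup Cx₂]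
  [NormedAddCommGroup Cq₂] [NormedAddCommGroup Ux₂] [NormedAddCommGroup Uq₂]
  {m₂ : BranchModel ι₂ Cx₂ Cq₂ Ux₂ Uq₂} {m₁ : BranchModel ι₁ Cx₁ Cq₁ Ux₁ Uq₁}

theorem SmallScaleBlock.mono {Zu : Set (Ux₂ × Uq₂)} {Zv : Set (Ux₁ × Uq₁)}
    {c : Ux₂ × Uq₂ → Ux₁ × Uq₁ → Cx₂ × Cq₂} {l l' e k k' e' : ℝ}
    (h : SmallScaleBlock Zu Zv c l l' e) (hl : l ≤ k) (hl' : l' ≤ k') (he : e ≤ e') :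
    SmallScaleBlock Zu Zv c k k' e' := by
  obtain ⟨δ, hδ, h⟩ := h
  exact ⟨δ, hδ, fun s hs s' hs' t ht t' ht' h1 h2 =>
    (h s hs s' hs' t ht t' ht' h1 h2).mono hl hl' (by gcongr)⟩

/-- There is a family of joint orbits of lengths `n` and `m` whose graphs are Lipschitz with constants
`x` and `y`, the widths, in the other machine's coordinate, and with a small slope in the own one. The
dependence of the family on the other machine's coordinate adds to the slope of the second
graph an error proportional to the product of the widths. Since this product decreases
geometrically, `θ + 2 κ x y / (1 - lam)` does not increase. -/
def WidthState (m₂ : BranchModel ι₂ Cx₂ Cq₂ Ux₂ Uq₂) (d₂ : BranchDynamics ι₂ X₂ Cx₂ Cq₂ Ux₂ Uq₂)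
    (m₁ : BranchModel ι₁ Cx₁ Cq₁ Ux₁ Uq₁) (d₁ : BranchDynamics ι₁ X₁ Cx₁ Cq₁ Ux₁ Uq₁)
    (Rel : X₂ → X₁ → Prop) (κ lam θ : ℝ) (n m : ℕ) (x y : ℝ) : Prop :=
  0 < x ∧ 0 < y ∧ ∃ c₂ c₁ θ₂ θ₁, OrbitFamily m₂ d₂ m₁ d₁ Rel n m c₂ c₁ ∧
    SmallScaleLipschitz m₂.fiber m₁.fiber c₂ θ₂ x ∧ SmallScaleLipschitz m₁.fiber m₂.fiber c₁ θ₁ y ∧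
    0 ≤ θ₂ ∧ 0 ≤ θ₁ ∧ θ₂ + 2 * κ / (1 - lam) * (x * y) ≤ θ ∧
    θ₁ + 2 * κ / (1 - lam) * (x * y) ≤ θ

section Width

variable {d₂ : BranchDynamics ι₂ X₂ Cx₂ Cq₂ Ux₂ Uq₂} {d₁ : BranchDynamics ι₁ X₁ Cx₁ Cq₁ Ux₁ Uq₁}
  {Rel : X₂ → X₁ → Prop} {κ lam θ : ℝ} {n m : ℕ} {x y : ℝ}

theorem WidthState.flip (h : WidthState m₂ d₂ m₁ d₁ Rel κ lam θ n m x y) :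
    WidthState m₁ d₁ m₂ d₂ (flip Rel) κ lam θ m n y x := by
  obtain ⟨hx, hy, c₂, c₁, θ₂, θ₁, a, b, c, d, e, f, g⟩ := h
  exact ⟨hy, hx, c₁, c₂, θ₁, θ₂, a.flip, c, b, e, d, by rwa [mul_comm y], by rwa [mul_comm y]⟩

end Width

variable [NormedSpace ℝ Ux₁] [NormedSpace ℝ Uq₁] [NormedSpace ℝ Ux₂] [NormedSpace ℝ Uq₂]

/-- If both machines are advanced simultaneously, the widths of the family in the fiber directions
decrease, because the contraction of one machine dominates the inverse expansion of the other. For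
boundedly many steps the error is under control. -/
theorem exists_block_orbitFamily {A W w₁ w₂ lam ℓ₀ E Δ₁ Δ₂ κ l₁ l₁' l₂ l₂' Q : ℝ}
    (h₂ : m₂.IsAdmissible A W w₂) (h₁ : m₁.IsAdmissible A W w₁) (hA : 0 ≤ A)
    (hlam0 : 0 ≤ lam) (hlam1 : lam ≤ 1)
    (hstrong : ∀ i ∈ m₂.index, ∀ j ∈ m₁.index, m₂.strong i * m₁.strong j ≤ lam)
    (hcross₂ : ∀ i ∈ m₂.index, ∀ j ∈ m₁.index, m₂.contr i * m₁.inv j ≤ lam)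
    (hcross₁ : ∀ i ∈ m₂.index, ∀ j ∈ m₁.index, m₁.contr j * m₂.inv i ≤ lam)
    (hs₂ : m₂.Selects Δ₂) (hs₁ : m₁.Selects Δ₁) (hE1 : E ≤ 1)
    (hl₂ : 0 ≤ l₂) (hl₂' : 0 ≤ l₂') (hl₁ : 0 ≤ l₁) (hl₁' : 0 ≤ l₁')
    (hl₂ℓ : l₂ ≤ ℓ₀) (hl₂ℓ' : l₂' ≤ ℓ₀) (hl₁ℓ : l₁ ≤ ℓ₀) (hl₁ℓ' : l₁' ≤ ℓ₀)
    (hw₂ : l₂' * w₁ + E * W < Δ₂) (hw₁ : l₁' * w₂ + E * W < Δ₁)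
    (hQ : Q = 2 * ((2 * A + 2 * ((A + 1) * ℓ₀) + 3) * (A + (A + 1) * ℓ₀ + 1)))
    (hκ : 0 ≤ κ) (hκ2 : κ ≤ 1 / 2)
    {d₂ : BranchDynamics ι₂ X₂ Cx₂ Cq₂ Ux₂ Uq₂} {d₁ : BranchDynamics ι₁ X₁ Cx₁ Cq₁ Ux₁ Uq₁}
    (hd₂ : m₂.Realizes d₂ κ) (hd₁ : m₁.Realizes d₁ κ) {Rel : X₂ → X₁ → Prop}
    {c₂ : Ux₂ × Uq₂ → Ux₁ × Uq₁ → Cx₂ × Cq₂} {c₁ : Ux₁ × Uq₁ → Ux₂ × Uq₂ → Cx₁ × Cq₁}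
    (hfam : OrbitFamily m₂ d₂ m₁ d₁ Rel 0 0 c₂ c₁)
    (hc₂ : SmallScaleBlock m₂.fiber m₁.fiber c₂ l₂ l₂' κ)
    (hc₁ : SmallScaleBlock m₁.fiber m₂.fiber c₁ l₁ l₁' κ) (k : ℕ) (hk : Q ^ (2 * k) * κ ≤ E) :
    ∃ c₂ c₁, OrbitFamily m₂ d₂ m₁ d₁ Rel k k c₂ c₁ ∧
      SmallScaleBlock m₂.fiber m₁.fiber c₂ (lam ^ k * l₂) (lam ^ k * l₂') (Q ^ (2 * k) * κ) ∧
      SmallScaleBlock m₁.fiber m₂.fiber c₁ (lam ^ k * l₁) (lam ^ k * l₁') (Q ^ (2 * k) * κ) := by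
  have hℓ₀ : 0 ≤ ℓ₀ := hl₂.trans hl₂ℓ
  set ℓ : ℝ := (A + 1) * ℓ₀ with hℓ
  have hℓ0 : 0 ≤ ℓ := by positivity
  have hle : ℓ₀ ≤ ℓ := by nlinarith
  have hW : 0 ≤ W := by
    obtain ⟨s, hs⟩ := h₂.nonempty
    exact (norm_nonneg _).trans (h₂.norm_sub_le s hs s hs)
  have hw₁0 : 0 ≤ w₁ := by
    obtain ⟨s, hs⟩ := h₁.nonempty
    exact (norm_nonneg _).trans (h₁.norm_snd_sub_le s hs s hs)
  have hw₂0 : 0 ≤ w₂ := by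
    obtain ⟨s, hs⟩ := h₂.nonempty
    exact (norm_nonneg _).trans (h₂.norm_snd_sub_le s hs s hs)
  set C : ℝ := (2 * A + 2 * ℓ + 3) * (A + ℓ + 1) with hC
  have hC1 : 1 ≤ C := by nlinarith
  have hQ1 : 1 ≤ Q := by linarith
  have hgrow : ∀ j : ℕ, C * (Q ^ j * κ + κ) ≤ Q ^ (j + 1) * κ := by
    intro j
    have : 1 ≤ Q ^ j := one_le_pow₀ hQ1
    have h0 : κ ≤ Q ^ j * κ := le_mul_of_one_le_left hκ this
    calc C * (Q ^ j * κ + κ) ≤ C * (Q ^ j * κ + Q ^ j * κ) := by gcongr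
      _ = Q ^ (j + 1) * κ := by
        rw [pow_succ, hQ]
        ring
  have hpow : ∀ a b : ℕ, a ≤ b → Q ^ a * κ ≤ Q ^ b * κ := fun a b hab =>
    mul_le_mul_of_nonneg_right (pow_le_pow_right₀ hQ1 hab) hκ
  induction k with
  | zero => exact ⟨c₂, c₁, hfam, by simpa using hc₂, by simpa using hc₁⟩
  | succ k ih =>
    have hk1 : Q ^ (2 * k + 1) * κ ≤ E := (hpow _ _ (by omega)).trans hk
    have hk0 : Q ^ (2 * k) * κ ≤ E := (hpow _ _ (by omega)).trans hk
    obtain ⟨c₂, c₁, hfam, hc₂, hc₁⟩ := ih hk0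
    have he : 0 ≤ Q ^ (2 * k) * κ := by positivity
    have hlk : lam ^ k ≤ 1 := pow_le_one₀ hlam0 hlam1
    have hlk0 : 0 ≤ lam ^ k := pow_nonneg hlam0 k
    have hsmall : ∀ l : ℝ, 0 ≤ l → lam ^ k * l ≤ l := fun l hl => mul_le_of_le_one_left hl hlk
    -- both words are chosen before either machine is advanced
    obtain ⟨i, hi, hdom₂⟩ := hs₂ ((fun p : (Ux₂ × Uq₂) × (Ux₁ × Uq₁) => c₂ p.1 p.2) ''
        (m₂.fiber ×ˢ m₁.fiber))
      (by
        rintro _ ⟨p, hp, rfl⟩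
        exact (hfam p.1 hp.1 p.2 hp.2).1) (l₂' * w₁ + E * W)
      (by nlinarith [mul_nonneg hl₂' hw₁0, mul_nonneg (he.trans hk0) hW]) hw₂ (by
        rintro _ ⟨p, hp, rfl⟩ _ ⟨p', hp', rfl⟩
        refine (hc₂.snd_sub_le h₂.convex h₁.convex he (by positivity) h₁.norm_snd_sub_le
          h₂.norm_sub_le h₁.norm_sub_le hp.1 hp'.1 hp.2 hp'.2).trans ?_
        have := hsmall _ hl₂'
        gcongr)
    obtain ⟨j, hj, hdom₁⟩ := hs₁ ((fun p : (Ux₁ × Uq₁) × (Ux₂ × Uq₂) => c₁ p.1 p.2) ''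
        (m₁.fiber ×ˢ m₂.fiber))
      (by
        rintro _ ⟨p, hp, rfl⟩
        exact (hfam p.2 hp.2 p.1 hp.1).2.1) (l₁' * w₂ + E * W)
      (by nlinarith [mul_nonneg hl₁' hw₂0, mul_nonneg (he.trans hk0) hW]) hw₁ (by
        rintro _ ⟨p, hp, rfl⟩ _ ⟨p', hp', rfl⟩
        refine (hc₁.snd_sub_le h₁.convex h₂.convex he (by positivity) h₂.norm_snd_sub_le
          h₁.norm_sub_le h₂.norm_sub_le hp.1 hp'.1 hp.2 hp'.2).trans ?_
        have := hsmall _ hl₁'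
        gcongr)
    have top : ∀ l : ℝ, 0 ≤ l → l ≤ ℓ₀ → lam ^ k * l ≤ ℓ := fun l h0 h1 =>
      (hsmall l h0).trans (h1.trans hle)
    have top' : ∀ l a : ℝ, 0 ≤ l → l ≤ ℓ₀ → 0 ≤ a → a ≤ A → a * (lam ^ k * l) ≤ ℓ := by
      intro l a h0 h1 ha0 ha
      have h2 : lam ^ k * l ≤ ℓ₀ := (hsmall l h0).trans h1
      have h3 : a * (lam ^ k * l) ≤ A * ℓ₀ := by gcongr
      rw [hℓ]
      nlinarith
    obtain ⟨c₂', c₁', hfam', hc₂', hc₁', hrange⟩ := hfam.exists_block_advance hd₂ h₂.complete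
      h₂.convex h₂.nonempty hi (fun s hs t ht => hdom₂ ⟨(s, t), ⟨hs, ht⟩, rfl⟩) (A := A)
      hκ hκ2 he (hk0.trans hE1) hℓ0 (top _ hl₂ hl₂ℓ) (top _ hl₂' hl₂ℓ') (by positivity)
      (top _ hl₁ hl₁ℓ) (by positivity) (top _ hl₁' hl₁ℓ') (h₂.strong_nonneg i hi)
      (h₂.strong_le i hi) (h₂.contr_nonneg i hi) (h₂.contr_le i hi) (h₂.inv_le i hi) hc₂ hc₁
    have hS₂ := h₂.strong_nonneg i hi
    have hC₂ := h₂.contr_nonneg i hi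
    have hI₂ := h₂.inv_nonneg i hi
    have hS₁ := h₁.strong_nonneg j hj
    have hC₁ := h₁.contr_nonneg j hj
    have hI₁ := h₁.inv_nonneg j hj
    replace hc₂' := hc₂'.mono le_rfl le_rfl (hgrow (2 * k))
    replace hc₁' := hc₁'.mono (mul_comm _ _).le (mul_comm _ _).le (hgrow (2 * k))
    obtain ⟨c₁'', c₂'', hfam'', hc₁'', hc₂'', -⟩ := hfam'.flip.exists_block_advance hd₁
      h₁.complete h₁.convex h₁.nonempty hj (fun t ht s hs => by
        obtain ⟨s', hs', heq⟩ := hrange s hs t ht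
        rw [heq]
        exact hdom₁ ⟨(t, s'), ⟨ht, hs'⟩, rfl⟩) (A := A)
      hκ hκ2 (by positivity) (hk1.trans hE1) hℓ0
      (top' _ _ hl₁ hl₁ℓ hS₂ (h₂.strong_le i hi)) (top' _ _ hl₁' hl₁ℓ' hI₂ (h₂.inv_le i hi))
      (by positivity) (top' _ _ hl₂ hl₂ℓ hS₂ (h₂.strong_le i hi)) (by positivity)
      (top' _ _ hl₂' hl₂ℓ' hC₂ (h₂.contr_le i hi)) hS₁ (h₁.strong_le j hj) hC₁
      (h₁.contr_le j hj) (h₁.inv_le j hj) hc₁' hc₂'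
    have hrate : ∀ a b l : ℝ, 0 ≤ l → a * b ≤ lam → a * (b * (lam ^ k * l)) ≤ lam ^ (k + 1) * l := by
      intro a b l hl hab
      have : a * (b * (lam ^ k * l)) = (a * b) * (lam ^ k * l) := by ring
      rw [this, pow_succ']
      have : 0 ≤ lam ^ k * l := by positivity
      nlinarith
    have hpow2 : 2 * (k + 1) = 2 * k + 1 + 1 := by ring
    rw [hpow2]
    refine ⟨c₂'', c₁'', hfam''.flip, hc₂''.mono ?_ ?_ (hgrow _), hc₁''.mono ?_ ?_ (hgrow _)⟩
    · rw [mul_comm]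
      exact hrate _ _ _ hl₂ (by
        rw [mul_comm]
        exact hstrong i hi j hj)
    · rw [mul_comm]
      exact hrate _ _ _ hl₂' (by
        rw [mul_comm]
        exact hcross₂ i hi j hj)
    · exact hrate _ _ _ hl₁ (by
        rw [mul_comm]
        exact hstrong i hi j hj)
    · exact hrate _ _ _ hl₁' (hcross₁ i hi j hj)

section Width

variable {d₂ : BranchDynamics ι₂ X₂ Cx₂ Cq₂ Ux₂ Uq₂} {d₁ : BranchDynamics ι₁ X₁ Cx₁ Cq₁ Ux₁ Uq₁}
  {Rel : X₂ → X₁ → Prop} {κ lam θ : ℝ} {n m : ℕ} {x y : ℝ}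

/-- While the first width is at most `X`, the family fits into the rectangle of some word of the
second machine, and this machine can be advanced. -/
theorem WidthState.exists_advance (h : WidthState m₂ d₂ m₁ d₁ Rel κ lam θ n m x y)
    {D W w₁ w₂ Δ X : ℝ} {A B : ι₂ → ℝ}
    (h₂ : m₂.IsAdmissible D W w₂) (h₁ : m₁.IsAdmissible D W w₁) (hs : m₂.Selects Δ)
    (hd : m₂.Realizes d₂ κ) (hκ : 0 ≤ κ) (hκlam : κ ≤ (1 - lam) * θ) (hlam0 : 0 ≤ lam)
    (hlam1 : lam < 1) (hκθ : κ * θ ≤ 1 / 2)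
    (hA : ∀ i ∈ m₂.index, 0 < A i) (hB : ∀ i ∈ m₂.index, 0 < B i)
    (hAB : ∀ i ∈ m₂.index, A i * B i ≤ lam)
    (hsA : ∀ i ∈ m₂.index, m₂.strong i + κ ≤ A i * (1 - κ * θ))
    (hcA : ∀ i ∈ m₂.index, m₂.contr i + κ ≤ A i * (1 - κ * θ))
    (hsB : ∀ i ∈ m₂.index, m₂.strong i + κ ≤ B i * (1 - κ * θ))
    (hiB : ∀ i ∈ m₂.index, m₂.inv i + κ ≤ B i * (1 - κ * θ))
    (hxX : x ≤ X) (hΔ : θ * W + X * W < Δ) :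
    ∃ i ∈ m₂.index, WidthState m₂ d₂ m₁ d₁ Rel κ lam θ (n + 1) m (A i * x) (B i * y) := by
  obtain ⟨hx, hy, c₂, c₁, θ₂, θ₁, hfam, hc₂, hc₁, hθ₂, hθ₁, hp₂, hp₁⟩ := h
  have hW : 0 ≤ W := by
    obtain ⟨s, hs⟩ := h₂.nonempty
    exact (norm_nonneg _).trans (h₂.norm_sub_le s hs s hs)
  have hlam' : 0 < 1 - lam := by linarith
  set P := 2 * κ / (1 - lam) with hP
  have hP0 : 0 ≤ P := by positivity
  have hP1 : P * (1 - lam) = 2 * κ := by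
    rw [hP]
    field_simp
  have hxy : 0 < x * y := mul_pos hx hy
  have hθ₂θ : θ₂ ≤ θ := by nlinarith [mul_nonneg hP0 hxy.le]
  have hθ0 : 0 ≤ θ := hθ₂.trans hθ₂θ
  have hX : 0 ≤ X := hx.le.trans hxX
  obtain ⟨i, hi, hdom⟩ := hs ((fun p : (Ux₂ × Uq₂) × (Ux₁ × Uq₁) => c₂ p.1 p.2) ''
        (m₂.fiber ×ˢ m₁.fiber))
      (by
        rintro _ ⟨p, hp, rfl⟩
        exact (hfam p.1 hp.1 p.2 hp.2).1) (θ * W + X * W) (by positivity) hΔ (by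
        rintro _ ⟨p, hp, rfl⟩ _ ⟨p', hp', rfl⟩
        refine (norm_snd_le _).trans ((hc₂.norm_sub_le h₂.convex h₁.convex hθ₂ hx.le
          h₂.norm_sub_le h₁.norm_sub_le hp.1 hp'.1 hp.2 hp'.2).trans ?_)
        gcongr)
  have hmono : ∀ a : ℝ, 0 < a → a * (1 - κ * θ) ≤ a * (1 - κ * θ₂) := by
    intro a ha
    gcongr
  obtain ⟨c₂', c₁', hfam', hc₂', hc₁'⟩ := hfam.exists_advance hd h₂.complete
      h₂.convex h₂.nonempty hi (fun s hs t ht => hdom ⟨(s, t), ⟨hs, ht⟩, rfl⟩) hκ hθ₂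
      (le_trans (by gcongr) hκθ) hx.le hy.le (hA i hi).le (hB i hi).le (hAB i hi)
      (h₂.strong_nonneg i hi) ((hsA i hi).trans (hmono _ (hA i hi)))
      ((hcA i hi).trans (hmono _ (hA i hi))) ((hsB i hi).trans (hmono _ (hB i hi)))
      ((hiB i hi).trans (hmono _ (hB i hi))) hc₂ hc₁
  have hprod : A i * x * (B i * y) ≤ lam * (x * y) := by
    calc A i * x * (B i * y) = A i * B i * (x * y) := by ring
      _ ≤ _ := mul_le_mul_of_nonneg_right (hAB i hi) hxy.le
  have hprod' := mul_le_mul_of_nonneg_left hprod hP0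
  refine ⟨i, hi, mul_pos (hA i hi) hx, mul_pos (hB i hi) hy, c₂', c₁', _, _, hfam', hc₂', hc₁',
    by positivity, by positivity, ?_, ?_⟩
  · have := mul_le_mul_of_nonneg_left hp₂ hlam0
    linarith
  · have : P * (x * y) - P * (lam * (x * y)) = 2 * κ * (x * y) := by
      rw [← hP1]
      ring
    linarith

end Width

/-- The constants of the proof of `exists_joint_orbits`: the bound `θ` for the slopes and the widths,
the widths `x₀` and the error `E` after the `J` simultaneous steps, and the size `κ` of the
perturbation. -/
theorem exists_scales {D W w₁ w₂ lam Δ₁ Δ₂ l₁' l₂' ℓ₀ η Q : ℝ} (hD : 1 ≤ D) (hW : 0 ≤ W)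
    (hlam0 : 0 < lam) (hlam1 : lam < 1) (hΔ₂ : 0 < Δ₂) (hΔ₁ : 0 < Δ₁) (hw₂ : l₂' * w₁ < Δ₂)
    (hw₁ : l₁' * w₂ < Δ₁) (hη : 0 < η) (hℓ₀ : 0 ≤ ℓ₀) (hQ : 0 < Q) :
    ∃ (θ x₀ E κ : ℝ) (J : ℕ), 0 < θ ∧ θ ≤ 1 ∧ θ * W + θ * W < Δ₁ ∧ θ * W + θ * W < Δ₂ ∧
      0 < x₀ ∧ x₀ ≤ 1 / 2 ∧ x₀ * D ^ 2 ≤ θ ∧ 0 < E ∧ E ≤ θ / 2 ∧ E ≤ x₀ / 2 ∧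
      l₂' * w₁ + E * W < Δ₂ ∧ l₁' * w₂ + E * W < Δ₁ ∧ lam ^ J * ℓ₀ ≤ x₀ / 2 ∧ 0 < κ ∧
      κ ≤ 1 / 2 ∧ κ ≤ (1 - lam) * θ ∧ κ * (D + 1) ≤ η ∧ Q ^ (2 * J) * κ ≤ E := by
  have hD0 : 0 < D := by linarith
  -- admissible slopes and widths
  set Δ := min Δ₁ Δ₂
  have hΔ0 : 0 < Δ := lt_min hΔ₁ hΔ₂
  set θ : ℝ := min 1 (Δ / (2 * W + 1))
  have hθ0 : 0 < θ := lt_min one_pos (by positivity)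
  have hθ1 : θ ≤ 1 := min_le_left _ _
  have hθW : θ * W + θ * W < Δ := by
    have : θ ≤ Δ / (2 * W + 1) := min_le_right _ _
    rw [le_div_iff₀ (by positivity)] at this
    nlinarith
  set x₀ : ℝ := min (1 / 2) (θ / D ^ 2)
  have hx₀0 : 0 < x₀ := lt_min (by norm_num) (by positivity)
  have hx₀2 : x₀ ≤ 1 / 2 := min_le_left _ _
  have hx₀θ : x₀ * D ^ 2 ≤ θ := by
    rw [← le_div_iff₀ (by positivity)]
    exact min_le_right _ _
  -- admissible error at the end of the first phase
  set E : ℝ := min (min (θ / 2) (x₀ / 2))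
    (min ((Δ₂ - l₂' * w₁) / (2 * W + 1)) ((Δ₁ - l₁' * w₂) / (2 * W + 1)))
  have hE0 : 0 < E := by
    refine lt_min (lt_min (by positivity) (by positivity)) (lt_min ?_ ?_)
    · exact div_pos (by linarith) (by positivity)
    · exact div_pos (by linarith) (by positivity)
  have hEθ : E ≤ θ / 2 := (min_le_left _ _).trans (min_le_left _ _)
  have hEx : E ≤ x₀ / 2 := (min_le_left _ _).trans (min_le_right _ _)
  have hE₂ : l₂' * w₁ + E * W < Δ₂ := by
    have h : E ≤ (Δ₂ - l₂' * w₁) / (2 * W + 1) := (min_le_right _ _).trans (min_le_left _ _)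
    rw [le_div_iff₀ (by positivity)] at h
    nlinarith
  have hE₁ : l₁' * w₂ + E * W < Δ₁ := by
    have h : E ≤ (Δ₁ - l₁' * w₂) / (2 * W + 1) := (min_le_right _ _).trans (min_le_right _ _)
    rw [le_div_iff₀ (by positivity)] at h
    nlinarith
  obtain ⟨J, hJ⟩ := exists_pow_lt_of_lt_one (show 0 < x₀ / 2 / (ℓ₀ + 1) by positivity) hlam1
  have hJ' : lam ^ J * ℓ₀ ≤ x₀ / 2 := by
    rw [lt_div_iff₀ (by positivity)] at hJ
    have : 0 < lam ^ J := by positivity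
    nlinarith
  set κ : ℝ := min (min (1 / 2) ((1 - lam) * θ)) (min (η / (D + 1)) (E / Q ^ (2 * J)))
  have hlam' : 0 < 1 - lam := by linarith
  have hκ0 : 0 < κ := by
    refine lt_min (lt_min (by norm_num) (by positivity)) (lt_min ?_ ?_) <;> positivity
  have hκ2 : κ ≤ 1 / 2 := (min_le_left _ _).trans (min_le_left _ _)
  have hκlam : κ ≤ (1 - lam) * θ := (min_le_left _ _).trans (min_le_right _ _)
  have hκη : κ * (D + 1) ≤ η := by
    rw [← le_div_iff₀ (by positivity)]
    exact (min_le_right _ _).trans (min_le_left _ _)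
  have hκE : Q ^ (2 * J) * κ ≤ E := by
    rw [mul_comm, ← le_div_iff₀ (by positivity)]
    exact (min_le_right _ _).trans (min_le_right _ _)
  exact ⟨θ, x₀, E, κ, J, hθ0, hθ1, hθW.trans_le (min_le_left _ _), hθW.trans_le (min_le_right _ _),
    hx₀0, hx₀2, hx₀θ, hE0, hEθ, hEx, hE₂, hE₁, hJ', hκ0, hκ2, hκlam, hκη, hκE⟩

/-- Two models with cross-dominated rates have joint orbits of arbitrary lengths, for all dynamics
that realize the models up to a sufficiently small error and all initial families that have, up to
that error, the given widths. -/
theorem exists_joint_orbits {D W w₁ w₂ lam Δ₁ Δ₂ l₁ l₁' l₂ l₂' : ℝ} {A₁ B₁ : ι₁ → ℝ}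
    {A₂ B₂ : ι₂ → ℝ} (h₂ : m₂.IsAdmissible D W w₂) (h₁ : m₁.IsAdmissible D W w₁) (hD : 1 ≤ D)
    (hlam0 : 0 < lam) (hlam1 : lam < 1)
    (hstrong : ∀ i ∈ m₂.index, ∀ j ∈ m₁.index, m₂.strong i * m₁.strong j ≤ lam)
    (hcross₂ : ∀ i ∈ m₂.index, ∀ j ∈ m₁.index, m₂.contr i * m₁.inv j ≤ lam)
    (hcross₁ : ∀ i ∈ m₂.index, ∀ j ∈ m₁.index, m₁.contr j * m₂.inv i ≤ lam)
    (hs₂ : m₂.Selects Δ₂) (hs₁ : m₁.Selects Δ₁) (hΔ₂ : 0 < Δ₂) (hΔ₁ : 0 < Δ₁)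
    (hl₂ : 0 ≤ l₂) (hl₂' : 0 ≤ l₂') (hl₁ : 0 ≤ l₁) (hl₁' : 0 ≤ l₁')
    (hw₂ : l₂' * w₁ < Δ₂) (hw₁ : l₁' * w₂ < Δ₁) {η : ℝ} (hη : 0 < η)
    (hsA₂ : ∀ i ∈ m₂.index, m₂.strong i + η ≤ A₂ i) (hcA₂ : ∀ i ∈ m₂.index, m₂.contr i + η ≤ A₂ i)
    (hsB₂ : ∀ i ∈ m₂.index, m₂.strong i + η ≤ B₂ i) (hiB₂ : ∀ i ∈ m₂.index, m₂.inv i + η ≤ B₂ i)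
    (hsA₁ : ∀ j ∈ m₁.index, m₁.strong j + η ≤ A₁ j) (hcA₁ : ∀ j ∈ m₁.index, m₁.contr j + η ≤ A₁ j)
    (hsB₁ : ∀ j ∈ m₁.index, m₁.strong j + η ≤ B₁ j) (hiB₁ : ∀ j ∈ m₁.index, m₁.inv j + η ≤ B₁ j)
    (hA₁ : ∀ j ∈ m₁.index, A₁ j ≤ D) (hB₁ : ∀ j ∈ m₁.index, B₁ j ≤ D)
    (hAB₁ : ∀ j ∈ m₁.index, A₁ j * B₁ j ≤ lam)
    (hA₂ : ∀ i ∈ m₂.index, A₂ i ≤ D) (hB₂ : ∀ i ∈ m₂.index, B₂ i ≤ D)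
    (hAB₂ : ∀ i ∈ m₂.index, A₂ i * B₂ i ≤ lam)
    (hx : (∀ i ∈ m₂.index, A₂ i ≤ lam) ∨ ∀ j ∈ m₁.index, B₁ j ≤ lam)
    (hy : (∀ j ∈ m₁.index, A₁ j ≤ lam) ∨ ∀ i ∈ m₂.index, B₂ i ≤ lam) :
    ∃ κ > 0, ∀ (d₂ : BranchDynamics ι₂ X₂ Cx₂ Cq₂ Ux₂ Uq₂)
      (d₁ : BranchDynamics ι₁ X₁ Cx₁ Cq₁ Ux₁ Uq₁), m₂.Realizes d₂ κ → m₁.Realizes d₁ κ →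
      ∀ (Rel : X₂ → X₁ → Prop) (c₂ : Ux₂ × Uq₂ → Ux₁ × Uq₁ → Cx₂ × Cq₂)
        (c₁ : Ux₁ × Uq₁ → Ux₂ × Uq₂ → Cx₁ × Cq₁), OrbitFamily m₂ d₂ m₁ d₁ Rel 0 0 c₂ c₁ →
      SmallScaleBlock m₂.fiber m₁.fiber c₂ l₂ l₂' κ →
      SmallScaleBlock m₁.fiber m₂.fiber c₁ l₁ l₁' κ → ∀ N : ℕ,
      ∃ z w, Rel z w ∧ (∀ j < N, d₂.map^[j] z ∈ d₂.K) ∧ ∀ j < N, d₁.map^[j] w ∈ d₁.K := by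
  have hD0 : 0 < D := by linarith
  have hW : 0 ≤ W := by
    obtain ⟨s, hs⟩ := h₂.nonempty
    exact (norm_nonneg _).trans (h₂.norm_sub_le s hs s hs)
  set ℓ₀ : ℝ := max (max l₂ l₂') (max l₁ l₁') with hℓ₀
  have hℓ₀0 : 0 ≤ ℓ₀ := hl₂.trans ((le_max_left _ _).trans (le_max_left _ _))
  have hl₂ℓ : l₂ ≤ ℓ₀ := (le_max_left _ _).trans (le_max_left _ _)
  have hl₂ℓ' : l₂' ≤ ℓ₀ := (le_max_right _ _).trans (le_max_left _ _)
  have hl₁ℓ : l₁ ≤ ℓ₀ := (le_max_left _ _).trans (le_max_right _ _)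
  have hl₁ℓ' : l₁' ≤ ℓ₀ := (le_max_right _ _).trans (le_max_right _ _)
  set Q : ℝ := 2 * ((2 * D + 2 * ((D + 1) * ℓ₀) + 3) * (D + (D + 1) * ℓ₀ + 1)) with hQ
  have hQ0 : 0 < Q := by positivity
  obtain ⟨θ, x₀, E, κ, J, hθ0, hθ1, hθW₁, hθW₂, hx₀0, hx₀2, hx₀θ, hE0, hEθ, hEx, hE₂, hE₁, hJ',
    hκ0, hκ2, hκlam, hκη, hκE⟩ := exists_scales hD hW hlam0 hlam1 hΔ₂ hΔ₁ hw₂ hw₁ hη hℓ₀0 hQ0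
  have hD2 : 1 ≤ D ^ 2 := one_le_pow₀ hD
  have hx₀θ' : x₀ ≤ θ := by nlinarith
  have hlam' : 0 < 1 - lam := by linarith
  have hκθ : κ * θ ≤ 1 / 2 := (mul_le_of_le_one_right hκ0.le hθ1).trans hκ2
  have slack : ∀ r a : ℝ, a ≤ D → r + η ≤ a → r + κ ≤ a * (1 - κ * θ) := by
    intro r a haD hra
    have : a * (κ * θ) ≤ D * (κ * 1) :=
      mul_le_mul haD (by gcongr) (by positivity) (by positivity)
    nlinarith
  have pos : ∀ r a : ℝ, 0 ≤ r → r + η ≤ a → 0 < a := fun r a h1 h2 => by linarith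
  refine ⟨κ, hκ0, fun d₂ d₁ hd₂ hd₁ Rel c₂ c₁ hfam hc₂ hc₁ N => ?_⟩
  -- simultaneous steps, until the widths are small
  obtain ⟨c₂, c₁, hfam, hc₂, hc₁⟩ := exists_block_orbitFamily h₂ h₁ hD0.le hlam0.le hlam1.le
    hstrong hcross₂ hcross₁ hs₂ hs₁ (by linarith) hl₂ hl₂' hl₁ hl₁' hl₂ℓ hl₂ℓ' hl₁ℓ hl₁ℓ' hE₂ hE₁
    hQ hκ0.le hκ2 hd₂ hd₁ hfam hc₂ hc₁ J hκE
  have hlamJ : 0 ≤ lam ^ J := by positivity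
  have lip₂ := (hc₂.mono le_rfl le_rfl hκE).lipschitz (ℓ := x₀ / 2) (by positivity)
    ((mul_le_mul_of_nonneg_left hl₂ℓ hlamJ).trans hJ')
    ((mul_le_mul_of_nonneg_left hl₂ℓ' hlamJ).trans hJ') hE0.le
  have lip₁ := (hc₁.mono le_rfl le_rfl hκE).lipschitz (ℓ := x₀ / 2) (by positivity)
    ((mul_le_mul_of_nonneg_left hl₁ℓ hlamJ).trans hJ')
    ((mul_le_mul_of_nonneg_left hl₁ℓ' hlamJ).trans hJ') hE0.le
  set x₁ : ℝ := x₀ / 2 + E with hx₁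
  have hx₁0 : 0 < x₁ := by positivity
  have hx₁x : x₁ ≤ x₀ := by linarith
  have hstart : WidthState m₂ d₂ m₁ d₁ Rel κ lam θ J J x₁ x₁ := by
    have h1 : 2 * κ / (1 - lam) ≤ 2 * θ := by
      rw [div_le_iff₀ hlam']
      linarith
    have h2 : x₁ * x₁ ≤ 1 / 4 :=
      (mul_self_le_mul_self hx₁0.le (hx₁x.trans hx₀2)).trans (by norm_num)
    have h3 : 2 * κ / (1 - lam) * (x₁ * x₁) ≤ 2 * θ * (1 / 4) :=
      mul_le_mul h1 h2 (by positivity) (by positivity)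
    exact ⟨hx₁0, hx₁0, c₂, c₁, E, E, hfam, lip₂, lip₁, hE0.le, hE0.le, by linarith, by linarith⟩
  -- then one machine is advanced at a time
  obtain ⟨n, m, x, y, hn, hm, hgood⟩ := exists_schedule (S₁ := m₁.index) (S₂ := m₂.index)
    (Good := WidthState m₂ d₂ m₁ d₁ Rel κ lam θ) (X := θ) (Y := x₀ * x₀) hD hθ0
    (by
      have h1 : x₀ * D ^ 2 * (x₀ * D ^ 2) ≤ θ * θ := by gcongr
      have h2 : D ^ 3 ≤ D ^ 4 := pow_le_pow_right₀ hD (by norm_num)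
      have h3 : x₀ * x₀ * D ^ 3 ≤ x₀ * x₀ * D ^ 4 := by gcongr
      linarith) hlam0 hlam1 hA₁ hB₁ hAB₁ hA₂ hB₂ hAB₂ hx hy (fun _ _ _ _ h => ⟨h.1, h.2.1⟩)
    (fun n m x y h hxX _ => h.exists_advance h₂ h₁ hs₂ hd₂ hκ0.le hκlam hlam0.le hlam1 hκθ
      (fun i hi => pos _ _ (h₂.strong_nonneg i hi) (hsA₂ i hi))
      (fun i hi => pos _ _ (h₂.strong_nonneg i hi) (hsB₂ i hi)) hAB₂
      (fun i hi => slack _ _ (hA₂ i hi) (hsA₂ i hi)) (fun i hi => slack _ _ (hA₂ i hi) (hcA₂ i hi))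
      (fun i hi => slack _ _ (hB₂ i hi) (hsB₂ i hi)) (fun i hi => slack _ _ (hB₂ i hi) (hiB₂ i hi))
      hxX hθW₂)
    (fun n m x y h _ hyX => by
      obtain ⟨j, hj, h'⟩ := h.flip.exists_advance h₁ h₂ hs₁ hd₁ hκ0.le hκlam hlam0.le hlam1 hκθ
        (fun i hi => pos _ _ (h₁.strong_nonneg i hi) (hsA₁ i hi))
        (fun i hi => pos _ _ (h₁.strong_nonneg i hi) (hsB₁ i hi)) hAB₁
        (fun i hi => slack _ _ (hA₁ i hi) (hsA₁ i hi))
        (fun i hi => slack _ _ (hA₁ i hi) (hcA₁ i hi))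
        (fun i hi => slack _ _ (hB₁ i hi) (hsB₁ i hi))
        (fun i hi => slack _ _ (hB₁ i hi) (hiB₁ i hi)) hyX hθW₁
      exact ⟨j, hj, h'.flip⟩)
    hstart (hx₁x.trans hx₀θ') (hx₁x.trans hx₀θ') (by gcongr) N
  obtain ⟨-, -, c₂, c₁, -, -, hfam, -⟩ := hgood
  obtain ⟨s, hs⟩ := h₂.nonempty
  obtain ⟨t, ht⟩ := h₁.nonempty
  obtain ⟨-, -, z, w, hzw, -, -, hz, hw⟩ := hfam s hs t ht
  exact ⟨z, w, hzw, fun j hj => hz j (by omega), fun j hj => hw j (by omega)⟩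

/-! ### Branches of perturbations of a map with block diagonal derivative -/

/-- The inverse of a continuous injective map on a compact set is uniformly continuous. -/
theorem exists_dist_lt_of_injOn_isCompact {X Y : Type*} [MetricSpace X] [MetricSpace Y] {K : Set X}
    (hK : IsCompact K) {f : X → Y} (hf : ContinuousOn f K) (hinj : InjOn f K) {η : ℝ} (hη : 0 < η) :
    ∃ δ > 0, ∀ x ∈ K, ∀ y ∈ K, dist (f x) (f y) < δ → dist x y < η := by
  set K' : Set (X × X) := (K ×ˢ K) ∩ {p | η ≤ dist p.1 p.2} with hK'
  have hc : IsCompact K' := (hK.prod hK).inter_right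
    (isClosed_le continuous_const continuous_dist)
  rcases K'.eq_empty_or_nonempty with he | hne
  · refine ⟨1, one_pos, fun x hx y hy _ => ?_⟩
    by_contra hcon
    have : (x, y) ∈ K' := ⟨⟨hx, hy⟩, not_lt.1 hcon⟩
    simp [he] at this
  · have hcont : ContinuousOn (fun p : X × X => dist (f p.1) (f p.2)) K' :=
      continuous_dist.comp_continuousOn
        ((hf.comp continuous_fst.continuousOn fun (p : X × X) (hp : p ∈ K') => hp.1.1).prodMk
          (hf.comp continuous_snd.continuousOn fun (p : X × X) (hp : p ∈ K') => hp.1.2))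
    obtain ⟨p, hp, hmin⟩ := hc.exists_isMinOn hne hcont
    refine ⟨dist (f p.1) (f p.2), ?_, fun x hx y hy hlt => ?_⟩
    · refine dist_pos.2 fun heq => ?_
      have h1 : η ≤ dist p.1 p.2 := hp.2
      rw [hinj hp.1.1 hp.1.2 heq, dist_self] at h1
      linarith
    · by_contra hcon
      exact absurd hlt (not_lt.2 (hmin (show (x, y) ∈ K' from ⟨⟨hx, hy⟩, not_lt.1 hcon⟩)))

section Branch

variable {C U C' U' : Type*} [NormedAddCommGroup C] [NormedSpace ℝ C] [NormedAddCommGroup U]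
  [NormedSpace ℝ U] [NormedAddCommGroup C'] [NormedSpace ℝ C'] [NormedAddCommGroup U']
  [NormedSpace ℝ U']

/-- A solution of an equation `(g (c, v)).2 = s` near a point where the derivative of `g` is close
to a block diagonal map. -/
theorem exists_branch_point [CompleteSpace U] {g : C × U → C' × U'} {a : C →L[ℝ] C'}
    {b : U ≃L[ℝ] U'} {c : C} {v₀ : U} {s : U'} {r κ β : ℝ} (hr : 0 ≤ r)
    (hg : ∀ x ∈ Metric.closedBall (c, v₀) r, ∀ y ∈ Metric.closedBall (c, v₀) r,
      ‖g x - g y - (a.prodMap (b : U →L[ℝ] U')) (x - y)‖ ≤ κ * ‖x - y‖)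
    (hβ : ‖(b.symm : U' →L[ℝ] U)‖ ≤ β) (hβκ : β * κ ≤ 1 / 2)
    (h0 : β * ‖(g (c, v₀)).2 - s‖ ≤ r / 2) : ∃ v, ‖v - v₀‖ ≤ r ∧ (g (c, v)).2 = s := by
  set T : U → U := fun v => v - b.symm ((g (c, v)).2 - s) with hT
  have hβ0 : 0 ≤ β := (norm_nonneg _).trans hβ
  have hmem : ∀ v ∈ Metric.closedBall v₀ r, (c, v) ∈ Metric.closedBall (c, v₀) r := by
    intro v hv
    rw [Metric.mem_closedBall, Prod.dist_eq, dist_self]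
    exact max_le hr hv
  have hcontr : ∀ v ∈ Metric.closedBall v₀ r, ∀ w ∈ Metric.closedBall v₀ r,
      ‖T v - T w‖ ≤ 1 / 2 * ‖v - w‖ := by
    intro v hv w hw
    have h1 := hg _ (hmem v hv) _ (hmem w hw)
    have hprod : ∀ z, ((a.prodMap (b : U →L[ℝ] U')) z).2 = b z.2 := fun _ => rfl
    have h2 : T v - T w = -b.symm (g (c, v) - g (c, w) -
        (a.prodMap (b : U →L[ℝ] U')) ((c, v) - (c, w))).2 := by
      simp only [hT, Prod.snd_sub, hprod, Prod.mk_sub_mk, map_sub,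
        ContinuousLinearEquiv.symm_apply_apply]
      abel
    rw [h2, norm_neg]
    calc _ ≤ ‖(b.symm : U' →L[ℝ] U)‖ * ‖(g (c, v) - g (c, w) -
          (a.prodMap (b : U →L[ℝ] U')) ((c, v) - (c, w))).2‖ :=
            (b.symm : U' →L[ℝ] U).le_opNorm _
      _ ≤ β * (κ * ‖((c, v) : C × U) - (c, w)‖) := by
          gcongr
          exact (norm_snd_le _).trans h1
      _ = β * κ * ‖v - w‖ := by simp [Prod.norm_def, mul_assoc]
      _ ≤ _ := by gcongr
  have hv₀ : v₀ ∈ Metric.closedBall v₀ r := Metric.mem_closedBall_self hr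
  have hT0 : ‖T v₀ - v₀‖ ≤ r / 2 := by
    have : T v₀ - v₀ = -b.symm ((g (c, v₀)).2 - s) := by simp [hT]
    rw [this, norm_neg]
    refine ((b.symm : U' →L[ℝ] U).le_opNorm _).trans (le_trans ?_ h0)
    gcongr
  have hmaps : MapsTo T (Metric.closedBall v₀ r) (Metric.closedBall v₀ r) := by
    intro v hv
    have h1 := hcontr v hv v₀ hv₀
    rw [Metric.mem_closedBall, dist_eq_norm] at hv ⊢
    calc ‖T v - v₀‖ = ‖(T v - T v₀) + (T v₀ - v₀)‖ := by rw [sub_add_sub_cancel]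
      _ ≤ 1 / 2 * ‖v - v₀‖ + r / 2 := (norm_add_le _ _).trans (add_le_add h1 hT0)
      _ ≤ r := by linarith
  have hK : ContractingWith (1 / 2) (hmaps.restrict T _ _) := by
    refine ⟨?_, LipschitzWith.of_dist_le_mul fun x y => ?_⟩
    · exact NNReal.half_lt_self one_ne_zero
    · rw [Subtype.dist_eq, Subtype.dist_eq, dist_eq_norm, dist_eq_norm]
      exact_mod_cast hcontr x x.2 y y.2
  obtain ⟨v, hv, hfix, -⟩ := ContractingWith.exists_fixedPoint' (x := v₀)
    Metric.isClosed_closedBall.isComplete hmaps hK hv₀ (edist_ne_top _ _)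
  refine ⟨v, by rwa [Metric.mem_closedBall, dist_eq_norm] at hv, ?_⟩
  have h1 : v - b.symm ((g (c, v)).2 - s) = v := hfix
  have h2 : b.symm ((g (c, v)).2 - s) = 0 := by simpa using h1
  have h3 : (g (c, v)).2 - s = 0 := (map_eq_zero_iff _ b.symm.injective).1 h2
  exact sub_eq_zero.1 h3

theorem branch_estimates {g : C × U → C' × U'} {a : C →L[ℝ] C'}
    {b : U ≃L[ℝ] U'} {x y : C × U} {κ β : ℝ} (hκ : 0 ≤ κ)
    (hg : ‖g x - g y - (a.prodMap (b : U →L[ℝ] U')) (x - y)‖ ≤ κ * ‖x - y‖)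
    (hβ : ‖(b.symm : U' →L[ℝ] U)‖ ≤ β) (hβκ : β * κ ≤ 1 / 2) :
    ‖x.2 - y.2 - b.symm ((g x).2 - (g y).2)‖ ≤
      (β + 1) * κ * (2 * β + 1) * max ‖x.1 - y.1‖ ‖(g x).2 - (g y).2‖ ∧
    ‖(g x).1 - (g y).1 - a (x.1 - y.1)‖ ≤
      (β + 1) * κ * (2 * β + 1) * max ‖x.1 - y.1‖ ‖(g x).2 - (g y).2‖ := by
  have hβ0 : 0 ≤ β := (norm_nonneg _).trans hβ
  set e := g x - g y - (a.prodMap (b : U →L[ℝ] U')) (x - y) with he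
  have h1 : x.2 - y.2 - b.symm ((g x).2 - (g y).2) = -b.symm e.2 := by
    have hprod : ∀ z, ((a.prodMap (b : U →L[ℝ] U')) z).2 = b z.2 := fun _ => rfl
    simp only [he, Prod.snd_sub, hprod, map_sub, ContinuousLinearEquiv.symm_apply_apply]
    abel
  have h2 : (g x).1 - (g y).1 - a (x.1 - y.1) = e.1 := by
    simp [he]
  have h3 : ‖x.2 - y.2 - b.symm ((g x).2 - (g y).2)‖ ≤ β * (κ * ‖x - y‖) := by
    rw [h1, norm_neg]
    refine ((b.symm : U' →L[ℝ] U).le_opNorm _).trans ?_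
    gcongr
    exact (norm_snd_le _).trans hg
  have h4 : ‖x.2 - y.2‖ ≤ β * ‖(g x).2 - (g y).2‖ + β * (κ * ‖x - y‖) := by
    have h5 : ‖b.symm ((g x).2 - (g y).2)‖ ≤ β * ‖(g x).2 - (g y).2‖ :=
      ((b.symm : U' →L[ℝ] U).le_opNorm _).trans (by gcongr)
    have := norm_add_le (b.symm ((g x).2 - (g y).2)) (x.2 - y.2 - b.symm ((g x).2 - (g y).2))
    rw [add_sub_cancel] at this
    linarith
  set D := max ‖x.1 - y.1‖ ‖(g x).2 - (g y).2‖ with hD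
  have hD1 : ‖x.1 - y.1‖ ≤ D := le_max_left _ _
  have hD2 : ‖(g x).2 - (g y).2‖ ≤ D := le_max_right _ _
  have hD0 : 0 ≤ D := (norm_nonneg _).trans hD1
  have h6 : ‖x - y‖ ≤ (2 * β + 1) * D := by
    have hxy : ‖x - y‖ = max ‖x.1 - y.1‖ ‖x.2 - y.2‖ := rfl
    have h7 : β * ‖(g x).2 - (g y).2‖ ≤ β * D := by gcongr
    have h9 : β * (κ * ‖x - y‖) ≤ 1 / 2 * ‖x - y‖ := by
      rw [← mul_assoc]
      gcongr
    rcases max_choice ‖x.1 - y.1‖ ‖x.2 - y.2‖ with h8 | h8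
    · rw [hxy, h8]
      nlinarith
    · have : ‖x - y‖ ≤ β * D + 1 / 2 * ‖x - y‖ := by
        rw [hxy, h8] at h9 ⊢
        rw [hxy, h8] at h4
        linarith
      nlinarith
  have h10 : κ * ‖x - y‖ ≤ κ * ((2 * β + 1) * D) := by gcongr
  have h11 : 0 ≤ κ * ((2 * β + 1) * D) := by positivity
  constructor
  · calc _ ≤ β * (κ * ‖x - y‖) := h3
      _ ≤ β * (κ * ((2 * β + 1) * D)) := by gcongr
      _ ≤ _ := by nlinarith
  · rw [h2]
    calc _ ≤ κ * ‖x - y‖ := (norm_fst_le _).trans hg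
      _ ≤ κ * ((2 * β + 1) * D) := h10
      _ ≤ _ := by nlinarith

/-- `v` parametrizes a branch of `g` over `D × Z`: the point `(c, v c s)` lies in the fiber over `c`
and the second component of its image is `s`. -/
def IsBranch (g : C × U → C' × U') (D : Set C) (Z : Set U') (v : C → U' → U) : Prop :=
  ∀ c ∈ D, ∀ s ∈ Z, (g (c, v c s)).2 = s

/-- Let the derivative of `f` be block diagonal along the compact graph of a branch `v₀`. Every map
`g` that is `C¹` close to `f` near this graph has a branch close to `v₀`, and any such branch has
small scale estimates as if `g` were block diagonal, up to a small error. -/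
theorem exists_branches_of_close [FiniteDimensional ℝ C] [FiniteDimensional ℝ U]
    {f : C × U → C' × U'} {O K : Set (C × U)} (hO : IsOpen O) (hf : ContDiffOn ℝ 1 f O)
    (hK : IsCompact K) (hKO : K ⊆ O) {D : Set C} {Z : Set U'} {v₀ : C → U' → U}
    (hinj : InjOn (fun x => (x.1, (f x).2)) K) (hv₀ : IsBranch f D Z v₀)
    (hv₀K : ∀ c ∈ D, ∀ s ∈ Z, (c, v₀ c s) ∈ K) {β : ℝ}
    {P : (C →L[ℝ] C') → (U ≃L[ℝ] U') → Prop}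
    (hder : ∀ x ∈ K, ∃ (a : C →L[ℝ] C') (b : U ≃L[ℝ] U'),
      fderiv ℝ f x = a.prodMap (b : U →L[ℝ] U') ∧ ‖(b.symm : U' →L[ℝ] U)‖ ≤ β ∧ P a b)
    {κ ρ : ℝ} (hκ : 0 < κ) (hρ : 0 < ρ) :
    ∃ (L : Set (C × U)) (r ε : ℝ), IsCompact L ∧ L ⊆ O ∧ 0 < r ∧ 0 < ε ∧
      ∀ g : C × U → C' × U', (∀ x ∈ L, DifferentiableAt ℝ g x ∧ ‖g x - f x‖ ≤ ε ∧
        ‖fderiv ℝ g x - fderiv ℝ f x‖ ≤ ε) →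
      (∃ v, (∀ c ∈ D, ∀ s ∈ Z, ‖v c s - v₀ c s‖ ≤ r) ∧ IsBranch g D Z v) ∧
      ∀ v, (∀ c ∈ D, ∀ s ∈ Z, ‖v c s - v₀ c s‖ ≤ r) → IsBranch g D Z v →
        (∀ c ∈ D, ∀ s ∈ Z, (c, v c s) ∈ L ∧ ‖v c s - v₀ c s‖ ≤ ρ ∧
          ‖(g (c, v c s)).1 - (f (c, v₀ c s)).1‖ ≤ ρ) ∧
        ∃ δ > 0, ∀ c ∈ D, ∀ c' ∈ D, ∀ s ∈ Z, ∀ s' ∈ Z, ‖c - c'‖ < δ → ‖s - s'‖ < δ →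
          ∃ a b, P a b ∧
            ‖v c s - v c' s' - b.symm (s - s')‖ ≤ κ * max ‖c - c'‖ ‖s - s'‖ ∧
            ‖(g (c, v c s)).1 - (g (c', v c' s')).1 - a (c - c')‖ ≤
              κ * max ‖c - c'‖ ‖s - s'‖ := by
  have hcont : ContinuousOn f O := hf.continuousOn
  have hcont' : ContinuousOn (fderiv ℝ f) O := hf.continuousOn_fderiv_of_isOpen hO le_rfl
  set β' : ℝ := max β 0 with hβ'
  have hβ0 : 0 ≤ β' := le_max_right _ _
  set κ' : ℝ := min (1 / (2 * (β' + 1))) (κ / ((β' + 1) * (2 * β' + 1))) with hκ'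
  have hκ'0 : 0 < κ' := lt_min (by positivity) (by positivity)
  have hβκ : β' * κ' ≤ 1 / 2 := by
    have : κ' ≤ 1 / (2 * (β' + 1)) := min_le_left _ _
    rw [le_div_iff₀ (by positivity)] at this
    nlinarith
  have hκκ : (β' + 1) * κ' * (2 * β' + 1) ≤ κ := by
    have : κ' ≤ κ / ((β' + 1) * (2 * β' + 1)) := min_le_right _ _
    rw [le_div_iff₀ (by positivity)] at this
    linarith
  -- a scale on which `f` and its derivative are almost constant
  obtain ⟨r₁, hr₁, hr₁O⟩ := hK.exists_cthickening_subset_open hO hKO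
  have hunif : ∀ᶠ p in uniformity (C × U), p.1 ∈ K → (f p.1, f p.2) ∈
      {q : (C' × U') × (C' × U') | dist q.1 q.2 < ρ / 2} :=
    hK.uniformContinuousAt_of_continuousAt f
      (fun x hx => hcont.continuousAt (hO.mem_nhds (hKO hx)))
      (Metric.dist_mem_uniformity (by positivity))
  have hunif' : ∀ᶠ p in uniformity (C × U), p.1 ∈ K → (fderiv ℝ f p.1, fderiv ℝ f p.2) ∈
      {q : (C × U →L[ℝ] C' × U') × (C × U →L[ℝ] C' × U') | dist q.1 q.2 < κ' / 2} :=
    hK.uniformContinuousAt_of_continuousAt (fderiv ℝ f)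
      (fun x hx => hcont'.continuousAt (hO.mem_nhds (hKO hx)))
      (Metric.dist_mem_uniformity (by positivity))
  obtain ⟨r₂, hr₂, hr₂f⟩ := Metric.mem_uniformity_dist.1 hunif
  obtain ⟨r₃, hr₃, hr₃f⟩ := Metric.mem_uniformity_dist.1 hunif'
  set R : ℝ := min r₁ (min (r₂ / 2) (r₃ / 2)) with hR
  have hR0 : 0 < R := lt_min hr₁ (lt_min (by positivity) (by positivity))
  have hR1 : R ≤ r₁ := min_le_left _ _
  have hR2 : R < r₂ := lt_of_le_of_lt ((min_le_right _ _).trans (min_le_left _ _)) (by linarith)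
  have hR3 : R < r₃ := lt_of_le_of_lt ((min_le_right _ _).trans (min_le_right _ _)) (by linarith)
  set r : ℝ := min ρ (R / 3) with hr
  have hr0 : 0 < r := lt_min hρ (by positivity)
  have hrR : r ≤ R / 3 := min_le_right _ _
  set ε : ℝ := min (κ' / 2) (min (ρ / 2) (r / (2 * (β' + 1)))) with hε
  have hε0 : 0 < ε := lt_min (by positivity) (lt_min (by positivity) (by positivity))
  refine ⟨Metric.cthickening R K, r, ε, hK.cthickening,
    (Metric.cthickening_mono hR1 K).trans hr₁O, hr0, hε0, fun g hg => ?_⟩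
  have hball : ∀ x ∈ K, Metric.closedBall x R ⊆ Metric.cthickening R K := fun x hx =>
    Metric.closedBall_subset_cthickening hx R
  have hlin : ∀ x₀ ∈ K, ∀ x ∈ Metric.closedBall x₀ R, ∀ y ∈ Metric.closedBall x₀ R,
      ‖g x - g y - fderiv ℝ f x₀ (x - y)‖ ≤ κ' * ‖x - y‖ := by
    intro x₀ hx₀ x hx y hy
    refine (convex_closedBall x₀ R).norm_image_sub_le_of_norm_hasFDerivWithin_le'
      (f' := fderiv ℝ g) (fun z hz => (hg z (hball x₀ hx₀ hz)).1.hasFDerivAt.hasFDerivWithinAt)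
      (fun z hz => ?_) hy hx
    have h1 := (hg z (hball x₀ hx₀ hz)).2.2
    have h2 : dist (fderiv ℝ f x₀) (fderiv ℝ f z) < κ' / 2 :=
      hr₃f (by
        rw [dist_comm]
        exact lt_of_le_of_lt hz hR3) hx₀
    rw [dist_comm, dist_eq_norm] at h2
    have h3 : ε ≤ κ' / 2 := min_le_left _ _
    calc _ = ‖(fderiv ℝ g z - fderiv ℝ f z) + (fderiv ℝ f z - fderiv ℝ f x₀)‖ := by
          rw [sub_add_sub_cancel]
      _ ≤ _ := norm_add_le _ _
      _ ≤ κ' := by linarith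
  constructor
  · have hex : ∀ c s, ∃ w, c ∈ D → s ∈ Z → ‖w - v₀ c s‖ ≤ r ∧ (g (c, w)).2 = s := by
      intro c s
      by_cases h : c ∈ D ∧ s ∈ Z
      · have hx₀ := hv₀K c h.1 s h.2
        obtain ⟨a, b, hab, hb, -⟩ := hder _ hx₀
        obtain ⟨w, hw⟩ := exists_branch_point (g := g) (a := a) (b := b) (c := c) (v₀ := v₀ c s)
          (s := s) (κ := κ') (β := β') hr0.le (fun x hx y hy => by
            rw [← hab]
            exact hlin _ hx₀ x (Metric.closedBall_subset_closedBall (by linarith) hx) y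
              (Metric.closedBall_subset_closedBall (by linarith) hy))
          (hb.trans (le_max_left _ _)) hβκ (by
            have h1 := (hg _ (hball _ hx₀ (Metric.mem_closedBall_self hR0.le))).2.1
            have h2 : ‖(g (c, v₀ c s)).2 - s‖ ≤ ε := by
              rw [← hv₀ c h.1 s h.2, hv₀ c h.1 s h.2]
              refine le_trans ?_ h1
              have := norm_snd_le (g (c, v₀ c s) - f (c, v₀ c s))
              rwa [Prod.snd_sub, hv₀ c h.1 s h.2] at this
            have h3 : ε ≤ r / (2 * (β' + 1)) := (min_le_right _ _).trans (min_le_right _ _)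
            rw [le_div_iff₀ (by positivity)] at h3
            nlinarith)
        exact ⟨w, fun _ _ => hw⟩
      · exact ⟨0, fun h1 h2 => absurd ⟨h1, h2⟩ h⟩
    choose v hv using hex
    exact ⟨v, fun c hc s hs => (hv c s hc hs).1, fun c hc s hs => (hv c s hc hs).2⟩
  · intro v hv hvb
    have hmem : ∀ c ∈ D, ∀ s ∈ Z, (c, v c s) ∈ Metric.closedBall (c, v₀ c s) r := by
      intro c hc s hs
      rw [Metric.mem_closedBall, Prod.dist_eq, dist_self, dist_eq_norm]
      exact max_le hr0.le (hv c hc s hs)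
    constructor
    · intro c hc s hs
      have hx₀ := hv₀K c hc s hs
      have hx := Metric.closedBall_subset_closedBall (show r ≤ R by linarith) (hmem c hc s hs)
      have hL := hball _ hx₀ hx
      refine ⟨hL, (hv c hc s hs).trans (min_le_left _ _), ?_⟩
      have h1 : dist (f (c, v₀ c s)) (f (c, v c s)) < ρ / 2 := hr₂f (by
        rw [dist_comm]
        exact lt_of_le_of_lt hx hR2) hx₀
      rw [dist_comm, dist_eq_norm] at h1
      have h2 := (hg _ hL).2.1
      have h3 : ε ≤ ρ / 2 := (min_le_right _ _).trans (min_le_left _ _)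
      calc _ = ‖(g (c, v c s) - f (c, v₀ c s)).1‖ := rfl
        _ ≤ ‖(g (c, v c s) - f (c, v c s)) + (f (c, v c s) - f (c, v₀ c s))‖ := by
          rw [sub_add_sub_cancel]
          exact norm_fst_le _
        _ ≤ _ := norm_add_le _ _
        _ ≤ ρ := by linarith
    · obtain ⟨δ, hδ, hδK⟩ := exists_dist_lt_of_injOn_isCompact hK
        (f := fun x : C × U => (x.1, (f x).2))
        (continuous_fst.continuousOn.prodMk ((continuous_snd.comp_continuousOn
          (hcont.mono hKO)))) hinj (show 0 < R / 3 by positivity)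
      refine ⟨δ, hδ, fun c hc c' hc' s hs s' hs' hcc hss => ?_⟩
      have hx₀ := hv₀K c hc s hs
      have hy₀ := hv₀K c' hc' s' hs'
      obtain ⟨a, b, hab, hb, hP⟩ := hder _ hx₀
      have hclose : dist (c, v₀ c s) (c', v₀ c' s') < R / 3 := by
        refine hδK _ hx₀ _ hy₀ ?_
        rw [Prod.dist_eq]
        simp only [hv₀ c hc s hs, hv₀ c' hc' s' hs', dist_eq_norm]
        exact max_lt hcc hss
      have hx := Metric.closedBall_subset_closedBall (show r ≤ R by linarith) (hmem c hc s hs)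
      have hy : (c', v c' s') ∈ Metric.closedBall (c, v₀ c s) R := by
        have h1 := hmem c' hc' s' hs'
        rw [Metric.mem_closedBall] at h1 ⊢
        have := dist_triangle (c', v c' s') (c', v₀ c' s') (c, v₀ c s)
        rw [dist_comm (c', v₀ c' s')] at this
        linarith
      have hl := hlin _ hx₀ _ hx _ hy
      rw [hab] at hl
      obtain ⟨h1, h2⟩ := branch_estimates hκ'0.le hl (hb.trans (le_max_left _ _)) hβκ
      simp only [hvb c hc s hs, hvb c' hc' s' hs'] at h1 h2
      exact ⟨a, b, hP, h1.trans (by gcongr), h2.trans (by gcongr)⟩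

end Branch

/-! ### Maps between manifolds in global coordinates -/

section Coordinates

variable {E H : Type*} [NormedAddCommGroup E] [NormedSpace ℝ E] [TopologicalSpace H]
  {I : ModelWithCorners ℝ E H}
  {E' H' : Type*} [NormedAddCommGroup E'] [NormedSpace ℝ E'] [TopologicalSpace H']
  {I' : ModelWithCorners ℝ E' H'}
  {X : Type*} [TopologicalSpace X] [ChartedSpace H X]
  {Y : Type*} [TopologicalSpace Y] [ChartedSpace H' Y]
  {F F' : Type*} [NormedAddCommGroup F] [NormedSpace ℝ F]
  [NormedAddCommGroup F'] [NormedSpace ℝ F']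

/-- A diffeomorphism onto an open image, as a partial diffeomorphism. -/
theorem IsDiffeoOntoImage.exists_partialDiffeomorph [Nonempty X] {f : X → Y} {W : Set X}
    (hf : IsDiffeoOntoImage I I' f W) :
    ∃ Φ : PartialDiffeomorph I I' X Y 1, Φ.source = W ∧ Φ.toFun = f := by
  obtain ⟨hW, hinj, hloc⟩ := hf
  have key : ∀ x ∈ W, ∃ Φ : PartialDiffeomorph I I' X Y 1, x ∈ Φ.source ∧
      EqOn f Φ Φ.source := fun x hx => hloc ⟨x, hx⟩
  have hopen : ∀ Φ : PartialDiffeomorph I I' X Y 1, IsOpen (Φ '' (Φ.source ∩ W)) := fun Φ =>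
    Φ.toOpenPartialHomeomorph.isOpen_image_source_inter hW
  refine ⟨{ toPartialEquiv := hinj.toPartialEquiv f W, open_source := hW, open_target := ?_,
            contMDiffOn_toFun := hloc.contMDiffOn, contMDiffOn_invFun := ?_ }, rfl, rfl⟩
  · change IsOpen (f '' W)
    rw [isOpen_iff_mem_nhds]
    rintro _ ⟨x, hx, rfl⟩
    obtain ⟨Φ, hxΦ, hΦ⟩ := key x hx
    refine mem_of_superset ((hopen Φ).mem_nhds ⟨x, ⟨hxΦ, hx⟩, (hΦ hxΦ).symm⟩) ?_
    rintro _ ⟨z, hz, rfl⟩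
    exact ⟨z, hz.2, hΦ hz.1⟩
  · change ContMDiffOn I' I 1 (invFunOn f W) (f '' W)
    rintro _ ⟨x, hx, rfl⟩
    obtain ⟨Φ, hxΦ, hΦ⟩ := key x hx
    have hxt : f x ∈ Φ.target := by
      rw [hΦ hxΦ]
      exact Φ.map_source hxΦ
    refine ContMDiffAt.contMDiffWithinAt (ContMDiffAt.congr_of_eventuallyEq
      (f := Φ.symm) ((Φ.contMDiffOn_invFun _ hxt).contMDiffAt (Φ.open_target.mem_nhds hxt)) ?_)
    filter_upwards [(hopen Φ).mem_nhds ⟨x, ⟨hxΦ, hx⟩, (hΦ hxΦ).symm⟩]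
    rintro _ ⟨z, hz, rfl⟩
    rw [← hΦ hz.1, hinj.leftInvOn_invFunOn hz.2, hΦ hz.1]
    exact (Φ.left_inv hz.1).symm

/-- A map between manifolds in the coordinates given by partial diffeomorphisms to vector spaces. -/
def inCoordinates (Φ : PartialDiffeomorph I 𝓘(ℝ, F) X F 1)
    (Φ' : PartialDiffeomorph I' 𝓘(ℝ, F') Y F' 1) (f : X → Y) : F → F' :=
  fun y => Φ' (f (Φ.symm y))

theorem differentiableAt_inCoordinates {Φ : PartialDiffeomorph I 𝓘(ℝ, F) X F 1}
    {Φ' : PartialDiffeomorph I' 𝓘(ℝ, F') Y F' 1} {f : X → Y} {y : F} (hy : y ∈ Φ.target)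
    (hf : MDifferentiableAt I I' f (Φ.symm y)) (hy' : f (Φ.symm y) ∈ Φ'.source) :
    DifferentiableAt ℝ (inCoordinates Φ Φ' f) y ∧ ∀ v : F, fderiv ℝ (inCoordinates Φ Φ' f) y v =
      mfderiv I' 𝓘(ℝ, F') Φ' (f (Φ.symm y))
        (mfderiv I I' f (Φ.symm y) (mfderiv 𝓘(ℝ, F) I Φ.symm y v)) := by
  have h1 := Φ.symm.mdifferentiableAt one_ne_zero hy
  have h2 := Φ'.mdifferentiableAt one_ne_zero hy'
  have h3 : MDifferentiableAt 𝓘(ℝ, F) I' (f ∘ Φ.symm) y := hf.comp y h1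
  have h4 : MDifferentiableAt 𝓘(ℝ, F) 𝓘(ℝ, F') (Φ'.toFun ∘ (f ∘ Φ.symm.toFun)) y := h2.comp y h3
  refine ⟨h4.differentiableAt, fun v => ?_⟩
  rw [← mfderiv_eq_fderiv]
  have h5 := mfderiv_comp_apply (I := 𝓘(ℝ, F)) (I' := I') (I'' := 𝓘(ℝ, F')) y h2 h3 v
  have h6 := mfderiv_comp_apply (I := 𝓘(ℝ, F)) (I' := I) (I'' := I') y hf h1 v
  rw [h6] at h5
  exact h5

theorem fderiv_inCoordinates_mfderiv {Φ : PartialDiffeomorph I 𝓘(ℝ, F) X F 1}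
    {Φ' : PartialDiffeomorph I' 𝓘(ℝ, F') Y F' 1} {f : X → Y} {x : X} (hx : x ∈ Φ.source)
    (hf : MDifferentiableAt I I' f x) (hx' : f x ∈ Φ'.source) :
    DifferentiableAt ℝ (inCoordinates Φ Φ' f) (Φ x) ∧ ∀ v : TangentSpace I x,
      fderiv ℝ (inCoordinates Φ Φ' f) (Φ x) (mfderiv I 𝓘(ℝ, F) Φ x v : F) =
      (mfderiv I' 𝓘(ℝ, F') Φ' (f x) (mfderiv I I' f x v) : F') := by
  have hinv : Φ.symm (Φ x) = x := Φ.left_inv hx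
  have h1 : DifferentiableAt ℝ (inCoordinates Φ Φ' f) (Φ x) :=
    (differentiableAt_inCoordinates (Φ.map_source hx) (by rwa [hinv]) (by rwa [hinv])).1
  refine ⟨h1, fun v => ?_⟩
  have h2 := mfderiv_comp_apply (I := I) (I' := 𝓘(ℝ, F)) (I'' := 𝓘(ℝ, F')) x
    (g := inCoordinates Φ Φ' f) h1.mdifferentiableAt (Φ.mdifferentiableAt one_ne_zero hx) v
  have h3 := mfderiv_comp_apply (I := I) (I' := I') (I'' := 𝓘(ℝ, F')) x
    (Φ'.mdifferentiableAt one_ne_zero hx') hf v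
  have h4 : (inCoordinates Φ Φ' f ∘ Φ.toFun) =ᶠ[𝓝 x] Φ'.toFun ∘ f := by
    filter_upwards [Φ.open_source.mem_nhds hx] with z hz
    change Φ' (f (Φ.symm (Φ z))) = Φ' (f z)
    have h5 : Φ.symm (Φ z) = z := Φ.left_inv hz
    rw [h5]
  have h6 : mfderiv I 𝓘(ℝ, F') (inCoordinates Φ Φ' f ∘ Φ.toFun) x =
      mfderiv I 𝓘(ℝ, F') (Φ'.toFun ∘ f) x := h4.mfderiv_eq
  rw [← mfderiv_eq_fderiv]
  refine h2.symm.trans (Eq.trans ?_ h3)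
  rw [h6]
  rfl

theorem contDiffOn_inCoordinates {Φ : PartialDiffeomorph I 𝓘(ℝ, F) X F 1}
    {Φ' : PartialDiffeomorph I' 𝓘(ℝ, F') Y F' 1} {f : X → Y} {U : Set X}
    (hf : ContMDiffOn I I' 1 f U) :
    ContDiffOn ℝ 1 (inCoordinates Φ Φ' f)
      {y | y ∈ Φ.target ∧ Φ.symm y ∈ U ∧ f (Φ.symm y) ∈ Φ'.source} := by
  rw [← contMDiffOn_iff_contDiffOn]
  exact Φ'.contMDiffOn_toFun.comp (hf.comp (Φ.contMDiffOn_invFun.mono fun y hy => hy.1)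
    fun y hy => hy.2.1) fun y hy => hy.2.2

theorem isOpen_inCoordinates_domain {Φ : PartialDiffeomorph I 𝓘(ℝ, F) X F 1}
    {Φ' : PartialDiffeomorph I' 𝓘(ℝ, F') Y F' 1} {f : X → Y} {U : Set X} (hU : IsOpen U)
    (hf : ContinuousOn f U) :
    IsOpen {y | y ∈ Φ.target ∧ Φ.symm y ∈ U ∧ f (Φ.symm y) ∈ Φ'.source} := by
  have h1 := hf.isOpen_inter_preimage hU Φ'.open_source
  exact Φ.contMDiffOn_invFun.continuousOn.isOpen_inter_preimage Φ.open_target h1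

variable [IsManifold I 1 X] [IsManifold I' 1 Y]

theorem continuousOn_tangentMap_toSpace {f : X → F} {W : Set X} (hW : IsOpen W)
    (hf : ContMDiffOn I 𝓘(ℝ, F) 1 f W) :
    ContinuousOn (fun v : TangentBundle I X =>
      ((f v.proj, mfderiv I 𝓘(ℝ, F) f v.proj v.2) : F × F)) {v | v.proj ∈ W} := by
  have h1 := hf.continuousOn_tangentMapWithin le_rfl hW.uniqueMDiffOn
  have h2 : ContinuousOn (fun v => tangentBundleModelSpaceHomeomorph 𝓘(ℝ, F)
      (tangentMapWithin I 𝓘(ℝ, F) f W v)) {v | v.proj ∈ W} :=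
    (tangentBundleModelSpaceHomeomorph 𝓘(ℝ, F)).continuous.comp_continuousOn h1
  refine h2.congr fun v hv => ?_
  change _ = (f v.proj, mfderivWithin I 𝓘(ℝ, F) f W v.proj v.2)
  rw [mfderivWithin_of_isOpen hW hv]
  rfl

theorem continuousOn_tangentMap_ofSpace {f : F → X} {W : Set F} (hW : IsOpen W)
    (hf : ContMDiffOn 𝓘(ℝ, F) I 1 f W) :
    ContinuousOn (fun p : F × F =>
      (⟨f p.1, mfderiv 𝓘(ℝ, F) I f p.1 p.2⟩ : TangentBundle I X)) (W ×ˢ univ) := by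
  have h1 := hf.continuousOn_tangentMapWithin le_rfl hW.uniqueMDiffOn
  have h2 : ContinuousOn (fun p : F × F => tangentMapWithin 𝓘(ℝ, F) I f W
      ((tangentBundleModelSpaceHomeomorph 𝓘(ℝ, F)).symm p)) (W ×ˢ univ) :=
    h1.comp (tangentBundleModelSpaceHomeomorph 𝓘(ℝ, F)).symm.continuous.continuousOn
      fun p hp => hp.1
  refine h2.congr fun p hp => ?_
  change _ = (⟨f p.1, mfderivWithin 𝓘(ℝ, F) I f W p.1 p.2⟩ : TangentBundle I X)
  rw [mfderivWithin_of_isOpen hW hp.1]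

/-- Compact sets of tangent vectors where a map is to be close to `f` in the `C¹` topology translate
into compact sets of points where the coordinate expressions are uniformly close with their
derivatives. -/
theorem exists_c1Nhds_inCoordinates [FiniteDimensional ℝ F]
    (Φ : PartialDiffeomorph I 𝓘(ℝ, F) X F 1) (Φ' : PartialDiffeomorph I' 𝓘(ℝ, F') Y F' 1)
    {f : X → Y} {U : Set X} (hU : IsOpen U) (hf : ContMDiffOn I I' 1 f U) {L : Set F}
    (hL : IsCompact L)
    (hLU : L ⊆ {y | y ∈ Φ.target ∧ Φ.symm y ∈ U ∧ f (Φ.symm y) ∈ Φ'.source})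
    {ε : ℝ} (hε : 0 < ε) :
    ∃ 𝒰 ∈ @nhds _ (c1Topology I I' U) f, ∀ g ∈ 𝒰, ContMDiffOn I I' 1 g U → ∀ y ∈ L,
      g (Φ.symm y) ∈ Φ'.source ∧ DifferentiableAt ℝ (inCoordinates Φ Φ' g) y ∧
      ‖inCoordinates Φ Φ' g y - inCoordinates Φ Φ' f y‖ ≤ ε ∧
      ‖fderiv ℝ (inCoordinates Φ Φ' g) y - fderiv ℝ (inCoordinates Φ Φ' f) y‖ ≤ ε := by
  let τ : F × F → TangentBundle I X := fun p => ⟨Φ.symm p.1, mfderiv 𝓘(ℝ, F) I Φ.symm p.1 p.2⟩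
  let σ : TangentBundle I' Y → F' × F' := fun w => (Φ' w.proj, mfderiv I' 𝓘(ℝ, F') Φ' w.proj w.2)
  have hτ : ContinuousOn τ (Φ.target ×ˢ univ) :=
    continuousOn_tangentMap_ofSpace Φ.open_target Φ.contMDiffOn_invFun
  have hσ : ContinuousOn σ {w | w.proj ∈ Φ'.source} :=
    continuousOn_tangentMap_toSpace Φ'.open_source Φ'.contMDiffOn_toFun
  have hσo : IsOpen {w : TangentBundle I' Y | w.proj ∈ Φ'.source} :=
    Φ'.open_source.preimage (FiberBundle.continuous_proj E' (TangentSpace I'))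
  have hfT : ContinuousOn (tangentMap I I' f) {v | v.proj ∈ U} := by
    refine (hf.continuousOn_tangentMapWithin le_rfl hU.uniqueMDiffOn).congr fun v hv => ?_
    exact (tangentMapWithin_eq_tangentMap (hU.uniqueMDiffOn v.1 hv)
      ((hf.mdifferentiableOn one_ne_zero v.1 hv).mdifferentiableAt (hU.mem_nhds hv))).symm
  have hUo : IsOpen {v : TangentBundle I X | v.proj ∈ U} :=
    hU.preimage (FiberBundle.continuous_proj E (TangentSpace I))
  set 𝓛 : Set (F × F) := L ×ˢ Metric.closedBall 0 1 with h𝓛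
  have h𝓛c : IsCompact 𝓛 := hL.prod (isCompact_closedBall 0 1)
  have hτ𝓛 : ContinuousOn τ 𝓛 := hτ.mono fun p hp => ⟨(hLU hp.1).1, mem_univ _⟩
  -- closeness of the tangent maps on the compact set `𝓛` of vectors
  have key : ∃ 𝒰 ∈ @nhds _ (c1Topology I I' U) f, ∀ g ∈ 𝒰, ∀ p ∈ 𝓛,
      (tangentMap I I' g (τ p)).proj ∈ Φ'.source ∧
      dist (σ (tangentMap I I' g (τ p))) (σ (tangentMap I I' f (τ p))) < ε := by
    refine h𝓛c.induction_on (p := fun S => ∃ 𝒰 ∈ @nhds _ (c1Topology I I' U) f, ∀ g ∈ 𝒰, ∀ p ∈ S,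
      (tangentMap I I' g (τ p)).proj ∈ Φ'.source ∧
      dist (σ (tangentMap I I' g (τ p))) (σ (tangentMap I I' f (τ p))) < ε) ?_ ?_ ?_ ?_
    · exact ⟨univ, Filter.univ_mem, fun g _ p hp => hp.elim⟩
    · rintro S S' hSS' ⟨𝒰, h1, h2⟩
      exact ⟨𝒰, h1, fun g hg p hp => h2 g hg p (hSS' hp)⟩
    · rintro S S' ⟨𝒰, h1, h2⟩ ⟨𝒰', h1', h2'⟩
      exact ⟨𝒰 ∩ 𝒰', Filter.inter_mem h1 h1', fun g hg p hp =>
        hp.elim (h2 g hg.1 p) (h2' g hg.2 p)⟩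
    · intro p₀ hp₀
      set q₀ := σ (tangentMap I I' f (τ p₀)) with hq₀
      set O : Set (TangentBundle I' Y) := {w | w.proj ∈ Φ'.source} ∩ σ ⁻¹' Metric.ball q₀ (ε / 2)
        with hO
      have hOo : IsOpen O := hσ.isOpen_inter_preimage hσo Metric.isOpen_ball
      have hfO : tangentMap I I' f (τ p₀) ∈ O :=
        ⟨(hLU hp₀.1).2.2, Metric.mem_ball_self (by positivity)⟩
      have hnear : {p | tangentMap I I' f (τ p) ∈ O} ∈ 𝓝[𝓛] p₀ := by
        have h1 : ContinuousWithinAt (fun p => tangentMap I I' f (τ p)) 𝓛 p₀ := by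
          have h2 : ContinuousAt (tangentMap I I' f) (τ p₀) :=
            hfT.continuousAt (hUo.mem_nhds (hLU hp₀.1).2.1)
          exact ContinuousAt.comp_continuousWithinAt (f := τ) h2 (hτ𝓛 p₀ hp₀)
        exact h1.preimage_mem_nhdsWithin (hOo.mem_nhds hfO)
      obtain ⟨N, hN, hNO⟩ := mem_nhdsWithin_iff_exists_mem_nhds_inter.1 hnear
      obtain ⟨N', hN', hN'c, hN'N⟩ := exists_mem_nhds_isClosed_subset hN
      refine ⟨N' ∩ 𝓛, inter_mem (mem_nhdsWithin_of_mem_nhds hN') self_mem_nhdsWithin,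
        {g | MapsTo (tangentMap I I' g) (τ '' (N' ∩ 𝓛)) O}, ?_, ?_⟩
      · let := c1Topology (Y := Y) I I' U
        refine IsOpen.mem_nhds ?_ ?_
        · refine TopologicalSpace.isOpen_generateFrom_of_mem ⟨τ '' (N' ∩ 𝓛), O, ?_, ?_, hOo, rfl⟩
          · exact (h𝓛c.inter_left hN'c).image_of_continuousOn (hτ𝓛.mono inter_subset_right)
          · rintro _ ⟨p, hp, rfl⟩
            exact (hLU hp.2.1).2.1
        · rintro _ ⟨p, hp, rfl⟩
          exact hNO ⟨hN'N hp.1, hp.2⟩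
      · intro g hg p hp
        have h1 : tangentMap I I' g (τ p) ∈ O := hg ⟨p, hp, rfl⟩
        have h2 : tangentMap I I' f (τ p) ∈ O := hNO ⟨hN'N hp.1, hp.2⟩
        refine ⟨h1.1, ?_⟩
        have h3 := dist_triangle_right (σ (tangentMap I I' g (τ p)))
          (σ (tangentMap I I' f (τ p))) q₀
        have h4 : dist (σ (tangentMap I I' g (τ p))) q₀ < ε / 2 := h1.2
        have h5 : dist (σ (tangentMap I I' f (τ p))) q₀ < ε / 2 := h2.2
        linarith
  obtain ⟨𝒰, h𝒰, hclose⟩ := key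
  refine ⟨𝒰, h𝒰, fun g hg hgU y hy => ?_⟩
  obtain ⟨hy1, hy2, hy3⟩ := hLU hy
  have hg1 : g (Φ.symm y) ∈ Φ'.source :=
    (hclose g hg (y, 0) ⟨hy, Metric.mem_closedBall_self zero_le_one⟩).1
  obtain ⟨hdg, hdg'⟩ := differentiableAt_inCoordinates (Φ' := Φ') hy1
    ((hgU.mdifferentiableOn one_ne_zero _ hy2).mdifferentiableAt (hU.mem_nhds hy2)) hg1
  obtain ⟨hdf, hdf'⟩ := differentiableAt_inCoordinates (Φ' := Φ') hy1
    ((hf.mdifferentiableOn one_ne_zero _ hy2).mdifferentiableAt (hU.mem_nhds hy2)) hy3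
  have hvec : ∀ v ∈ Metric.closedBall (0 : F) 1,
      ‖inCoordinates Φ Φ' g y - inCoordinates Φ Φ' f y‖ ≤ ε ∧
      ‖fderiv ℝ (inCoordinates Φ Φ' g) y v - fderiv ℝ (inCoordinates Φ Φ' f) y v‖ ≤ ε := by
    intro v hv
    have h1 := (hclose g hg (y, v) ⟨hy, hv⟩).2
    have h2 := max_le_iff.1 h1.le
    refine ⟨(dist_eq_norm _ _).symm.trans_le h2.1, ?_⟩
    rw [hdg', hdf']
    exact (dist_eq_norm (E := F') _ _).symm.trans_le h2.2
  refine ⟨hg1, hdg, (hvec 0 (Metric.mem_closedBall_self zero_le_one)).1, ?_⟩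
  refine ContinuousLinearMap.opNorm_le_of_unit_norm hε.le fun v hv => ?_
  rw [sub_apply]
  exact (hvec v (by simp [hv])).2

end Coordinates

/-! ### Local diffeomorphisms and the inverse function theorem -/

section LocalDiffeo

variable {E H : Type*} [NormedAddCommGroup E] [NormedSpace ℝ E] [TopologicalSpace H]
  {I : ModelWithCorners ℝ E H}
  {E' H' : Type*} [NormedAddCommGroup E'] [NormedSpace ℝ E'] [TopologicalSpace H']
  {I' : ModelWithCorners ℝ E' H'}
  {X : Type*} [TopologicalSpace X] [ChartedSpace H X]
  {Y : Type*} [TopologicalSpace Y] [ChartedSpace H' Y]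
  {F F' : Type*} [NormedAddCommGroup F] [NormedSpace ℝ F]
  [NormedAddCommGroup F'] [NormedSpace ℝ F']

theorem PartialDiffeomorph.isLocalDiffeomorphAt_of_mem (Φ : PartialDiffeomorph I I' X Y 1) {x : X}
    (hx : x ∈ Φ.source) : IsLocalDiffeomorphAt I I' 1 Φ x :=
  ⟨Φ, hx, fun _ _ => rfl⟩

/-- The inverse function theorem, producing a local diffeomorphism in the sense of manifolds. -/
theorem isLocalDiffeomorphAt_of_hasFDerivAt [CompleteSpace F] {f : F → F'} {x : F}
    (hf : ContDiffAt ℝ 1 f x) {f' : F ≃L[ℝ] F'} (hf' : HasFDerivAt f (f' : F →L[ℝ] F') x) :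
    IsLocalDiffeomorphAt 𝓘(ℝ, F) 𝓘(ℝ, F') 1 f x := by
  set e := hf.toOpenPartialHomeomorph f hf' one_ne_zero with he
  have hx : x ∈ e.source := hf.mem_toOpenPartialHomeomorph_source hf' one_ne_zero
  have hef : ∀ z, e z = f z := fun z => rfl
  have hinv : ContDiffAt ℝ 1 e.symm (f x) := hf.to_localInverse hf' one_ne_zero
  have h1 : ∀ᶠ y in 𝓝 x, ContDiffAt ℝ 1 f y := hf.eventually (by simp)
  have h2 : ∀ᶠ y in 𝓝 x, ContDiffAt ℝ 1 e.symm (f y) :=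
    hf.continuousAt.eventually (hinv.eventually (by simp))
  obtain ⟨s, hs, hso, hxs⟩ := eventually_nhds_iff.1 (h1.and h2)
  have hsrc : (e.restrOpen s hso).source = e.source ∩ s := rfl
  refine ⟨{ toPartialEquiv := (e.restrOpen s hso).toPartialEquiv
            open_source := (e.restrOpen s hso).open_source
            open_target := (e.restrOpen s hso).open_target
            contMDiffOn_toFun := ?_
            contMDiffOn_invFun := ?_ }, ⟨hx, hxs⟩, fun z _ => rfl⟩
  · rw [contMDiffOn_iff_contDiffOn]
    exact fun z hz => (hs z hz.2).1.contDiffWithinAt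
  · rw [contMDiffOn_iff_contDiffOn]
    intro z hz
    have h3 := (e.restrOpen s hso).map_target hz
    have h4 := (hs _ h3.2).2
    have h5 : f ((e.restrOpen s hso).symm z) = z := (e.restrOpen s hso).right_inv hz
    rw [h5] at h4
    exact h4.contDiffWithinAt

/-- A map that is injective on a compact set and a local diffeomorphism at its points is a
diffeomorphism onto its image near that compact set. -/
theorem exists_isDiffeoOntoImage [T2Space Y] {f : X → Y} {K O : Set X} (hK : IsCompact K)
    (hO : IsOpen O) (hKO : K ⊆ O) (hinj : InjOn f K)
    (hf : ∀ x ∈ K, IsLocalDiffeomorphAt I I' 1 f x) :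
    ∃ W, K ⊆ W ∧ W ⊆ O ∧ IsDiffeoOntoImage I I' f W := by
  have hloc : ∀ x ∈ K, ∃ u ∈ 𝓝 x, InjOn f u := by
    intro x hx
    obtain ⟨Φ, hxΦ, hΦ⟩ := hf x hx
    exact ⟨Φ.source, Φ.open_source.mem_nhds hxΦ, Φ.injOn.congr hΦ.symm⟩
  obtain ⟨t, ht, htinj⟩ := hinj.exists_mem_nhdsSet hK
    (fun x hx => (hf x hx).contMDiffAt.continuousAt) hloc
  rw [mem_nhdsSet_iff_exists] at ht
  obtain ⟨T, hTo, hKT, hTt⟩ := ht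
  choose Φ hΦ using hf
  refine ⟨T ∩ O ∩ ⋃ (x) (hx : x ∈ K), (Φ x hx).source, fun x hx => ⟨⟨hKT hx, hKO hx⟩, ?_⟩,
    fun x hx => hx.1.2, (hTo.inter hO).inter
    (isOpen_iUnion fun x => isOpen_iUnion fun hx => (Φ x hx).open_source),
    htinj.mono fun x hx => hTt hx.1.1, ?_⟩
  · simp only [mem_iUnion]
    exact ⟨x, hx, (hΦ x hx).1⟩
  · rintro ⟨z, hz⟩
    obtain ⟨x, hx, hzx⟩ := mem_iUnion₂.1 hz.2
    exact ⟨Φ x hx, hzx, (hΦ x hx).2⟩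

theorem IsLocalDiffeomorphAt.congr_of_eventuallyEq {f g : X → Y} {x : X}
    (hf : IsLocalDiffeomorphAt I I' 1 f x) (hfg : g =ᶠ[𝓝 x] f) :
    IsLocalDiffeomorphAt I I' 1 g x := by
  obtain ⟨Φ, hx, hΦ⟩ := hf
  obtain ⟨s, hs, hso, hxs⟩ := eventually_nhds_iff.1 hfg
  refine ⟨{ toPartialEquiv := (Φ.toOpenPartialHomeomorph.restrOpen s hso).toPartialEquiv
            open_source := (Φ.toOpenPartialHomeomorph.restrOpen s hso).open_source
            open_target := (Φ.toOpenPartialHomeomorph.restrOpen s hso).open_target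
            contMDiffOn_toFun := Φ.contMDiffOn_toFun.mono inter_subset_left
            contMDiffOn_invFun := Φ.contMDiffOn_invFun.mono inter_subset_left }, ⟨hx, hxs⟩,
            fun z hz => (hs z hz.2).trans (hΦ hz.1)⟩

/-- A map is a local diffeomorphism if its coordinate expression has invertible derivative. -/
theorem isLocalDiffeomorphAt_of_inCoordinates [CompleteSpace F]
    {Φ : PartialDiffeomorph I 𝓘(ℝ, F) X F 1} {Φ' : PartialDiffeomorph I' 𝓘(ℝ, F') Y F' 1}
    {f : X → Y} {U : Set X} (hU : IsOpen U) (hf : ContMDiffOn I I' 1 f U) {x : X} (hx : x ∈ Φ.source)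
    (hxU : x ∈ U) (hfx : f x ∈ Φ'.source) {T : F ≃L[ℝ] F'}
    (hT : fderiv ℝ (inCoordinates Φ Φ' f) (Φ x) = T) : IsLocalDiffeomorphAt I I' 1 f x := by
  have hinv : Φ.symm (Φ x) = x := Φ.left_inv hx
  have hmem : Φ x ∈ {y | y ∈ Φ.target ∧ Φ.symm y ∈ U ∧ f (Φ.symm y) ∈ Φ'.source} :=
    ⟨Φ.map_source hx, by rwa [hinv], by rwa [hinv]⟩
  have hopen := isOpen_inCoordinates_domain (Φ := Φ) (Φ' := Φ') hU hf.continuousOn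
  have h1 : ContDiffAt ℝ 1 (inCoordinates Φ Φ' f) (Φ x) :=
    (contDiffOn_inCoordinates hf).contDiffAt (hopen.mem_nhds hmem)
  have h2 : HasFDerivAt (inCoordinates Φ Φ' f) (T : F →L[ℝ] F') (Φ x) := by
    rw [← hT]
    exact (h1.differentiableAt one_ne_zero).hasFDerivAt
  have h3 := isLocalDiffeomorphAt_of_hasFDerivAt h1 h2
  have h4 : IsLocalDiffeomorphAt I 𝓘(ℝ, F') 1 (inCoordinates Φ Φ' f ∘ Φ) x :=
    IsLocalDiffeomorphAt.comp _ _ (Φ.isLocalDiffeomorphAt_of_mem hx) h3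
  have h5 : IsLocalDiffeomorphAt 𝓘(ℝ, F') I' 1 Φ'.symm ((inCoordinates Φ Φ' f ∘ Φ) x) := by
    refine Φ'.symm.isLocalDiffeomorphAt_of_mem (?_ : _ ∈ Φ'.target)
    change Φ' (f (Φ.symm (Φ x))) ∈ Φ'.target
    rw [hinv]
    exact Φ'.map_source hfx
  refine (IsLocalDiffeomorphAt.comp _ _ h4 h5).congr_of_eventuallyEq ?_
  have h6 : ∀ᶠ z in 𝓝 x, f z ∈ Φ'.source :=
    (hf.continuousOn.continuousAt (hU.mem_nhds hxU)).eventually (Φ'.open_source.mem_nhds hfx)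
  filter_upwards [h6, Φ.open_source.mem_nhds hx] with z hz hz'
  change f z = Φ'.symm (Φ' (f (Φ.symm (Φ z))))
  have h7 : Φ.symm (Φ z) = z := Φ.left_inv hz'
  rw [h7]
  exact (Φ'.left_inv hz).symm

end LocalDiffeo

/-! ### Domination in coordinates -/

section Domination

/-- An isomorphism of a product that satisfies cone conditions for all cone widths is block
diagonal. -/
theorem exists_prodMap_of_cones {F G : Type*} [NormedAddCommGroup F] [NormedSpace ℝ F]
    [NormedAddCommGroup G] [NormedSpace ℝ G] [FiniteDimensional ℝ F] [FiniteDimensional ℝ G]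
    (T : (F × G) ≃L[ℝ] (F × G))
    (h₁ : ∀ θ > 0, ∀ z, ‖(T z).2‖ ≤ θ * ‖(T z).1‖ → ‖z.2‖ ≤ θ * ‖z.1‖)
    (h₂ : ∀ θ > 0, ∀ z : F × G, ‖z.1‖ ≤ θ * ‖z.2‖ → ‖(T z).1‖ ≤ θ * ‖(T z).2‖) :
    ∃ (a : F →L[ℝ] F) (b : G ≃L[ℝ] G),
      (T : F × G →L[ℝ] F × G) = a.prodMap (b : G →L[ℝ] G) := by
  have hzero : ∀ x y : ℝ, 0 ≤ x → 0 ≤ y → (∀ θ > 0, x ≤ θ * y) → x = 0 := by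
    intro x y hx hy h
    by_contra hne
    have hx' : 0 < x := lt_of_le_of_ne hx (Ne.symm hne)
    have h3 := h (x / (2 * (y + 1))) (by positivity)
    rw [div_mul_eq_mul_div, le_div_iff₀ (by positivity)] at h3
    nlinarith
  have hb1 : ∀ w : G, (T (0, w)).1 = 0 := fun w => norm_eq_zero.1
    (hzero _ ‖(T (0, w)).2‖ (norm_nonneg _) (norm_nonneg _) fun θ hθ => h₂ θ hθ (0, w) (by
      simp only [norm_zero]
      positivity))
  have ha1 : ∀ u : F, (T.symm (u, 0)).2 = 0 := fun u => norm_eq_zero.1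
    (hzero _ ‖(T.symm (u, 0)).1‖ (norm_nonneg _) (norm_nonneg _) fun θ hθ =>
      h₁ θ hθ (T.symm (u, 0)) (by
        simp only [ContinuousLinearEquiv.apply_symm_apply, norm_zero]
        positivity))
  set a' : F →ₗ[ℝ] F := ((ContinuousLinearMap.fst ℝ F G).comp ((T.symm : F × G →L[ℝ] F × G).comp
    (ContinuousLinearMap.inl ℝ F G)) : F →L[ℝ] F).toLinearMap with ha'
  have ha'v : ∀ u, a' u = (T.symm (u, 0)).1 := fun _ => rfl
  have ha'inj : Injective a' := by
    rw [← LinearMap.ker_eq_bot, LinearMap.ker_eq_bot']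
    intro u hu
    have h3 : T.symm (u, 0) = 0 := Prod.ext hu (ha1 u)
    simpa using h3
  have ha2 : ∀ v : F, (T (v, 0)).2 = 0 := by
    intro v
    obtain ⟨u, rfl⟩ := (LinearMap.injective_iff_surjective.1 ha'inj) v
    have h3 : (a' u, (0 : G)) = T.symm (u, 0) := Prod.ext rfl (ha1 u).symm
    rw [h3, T.apply_symm_apply]
  set b' : G →ₗ[ℝ] G := ((ContinuousLinearMap.snd ℝ F G).comp ((T : F × G →L[ℝ] F × G).comp
    (ContinuousLinearMap.inr ℝ F G)) : G →L[ℝ] G).toLinearMap with hb'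
  have hb'inj : Injective b' := by
    rw [← LinearMap.ker_eq_bot, LinearMap.ker_eq_bot']
    intro w hw
    have h3 : T (0, w) = 0 := Prod.ext (hb1 w) hw
    simpa using h3
  refine ⟨(ContinuousLinearMap.fst ℝ F G).comp ((T : F × G →L[ℝ] F × G).comp
    (ContinuousLinearMap.inl ℝ F G)),
    (LinearEquiv.ofInjectiveEndo b' hb'inj).toContinuousLinearEquiv, ?_⟩
  refine ContinuousLinearMap.ext fun z => ?_
  obtain ⟨v, w⟩ := z
  have h3 : ((v, w) : F × G) = (v, 0) + (0, w) := by simp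
  have h4 : T (v, w) = T (v, 0) + T (0, w) := by rw [h3, map_add]
  change T (v, w) = ((T (v, 0)).1, (T (0, w)).2)
  rw [h4]
  exact Prod.ext (by simp [hb1]) (by simp [ha2])

variable {E H : Type*} [NormedAddCommGroup E] [NormedSpace ℝ E] [TopologicalSpace H]
  {I : ModelWithCorners ℝ E H} {X : Type*} [TopologicalSpace X] [ChartedSpace H X]
  {F G : Type*} [NormedAddCommGroup F] [NormedSpace ℝ F]
  [NormedAddCommGroup G] [NormedSpace ℝ G]

theorem tangentDeriv_of_prodMk {P : X → F} {Q : X → G} {x : X}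
    (h : MDifferentiableAt I 𝓘(ℝ, F × G) (fun x => (P x, Q x)) x) (v : TangentSpace I x) :
    tangentDeriv I P x v = (mfderiv I 𝓘(ℝ, F × G) (fun x => (P x, Q x)) x v : F × G).1 ∧
    tangentDeriv I Q x v = (mfderiv I 𝓘(ℝ, F × G) (fun x => (P x, Q x)) x v : F × G).2 := by
  constructor
  · have h1 := mfderiv_comp_apply (I := I) (I' := 𝓘(ℝ, F × G)) (I'' := 𝓘(ℝ, F)) x
      (g := (Prod.fst : F × G → F)) differentiableAt_fst.mdifferentiableAt h v
    rw [mfderiv_eq_fderiv, fderiv_fst] at h1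
    exact h1
  · have h1 := mfderiv_comp_apply (I := I) (I' := 𝓘(ℝ, F × G)) (I'' := 𝓘(ℝ, G)) x
      (g := (Prod.snd : F × G → G)) differentiableAt_snd.mdifferentiableAt h v
    rw [mfderiv_eq_fderiv, fderiv_snd] at h1
    exact h1

/-- In the coordinates of the splittings, the derivative of a dominated map is block diagonal, and
the dilatation condition gives bounds for the blocks. -/
theorem exists_prodMap_of_dominated [FiniteDimensional ℝ F] [FiniteDimensional ℝ G]
    {P₁ P₂ : X → F} {Q₁ Q₂ : X → G}
    {Ψ Ψ' : PartialDiffeomorph I 𝓘(ℝ, F × G) X (F × G) 1}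
    (hΨ : Ψ.toFun = fun x => (P₁ x, Q₁ x)) (hΨ' : Ψ'.toFun = fun x => (P₂ x, Q₂ x))
    {φ : X → X} {R : Set X} {x : X} (hx : x ∈ Ψ.source) (hφx : φ x ∈ Ψ'.source)
    (hφ : IsLocalDiffeomorphAt I I 1 φ x) (hxR : x ∈ R) {μ₀ γ₀ : ℝ}
    (hdom : Dominated I P₁ Q₁ P₂ Q₂ μ₀ γ₀ φ R) :
    ∃ (a : F →L[ℝ] F) (b : G ≃L[ℝ] G),
      HasFDerivAt (inCoordinates Ψ Ψ' φ) (a.prodMap (b : G →L[ℝ] G)) (Ψ x) ∧ Injective a ∧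
      ∀ μ γ, Dominated I P₁ Q₁ P₂ Q₂ μ γ φ R →
        (∀ v, μ * ‖a v‖ ≤ ‖v‖) ∧ ∀ w, γ * ‖w‖ ≤ ‖b w‖ := by
  have hinv : Ψ.symm (Ψ x) = x := Ψ.left_inv hx
  have hsymm : IsLocalDiffeomorphAt 𝓘(ℝ, F × G) I 1 Ψ.symm (Ψ x) :=
    Ψ.symm.isLocalDiffeomorphAt_of_mem (Ψ.map_source hx)
  have h1 : IsLocalDiffeomorphAt 𝓘(ℝ, F × G) 𝓘(ℝ, F × G) 1 (Ψ' ∘ φ ∘ Ψ.symm) (Ψ x) := by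
    refine IsLocalDiffeomorphAt.comp (J := I) _ _ (f := φ ∘ Ψ.symm) ?_ ?_
    · refine IsLocalDiffeomorphAt.comp _ _ hsymm ?_
      rwa [hinv]
    · refine Ψ'.isLocalDiffeomorphAt_of_mem ?_
      change φ (Ψ.symm (Ψ x)) ∈ _
      rwa [hinv]
  obtain ⟨hdiff, hder⟩ := fderiv_inCoordinates_mfderiv hx (hφ.mdifferentiableAt one_ne_zero) hφx
  obtain ⟨T, hT⟩ : ∃ T : (F × G) ≃L[ℝ] (F × G),
      (T : F × G →L[ℝ] F × G) = fderiv ℝ (inCoordinates Ψ Ψ' φ) (Ψ x) :=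
    ⟨h1.mfderivToContinuousLinearEquiv one_ne_zero, by
      rw [← mfderiv_eq_fderiv]
      rfl⟩
  have hval : ∀ v : TangentSpace I x, T (tangentDeriv I P₁ x v, tangentDeriv I Q₁ x v) =
      (tangentDeriv I P₂ (φ x) (mfderiv I I φ x v),
        tangentDeriv I Q₂ (φ x) (mfderiv I I φ x v)) := by
    intro v
    have hm : MDifferentiableAt I 𝓘(ℝ, F × G) (fun x => (P₁ x, Q₁ x)) x := by
      rw [← hΨ]
      exact Ψ.mdifferentiableAt one_ne_zero hx
    have hm' : MDifferentiableAt I 𝓘(ℝ, F × G) (fun x => (P₂ x, Q₂ x)) (φ x) := by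
      rw [← hΨ']
      exact Ψ'.mdifferentiableAt one_ne_zero hφx
    have e1 : (tangentDeriv I P₁ x v, tangentDeriv I Q₁ x v) =
        (mfderiv I 𝓘(ℝ, F × G) Ψ x v : F × G) := by
      rw [hΨ]
      exact Prod.ext (tangentDeriv_of_prodMk hm v).1 (tangentDeriv_of_prodMk hm v).2
    have e2 : (tangentDeriv I P₂ (φ x) (mfderiv I I φ x v),
        tangentDeriv I Q₂ (φ x) (mfderiv I I φ x v)) =
        (mfderiv I 𝓘(ℝ, F × G) Ψ' (φ x) (mfderiv I I φ x v) : F × G) := by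
      rw [hΨ']
      exact Prod.ext (tangentDeriv_of_prodMk hm' _).1 (tangentDeriv_of_prodMk hm' _).2
    rw [e1, e2]
    have e3 : ∀ z : F × G, T z = fderiv ℝ (inCoordinates Ψ Ψ' φ) (Ψ x) z := fun z => by
      rw [← hT]
      rfl
    exact (e3 _).trans (hder v)
  have hsurj : ∀ z : F × G, ∃ v : TangentSpace I x,
      z = (tangentDeriv I P₁ x v, tangentDeriv I Q₁ x v) := by
    intro z
    have hm : MDifferentiableAt I 𝓘(ℝ, F × G) (fun x => (P₁ x, Q₁ x)) x := by
      rw [← hΨ]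
      exact Ψ.mdifferentiableAt one_ne_zero hx
    obtain ⟨v, hv⟩ := ((Ψ.isLocalDiffeomorphAt_of_mem hx).mfderivToContinuousLinearEquiv
      one_ne_zero).surjective z
    refine ⟨v, ?_⟩
    have hv' : (mfderiv I 𝓘(ℝ, F × G) (fun x => (P₁ x, Q₁ x)) x v : F × G) = z := by
      rw [← hΨ]
      exact hv
    rw [← hv']
    exact Prod.ext (tangentDeriv_of_prodMk hm v).1.symm (tangentDeriv_of_prodMk hm v).2.symm
  have hT₁ : ∀ θ > 0, ∀ z, ‖(T z).2‖ ≤ θ * ‖(T z).1‖ → ‖z.2‖ ≤ θ * ‖z.1‖ := by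
    intro θ hθ z hz
    obtain ⟨v, rfl⟩ := hsurj z
    obtain ⟨θ', hθ'0, hθ', hinv'⟩ := (hdom θ hθ).1
    rw [hval] at hz
    refine ((hinv' x hxR v).1 hz).trans ?_
    gcongr
  have hT₂ : ∀ θ > 0, ∀ z : F × G, ‖z.1‖ ≤ θ * ‖z.2‖ → ‖(T z).1‖ ≤ θ * ‖(T z).2‖ := by
    intro θ hθ z hz
    obtain ⟨v, rfl⟩ := hsurj z
    obtain ⟨θ', hθ'0, hθ', hinv'⟩ := (hdom θ hθ).1
    rw [hval]
    refine ((hinv' x hxR v).2 hz).trans ?_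
    gcongr
  obtain ⟨a, b, hab⟩ := exists_prodMap_of_cones T hT₁ hT₂
  have hTab : ∀ z : F × G, T z = (a z.1, b z.2) := fun z => DFunLike.congr_fun hab z
  refine ⟨a, b, ?_, fun v v' hv => ?_, fun μ γ hμγ => ⟨fun v => ?_, fun w => ?_⟩⟩
  · rw [← hab, hT]
    exact hdiff.hasFDerivAt
  · have h3 : T (v, 0) = T (v', 0) := by rw [hTab, hTab, hv]
    exact congrArg Prod.fst (T.injective h3)
  · obtain ⟨v', hv'⟩ := hsurj (v, 0)
    rcases eq_or_ne v' 0 with h0 | h0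
    · have h3 : ((v, 0) : F × G) = 0 := by
        rw [hv', h0]
        simp [tangentDeriv]
        rfl
      simp only [Prod.mk_eq_zero, and_true] at h3
      simp [h3]
    · have h3 := ((hμγ 1 one_pos).2 x hxR v' h0).1
      have h4 := hval v'
      rw [← hv', hTab] at h4
      have h5 := congrArg Prod.fst h4
      have h6 := congrArg Prod.snd h4
      have h7 := congrArg Prod.fst hv'
      simp only at h5 h6 h7
      rw [← h5, ← h7] at h3
      refine (h3 ?_).le
      change ‖tangentDeriv I Q₂ (φ x) (mfderiv I I φ x v')‖ ≤
        1 * ‖tangentDeriv I P₂ (φ x) (mfderiv I I φ x v')‖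
      rw [← h6, map_zero, norm_zero, one_mul]
      exact norm_nonneg _
  · obtain ⟨v', hv'⟩ := hsurj (0, w)
    rcases eq_or_ne v' 0 with h0 | h0
    · have h3 : ((0, w) : F × G) = 0 := by
        rw [hv', h0]
        simp [tangentDeriv]
        rfl
      simp only [Prod.mk_eq_zero, true_and] at h3
      simp [h3]
    · have h3 := ((hμγ 1 one_pos).2 x hxR v' h0).2
      have h4 := hval v'
      rw [← hv', hTab] at h4
      have h6 := congrArg Prod.snd h4
      have h7 := congrArg Prod.snd hv'
      have h8 := congrArg Prod.fst hv'
      simp only at h6 h7 h8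
      rw [← h6, ← h7] at h3
      refine (h3 ?_).le
      change ‖tangentDeriv I P₁ x v'‖ ≤ 1 * ‖tangentDeriv I Q₁ x v'‖
      rw [← h8, norm_zero, one_mul]
      exact norm_nonneg _

end Domination

/-! ### Skew products over affine maps -/

section Skew

variable {V A B F G : Type*} [NormedAddCommGroup V] [NormedSpace ℝ V]
  [NormedAddCommGroup A] [NormedSpace ℝ A] [NormedAddCommGroup B] [NormedSpace ℝ B]
  [NormedAddCommGroup F] [NormedSpace ℝ F] [NormedAddCommGroup G] [NormedSpace ℝ G]
  {E H : Type*} [NormedAddCommGroup E] [NormedSpace ℝ E] [TopologicalSpace H]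
  {I : ModelWithCorners ℝ E H} {M : Type*} [TopologicalSpace M] [ChartedSpace H M]

/-- Coordinates on `V × M` adapted to a splitting `L = (x, y)` of the vector space `V` and to a
splitting `Ψ = (P, Q)` of an open subset of `M`: the pair of `(x, P)` and `(y, Q)`. -/
def skewCoordinates (L : V ≃L[ℝ] A × B) (Ψ : PartialDiffeomorph I 𝓘(ℝ, F × G) M (F × G) 1) :
    PartialDiffeomorph (𝓘(ℝ, V).prod I) 𝓘(ℝ, (A × F) × (B × G)) (V × M) ((A × F) × (B × G)) 1 where
  toFun z := (((L z.1).1, (Ψ z.2).1), ((L z.1).2, (Ψ z.2).2))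
  invFun y := (L.symm (y.1.1, y.2.1), Ψ.symm (y.1.2, y.2.2))
  source := univ ×ˢ Ψ.source
  target := {y | (y.1.2, y.2.2) ∈ Ψ.target}
  map_source' z hz := Ψ.map_source hz.2
  map_target' y hy := ⟨mem_univ _, Ψ.map_target hy⟩
  left_inv' z hz := Prod.ext (L.symm_apply_apply z.1) (Ψ.left_inv hz.2)
  right_inv' y hy := by
    have h1 : Ψ (Ψ.symm (y.1.2, y.2.2)) = (y.1.2, y.2.2) := Ψ.right_inv hy
    have h2 := L.apply_symm_apply (y.1.1, y.2.1)
    simp only [h1, h2]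
  open_source := isOpen_univ.prod Ψ.open_source
  open_target := Ψ.open_target.preimage (by fun_prop)
  contMDiffOn_toFun := by
    have h1 : ContMDiffOn (𝓘(ℝ, V).prod I) 𝓘(ℝ, F × G) 1 (fun z : V × M => Ψ z.2)
        (univ ×ˢ Ψ.source) :=
      Ψ.contMDiffOn_toFun.comp contMDiffOn_snd fun z hz => hz.2
    have h2 : ContMDiffOn (𝓘(ℝ, V).prod I) 𝓘(ℝ, A × B) 1 (fun z : V × M => L z.1)
        (univ ×ˢ Ψ.source) :=
      (L.contDiff.contMDiff).comp_contMDiffOn contMDiffOn_fst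
    have h3 := h2.prodMk_space h1
    exact (show ContDiff ℝ 1 fun p : (A × B) × F × G =>
      ((p.1.1, p.2.1), (p.1.2, p.2.2)) by fun_prop).contMDiff.comp_contMDiffOn h3
  contMDiffOn_invFun := by
    have h1 : ContMDiffOn 𝓘(ℝ, (A × F) × (B × G)) I 1
        (fun y : (A × F) × (B × G) => Ψ.symm (y.1.2, y.2.2)) {y | (y.1.2, y.2.2) ∈ Ψ.target} :=
      Ψ.contMDiffOn_invFun.comp (show ContDiff ℝ 1 fun y : (A × F) × (B × G) =>
        (y.1.2, y.2.2) by fun_prop).contMDiff.contMDiffOn fun y hy => hy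
    exact (show ContDiff ℝ 1 fun y : (A × F) × (B × G) =>
      L.symm (y.1.1, y.2.1) by fun_prop).contMDiff.contMDiffOn.prodMk h1

/-- The product of an affine map `(x, y) ↦ (T x + t, S y + s)`, read in the splitting `L = (x, y)`,
and of a map `φ` of the fiber. -/
def skewBranch (L : V ≃L[ℝ] A × B) (T : A →L[ℝ] A) (t : A) (S : B ≃L[ℝ] B) (s : B) (φ : M → M)
    (z : V × M) : (A × B) × M :=
  ((T (L z.1).1 + t, S (L z.1).2 + s), φ z.2)

/-- The rectangle over `Hs` in the domain of a skew branch whose image lies over `Vu`. -/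
def skewRect (L : V ≃L[ℝ] A × B) (S : B ≃L[ℝ] B) (s : B) (Hs : Set A) (Vu : Set B) (R : Set M) :
    Set (V × M) :=
  {z | ((L z.1).1 ∈ Hs ∧ S (L z.1).2 + s ∈ Vu) ∧ z.2 ∈ R}

/-- Norm bounds for the blocks of a linear map that is diagonal for `(A × F) × (B × G)`: `a` contracts
`A` by `r` and `F` by `α`, and `b` expands `B` by `r⁻¹` and `G` by `β⁻¹`. -/
structure BlockRates (r α β : ℝ) (a : A × F →L[ℝ] A × F) (b : (B × G) ≃L[ℝ] (B × G)) : Prop where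
  fst_le : ∀ v, ‖(a v).1‖ ≤ r * ‖v.1‖
  snd_le : ∀ v, ‖(a v).2‖ ≤ α * ‖v.2‖
  symm_fst_le : ∀ w, ‖(b.symm w).1‖ ≤ r * ‖w.1‖
  symm_snd_le : ∀ w, ‖(b.symm w).2‖ ≤ β * ‖w.2‖

/-- `F₀` is a `C¹` map on `U` that coincides to first order with a skew branch on a skew rectangle,
where `φ` is block diagonal in the coordinates `Ψ`, `Ψ'` with rates `α`, `β`. -/
structure IsSkewExtension (L : V ≃L[ℝ] A × B) (Ψ Ψ' : PartialDiffeomorph I 𝓘(ℝ, F × G) M (F × G) 1)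
    (T : A →L[ℝ] A) (t : A) (S : B ≃L[ℝ] B) (s : B) (φ : M → M) (Hs : Set A) (Vu : Set B)
    (R : Set M) (r α β : ℝ) (F₀ : V × M → (A × B) × M) (U : Set (V × M)) : Prop where
  isOpen : IsOpen U
  contMDiffOn : ContMDiffOn (𝓘(ℝ, V).prod I) (𝓘(ℝ, A × B).prod I) 1 F₀ U
  subset : skewRect L S s Hs Vu R ⊆ U
  agree : AgreeToFirstOrder (𝓘(ℝ, V).prod I) (𝓘(ℝ, A × B).prod I) F₀ (skewBranch L T t S s φ)
    (skewRect L S s Hs Vu R)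
  isCompact_base : IsCompact Hs
  isCompact_fiber : IsCompact Vu
  isCompact_rect : IsCompact R
  subset_source : R ⊆ Ψ.source
  mapsTo_source : MapsTo φ R Ψ'.source
  isLocalDiffeo : ∀ x ∈ R, IsLocalDiffeomorphAt I I 1 φ x
  injOn : InjOn (fun x => ((Ψ x).1, (Ψ' (φ x)).2)) R
  image_eq : (fun x => ((Ψ x).1, (Ψ' (φ x)).2)) '' R =
    ((fun x => (Ψ x).1) '' R) ×ˢ ((fun x => (Ψ' (φ x)).2) '' R)
  stable_le : ∀ x, ‖T x‖ ≤ r * ‖x‖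
  unstable_le : ∀ x, ‖S.symm x‖ ≤ r * ‖x‖
  hasFDerivAt : ∀ x ∈ R, ∃ (a : F →L[ℝ] F) (b : G ≃L[ℝ] G),
    HasFDerivAt (inCoordinates Ψ Ψ' φ) (a.prodMap (b : G →L[ℝ] G)) (Ψ x) ∧
    Injective a ∧ (∀ v, ‖a v‖ ≤ α * ‖v‖) ∧ ∀ w, ‖b.symm w‖ ≤ β * ‖w‖

namespace IsSkewExtension

variable {L : V ≃L[ℝ] A × B} {Ψ Ψ' : PartialDiffeomorph I 𝓘(ℝ, F × G) M (F × G) 1}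
    {T : A →L[ℝ] A} {t : A} {S : B ≃L[ℝ] B} {s : B} {φ : M → M} {Hs : Set A} {Vu : Set B}
    {R : Set M} {r α β : ℝ} {F₀ : V × M → (A × B) × M} {U : Set (V × M)}

theorem apply_eq (h : IsSkewExtension L Ψ Ψ' T t S s φ Hs Vu R r α β F₀ U) {z : V × M}
    (hz : z ∈ skewRect L S s Hs Vu R) : F₀ z = skewBranch L T t S s φ z :=
  congrArg Bundle.TotalSpace.proj (h.agree ⟨z, 0⟩ hz)

theorem isCompact (h : IsSkewExtension L Ψ Ψ' T t S s φ Hs Vu R r α β F₀ U) :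
    IsCompact (skewRect L S s Hs Vu R) := by
  have h1 : skewRect L S s Hs Vu R =
      (fun p : (A × B) × M => (L.symm (p.1.1, S.symm (p.1.2 - s)), p.2)) '' ((Hs ×ˢ Vu) ×ˢ R) := by
    ext z
    constructor
    · rintro ⟨⟨h1, h2⟩, h3⟩
      exact ⟨(((L z.1).1, S (L z.1).2 + s), z.2), ⟨⟨h1, h2⟩, h3⟩, by simp⟩
    · rintro ⟨p, ⟨⟨h1, h2⟩, h3⟩, rfl⟩
      exact ⟨⟨by simpa using h1, by simpa using h2⟩, h3⟩
  rw [h1]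
  exact ((h.isCompact_base.prod h.isCompact_fiber).prod h.isCompact_rect).image (by fun_prop)

theorem mem_source (h : IsSkewExtension L Ψ Ψ' T t S s φ Hs Vu R r α β F₀ U) {z : V × M}
    (hz : z ∈ skewRect L S s Hs Vu R) : z ∈ (skewCoordinates L Ψ).source ∧
      F₀ z ∈ (skewCoordinates (ContinuousLinearEquiv.refl ℝ (A × B)) Ψ').source := by
  refine ⟨⟨mem_univ _, h.subset_source hz.2⟩, ?_⟩
  rw [h.apply_eq hz]
  exact ⟨mem_univ _, h.mapsTo_source hz.2⟩

theorem fderiv_inCoordinates (h : IsSkewExtension L Ψ Ψ' T t S s φ Hs Vu R r α β F₀ U)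
    {z : V × M} (hz : z ∈ skewRect L S s Hs Vu R) :
    ∃ (a : A × F →L[ℝ] A × F) (b : (B × G) ≃L[ℝ] (B × G)),
      fderiv ℝ (inCoordinates (skewCoordinates L Ψ)
        (skewCoordinates (ContinuousLinearEquiv.refl ℝ (A × B)) Ψ') F₀) (skewCoordinates L Ψ z) =
        a.prodMap (b : B × G →L[ℝ] B × G) ∧ BlockRates r α β a b ∧
        (Injective T → Injective a) := by
  set Φ := skewCoordinates L Ψ with hΦ
  set Φ' := skewCoordinates (ContinuousLinearEquiv.refl ℝ (A × B)) Ψ' with hΦ'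
  obtain ⟨hzs, hzs'⟩ := h.mem_source hz
  obtain ⟨a, b, hab, hainj, ha, hb⟩ := h.hasFDerivAt z.2 hz.2
  refine ⟨T.prodMap a, S.prodCongr b, ?_, ⟨fun v => h.stable_le v.1, fun v => ha v.2,
    fun w => h.unstable_le w.1, fun w => hb w.2⟩, fun hT => hT.prodMap hainj⟩
  have hbr : MDifferentiableAt (𝓘(ℝ, V).prod I) (𝓘(ℝ, A × B).prod I) (skewBranch L T t S s φ) z := by
    have h1 : MDifferentiableAt (𝓘(ℝ, V).prod I) 𝓘(ℝ, V) (Prod.fst : V × M → V) z :=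
      mdifferentiableAt_fst
    have h2 : MDifferentiableAt (𝓘(ℝ, V).prod I) I (Prod.snd : V × M → M) z :=
      mdifferentiableAt_snd
    have h3 : DifferentiableAt ℝ (fun x : V => (T (L x).1 + t, S (L x).2 + s)) z.1 := by fun_prop
    exact (h3.mdifferentiableAt.comp z h1).prodMk
      (((h.isLocalDiffeo z.2 hz.2).mdifferentiableAt one_ne_zero).comp z h2)
  have hF : MDifferentiableAt (𝓘(ℝ, V).prod I) (𝓘(ℝ, A × B).prod I) F₀ z :=
    (h.contMDiffOn.mdifferentiableOn one_ne_zero z (h.subset hz)).mdifferentiableAt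
      (h.isOpen.mem_nhds (h.subset hz))
  have hbs : skewBranch L T t S s φ z ∈ Φ'.source := by
    rw [← h.apply_eq hz]
    exact hzs'
  obtain ⟨h1, h2⟩ := fderiv_inCoordinates_mfderiv (Φ := Φ) (Φ' := Φ') hzs hF hzs'
  obtain ⟨h3, h4⟩ := fderiv_inCoordinates_mfderiv (Φ := Φ) (Φ' := Φ') hzs hbr hbs
  have h5 : fderiv ℝ (inCoordinates Φ Φ' F₀) (Φ z) =
      fderiv ℝ (inCoordinates Φ Φ' (skewBranch L T t S s φ)) (Φ z) := by
    refine ContinuousLinearMap.ext fun y => ?_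
    obtain ⟨v, hv⟩ := ((Φ.isLocalDiffeomorphAt_of_mem hzs).mfderivToContinuousLinearEquiv
      one_ne_zero).surjective y
    have hv' : (mfderiv (𝓘(ℝ, V).prod I) 𝓘(ℝ, (A × F) × (B × G)) Φ z v :
      (A × F) × (B × G)) = y := hv
    rw [← hv']
    refine (h2 v).trans (Eq.trans ?_ (h4 v).symm)
    have h6 := h.agree ⟨z, v⟩ hz
    exact congrArg (fun w : TangentBundle (𝓘(ℝ, A × B).prod I) ((A × B) × M) =>
      (mfderiv (𝓘(ℝ, A × B).prod I) 𝓘(ℝ, (A × F) × (B × G)) Φ' w.proj w.2 :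
        (A × F) × (B × G))) h6
  rw [h5]
  have h6 : inCoordinates Φ Φ' (skewBranch L T t S s φ) = fun y : (A × F) × (B × G) =>
      ((T y.1.1 + t, (inCoordinates Ψ Ψ' φ (y.1.2, y.2.2)).1),
        (S y.2.1 + s, (inCoordinates Ψ Ψ' φ (y.1.2, y.2.2)).2)) := by
    funext y
    change (((T (L (L.symm (y.1.1, y.2.1))).1 + t, _), (S (L (L.symm (y.1.1, y.2.1))).2 + s, _)) :
      (A × F) × (B × G)) = _
    rw [L.apply_symm_apply]
    rfl
  rw [h6]
  apply HasFDerivAt.fderiv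
  have h7 : HasFDerivAt (fun y : (A × F) × (B × G) => inCoordinates Ψ Ψ' φ (y.1.2, y.2.2))
      ((a.prodMap (b : G →L[ℝ] G)).comp
        (((ContinuousLinearMap.snd ℝ A F).comp (ContinuousLinearMap.fst ℝ (A × F) (B × G))).prod
        ((ContinuousLinearMap.snd ℝ B G).comp (ContinuousLinearMap.snd ℝ (A × F) (B × G)))))
      (Φ z) :=
    HasFDerivAt.comp (Φ z) (g := inCoordinates Ψ Ψ' φ)
      (f := fun y : (A × F) × (B × G) => (y.1.2, y.2.2)) hab
      (ContinuousLinearMap.hasFDerivAt (((ContinuousLinearMap.snd ℝ A F).comp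
        (ContinuousLinearMap.fst ℝ (A × F) (B × G))).prod
        ((ContinuousLinearMap.snd ℝ B G).comp (ContinuousLinearMap.snd ℝ (A × F) (B × G)))))
  have h8 : HasFDerivAt (fun y : (A × F) × (B × G) => T y.1.1 + t)
      (T.comp ((ContinuousLinearMap.fst ℝ A F).comp
        (ContinuousLinearMap.fst ℝ (A × F) (B × G)))) (Φ z) :=
    (ContinuousLinearMap.hasFDerivAt (T.comp ((ContinuousLinearMap.fst ℝ A F).comp
        (ContinuousLinearMap.fst ℝ (A × F) (B × G))))).add_const t
  have h9 : HasFDerivAt (fun y : (A × F) × (B × G) => S y.2.1 + s)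
      ((S : B →L[ℝ] B).comp ((ContinuousLinearMap.fst ℝ B G).comp
        (ContinuousLinearMap.snd ℝ (A × F) (B × G)))) (Φ z) :=
    (ContinuousLinearMap.hasFDerivAt ((S : B →L[ℝ] B).comp ((ContinuousLinearMap.fst ℝ B G).comp
        (ContinuousLinearMap.snd ℝ (A × F) (B × G))))).add_const s
  exact (h8.prodMk h7.fst).prodMk (h9.prodMk h7.snd)

end IsSkewExtension

end Skew

/-! ### Branches of perturbed skew products -/

section Branches

variable {V A B F G : Type*} [NormedAddCommGroup V] [NormedSpace ℝ V]
  [NormedAddCommGroup A] [NormedSpace ℝ A] [NormedAddCommGroup B] [NormedSpace ℝ B]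
  [NormedAddCommGroup F] [NormedSpace ℝ F] [NormedAddCommGroup G] [NormedSpace ℝ G]
  {E H : Type*} [NormedAddCommGroup E] [NormedSpace ℝ E] [TopologicalSpace H]
  {I : ModelWithCorners ℝ E H} {M : Type*} [TopologicalSpace M] [ChartedSpace H M]

/-- In the coordinates `Φ = (c, u)` and `Φ'`, the part of the graph of `g` over the set `Lz` contains
a branch that is a graph over `D × Z`: for `c ∈ D` and `s ∈ Z` there is a point of `Lz` with
`c`-coordinate `c` whose image has `u`-coordinate `s`. The other coordinates lie in `Wu` and `Wc`, and
have small scale estimates with rates `r`, `α`, `β` and error `κ`. -/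
def HasBranch {X Y E₁ H₁ E₂ H₂ : Type*} [NormedAddCommGroup E₁] [NormedSpace ℝ E₁]
    [TopologicalSpace H₁] {I₁ : ModelWithCorners ℝ E₁ H₁} [TopologicalSpace X] [ChartedSpace H₁ X]
    [NormedAddCommGroup E₂] [NormedSpace ℝ E₂] [TopologicalSpace H₂]
    {I₂ : ModelWithCorners ℝ E₂ H₂} [TopologicalSpace Y] [ChartedSpace H₂ Y]
    (Φ : PartialDiffeomorph I₁ 𝓘(ℝ, (A × F) × (B × G)) X ((A × F) × (B × G)) 1)
    (Φ' : PartialDiffeomorph I₂ 𝓘(ℝ, (A × F) × (B × G)) Y ((A × F) × (B × G)) 1)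
    (g : X → Y) (Lz : Set X) (D : Set (A × F)) (Z Wu : Set (B × G)) (Wc : Set (A × F))
    (r α β κ : ℝ) : Prop :=
  ∃ (v : A × F → B × G → B × G) (w : A × F → B × G → A × F),
    (∀ c ∈ D, ∀ s ∈ Z, v c s ∈ Wu ∧ w c s ∈ Wc ∧ ∃ x ∈ Lz, x ∈ Φ.source ∧ Φ x = (c, v c s) ∧
      g x ∈ Φ'.source ∧ Φ' (g x) = (w c s, s)) ∧
    ∃ δ > 0, ∀ c ∈ D, ∀ c' ∈ D, ∀ s ∈ Z, ∀ s' ∈ Z, ‖c - c'‖ < δ → ‖s - s'‖ < δ →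
      BlockBound (v c s - v c' s') (s - s') r β (κ * max ‖c - c'‖ ‖s - s'‖) ∧
      BlockBound (w c s - w c' s') (c - c') r α (κ * max ‖c - c'‖ ‖s - s'‖)

theorem blockBound_of_norm_sub_le {C U : Type*} [NormedAddCommGroup C] [NormedAddCommGroup U]
    {v v' : C × U} {w : C × U} {l l' e : ℝ} (h : ‖v - v'‖ ≤ e) (h1 : ‖v'.1‖ ≤ l * ‖w.1‖)
    (h2 : ‖v'.2‖ ≤ l' * ‖w.2‖) : BlockBound v w l l' e := by
  constructor
  · have h3 : v.1 = v'.1 + (v - v').1 := by simp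
    rw [h3]
    exact (norm_add_le _ _).trans (add_le_add h1 ((norm_fst_le _).trans h))
  · have h3 : v.2 = v'.2 + (v - v').2 := by simp
    rw [h3]
    exact (norm_add_le _ _).trans (add_le_add h2 ((norm_snd_le _).trans h))

theorem BlockRates.norm_symm_le {r α β : ℝ} {a : A × F →L[ℝ] A × F} {b : (B × G) ≃L[ℝ] (B × G)}
    (h : BlockRates r α β a b) :
    ‖(b.symm : B × G →L[ℝ] B × G)‖ ≤ max 0 (max r β) := by
  refine ContinuousLinearMap.opNorm_le_bound _ (le_max_left _ _) fun w => ?_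
  have hm := le_max_right (0 : ℝ) (max r β)
  refine max_le ((h.symm_fst_le w).trans ?_) ((h.symm_snd_le w).trans ?_)
  · exact mul_le_mul ((le_max_left _ _).trans hm) (norm_fst_le w) (norm_nonneg _) (le_max_left _ _)
  · exact mul_le_mul ((le_max_right _ _).trans hm) (norm_snd_le w) (norm_nonneg _) (le_max_left _ _)

variable {L : V ≃L[ℝ] A × B} {Ψ Ψ' : PartialDiffeomorph I 𝓘(ℝ, F × G) M (F × G) 1}
    {T : A →L[ℝ] A} {t : A} {S : B ≃L[ℝ] B} {s : B} {φ : M → M} {Hs : Set A} {Vu : Set B}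
    {R : Set M} {r α β : ℝ} {F₀ : V × M → (A × B) × M} {U : Set (V × M)}

namespace IsSkewExtension

theorem coordinates_apply (h : IsSkewExtension L Ψ Ψ' T t S s φ Hs Vu R r α β F₀ U) {z : V × M}
    (hz : z ∈ skewRect L S s Hs Vu R) :
    (skewCoordinates L Ψ z).1 = ((L z.1).1, (Ψ z.2).1) ∧
    (skewCoordinates (ContinuousLinearEquiv.refl ℝ (A × B)) Ψ' (F₀ z)).2 =
      (S (L z.1).2 + s, (Ψ' (φ z.2)).2) := by
  rw [h.apply_eq hz]
  exact ⟨rfl, rfl⟩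

theorem injOn_coordinates (h : IsSkewExtension L Ψ Ψ' T t S s φ Hs Vu R r α β F₀ U) :
    InjOn (fun z => ((skewCoordinates L Ψ z).1,
      (skewCoordinates (ContinuousLinearEquiv.refl ℝ (A × B)) Ψ' (F₀ z)).2))
      (skewRect L S s Hs Vu R) := by
  intro z hz z' hz' heq
  simp only [(h.coordinates_apply hz).1, (h.coordinates_apply hz).2, (h.coordinates_apply hz').1,
    (h.coordinates_apply hz').2, Prod.mk.injEq, add_left_inj, EmbeddingLike.apply_eq_iff_eq] at heq
  obtain ⟨⟨h1, h2⟩, h3, h4⟩ := heq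
  exact Prod.ext (L.injective (Prod.ext h1 h3)) (h.injOn hz.2 hz'.2 (Prod.ext h2 h4))

theorem exists_coordinates_eq (h : IsSkewExtension L Ψ Ψ' T t S s φ Hs Vu R r α β F₀ U)
    {c : A × F} (hc : c ∈ Hs ×ˢ ((fun x => (Ψ x).1) '' R)) {u : B × G}
    (hu : u ∈ Vu ×ˢ ((fun x => (Ψ' (φ x)).2) '' R)) :
    ∃ z ∈ skewRect L S s Hs Vu R, (skewCoordinates L Ψ z).1 = c ∧
      (skewCoordinates (ContinuousLinearEquiv.refl ℝ (A × B)) Ψ' (F₀ z)).2 = u := by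
  have h1 : (c.2, u.2) ∈ (fun x => ((Ψ x).1, (Ψ' (φ x)).2)) '' R := by
    rw [h.image_eq]
    exact ⟨hc.2, hu.2⟩
  obtain ⟨x, hx, hxe⟩ := h1
  have hz : (L.symm (c.1, S.symm (u.1 - s)), x) ∈ skewRect L S s Hs Vu R :=
    ⟨⟨by simpa using hc.1, by simpa using hu.1⟩, hx⟩
  obtain ⟨h2, h3⟩ := Prod.ext_iff.1 hxe
  refine ⟨_, hz, ?_, ?_⟩
  · rw [(h.coordinates_apply hz).1]
    exact Prod.ext (by simp) h2
  · rw [(h.coordinates_apply hz).2]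
    exact Prod.ext (by simp) h3

/-- A skew extension has a branch over its skew rectangle, and every map that is `C¹` close to it has
a branch near that rectangle. -/
theorem exists_hasBranch [FiniteDimensional ℝ A] [FiniteDimensional ℝ B] [FiniteDimensional ℝ F]
    [FiniteDimensional ℝ G] [IsManifold I 1 M]
    (h : IsSkewExtension L Ψ Ψ' T t S s φ Hs Vu R r α β F₀ U)
    {W : Set (V × M)} (hW : IsOpen W) (hRW : skewRect L S s Hs Vu R ⊆ W) {Wu : Set (B × G)}
    (hWu : IsOpen Wu) (hRu : ∀ z ∈ skewRect L S s Hs Vu R, (skewCoordinates L Ψ z).2 ∈ Wu)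
    {Wc : Set (A × F)} (hWc : IsOpen Wc) (hRc : ∀ z ∈ skewRect L S s Hs Vu R,
      (skewCoordinates (ContinuousLinearEquiv.refl ℝ (A × B)) Ψ' (F₀ z)).1 ∈ Wc)
    {κ : ℝ} (hκ : 0 < κ) :
    HasBranch (skewCoordinates L Ψ) (skewCoordinates (ContinuousLinearEquiv.refl ℝ (A × B)) Ψ') F₀
      (skewRect L S s Hs Vu R) (Hs ×ˢ ((fun x => (Ψ x).1) '' R))
      (Vu ×ˢ ((fun x => (Ψ' (φ x)).2) '' R)) Wu Wc r α β κ ∧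
    ∃ Lz ⊆ W, IsCompact Lz ∧
      ∃ 𝒰 ∈ @nhds _ (c1Topology (𝓘(ℝ, V).prod I) (𝓘(ℝ, A × B).prod I) U) F₀, ∀ g ∈ 𝒰,
        ContMDiffOn (𝓘(ℝ, V).prod I) (𝓘(ℝ, A × B).prod I) 1 g U →
        HasBranch (skewCoordinates L Ψ) (skewCoordinates (ContinuousLinearEquiv.refl ℝ (A × B)) Ψ')
          g Lz (Hs ×ˢ ((fun x => (Ψ x).1) '' R)) (Vu ×ˢ ((fun x => (Ψ' (φ x)).2) '' R))
          Wu Wc r α β κ := by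
  set Φ := skewCoordinates L Ψ with hΦ
  set Φ' := skewCoordinates (ContinuousLinearEquiv.refl ℝ (A × B)) Ψ' with hΦ'
  set D := Hs ×ˢ ((fun x => (Ψ x).1) '' R) with hD
  set Z := Vu ×ˢ ((fun x => (Ψ' (φ x)).2) '' R) with hZ
  set Rs := skewRect L S s Hs Vu R with hRs
  have hleft : ∀ z ∈ Rs, Φ.symm (Φ z) = z := fun z hz => Φ.left_inv (h.mem_source hz).1
  have hval : ∀ z ∈ Rs, inCoordinates Φ Φ' F₀ (Φ z) = Φ' (F₀ z) := by
    intro z hz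
    change Φ' (F₀ (Φ.symm (Φ z))) = _
    rw [hleft z hz]
  set O := {y | y ∈ Φ.target ∧ Φ.symm y ∈ U ∩ W ∧ F₀ (Φ.symm y) ∈ Φ'.source} with hO
  have hmono := h.contMDiffOn.mono (inter_subset_left : U ∩ W ⊆ U)
  have hOo : IsOpen O := isOpen_inCoordinates_domain (h.isOpen.inter hW) hmono.continuousOn
  have hRsO : ∀ z ∈ Rs, Φ z ∈ O := fun z hz => by
    refine ⟨Φ.map_source (h.mem_source hz).1, ?_, ?_⟩
    · rw [hleft z hz]
      exact ⟨h.subset hz, hRW hz⟩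
    · rw [hleft z hz]
      exact (h.mem_source hz).2
  have hRsc : IsCompact Rs := h.isCompact
  have hΦc : ContinuousOn Φ Rs := Φ.contMDiffOn_toFun.continuousOn.mono fun z hz =>
    (h.mem_source hz).1
  have hF₀c : ContinuousOn (fun z => Φ' (F₀ z)) Rs :=
    Φ'.contMDiffOn_toFun.continuousOn.comp (h.contMDiffOn.continuousOn.mono h.subset)
      fun z hz => (h.mem_source hz).2
  have hexv : ∀ c u, ∃ z, c ∈ D → u ∈ Z → z ∈ Rs ∧ (Φ z).1 = c ∧ (Φ' (F₀ z)).2 = u := by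
    intro c u
    by_cases hcu : c ∈ D ∧ u ∈ Z
    · obtain ⟨z, h1, h2, h3⟩ := h.exists_coordinates_eq hcu.1 hcu.2
      exact ⟨z, fun _ _ => ⟨h1, h2, h3⟩⟩
    · exact ⟨(L.symm (c.1, u.1), Ψ.symm (c.2, u.2)), fun h1 h2 => absurd ⟨h1, h2⟩ hcu⟩
  choose ζ hζ using hexv
  have hζΦ : ∀ c ∈ D, ∀ u ∈ Z, Φ (ζ c u) = (c, (Φ (ζ c u)).2) := fun c hc u hu =>
    Prod.ext (hζ c u hc hu).2.1 rfl
  obtain ⟨ρ₁, hρ₁, hρ₁W⟩ := (hRsc.image_of_continuousOn hΦc.snd).exists_cthickening_subset_open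
    hWu (image_subset_iff.2 hRu)
  obtain ⟨ρ₂, hρ₂, hρ₂W⟩ := (hRsc.image_of_continuousOn hF₀c.fst).exists_cthickening_subset_open
    hWc (image_subset_iff.2 hRc)
  obtain ⟨Le, ρ, ε, hLc, hLO, hρ, hε, hall⟩ := exists_branches_of_close hOo
    (contDiffOn_inCoordinates hmono) (hRsc.image_of_continuousOn hΦc) (image_subset_iff.2 hRsO)
    (D := D) (Z := Z) (v₀ := fun c u => (Φ (ζ c u)).2) (β := max 0 (max r β))
    (P := BlockRates r α β) (κ := κ) (ρ := min ρ₁ ρ₂) (by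
      rintro _ ⟨z, hz, rfl⟩ _ ⟨z', hz', rfl⟩ heq
      simp only [hval z hz, hval z' hz'] at heq
      rw [h.injOn_coordinates hz hz' heq]) (by
      intro c hc u hu
      rw [← hζΦ c hc u hu, hval _ (hζ c u hc hu).1]
      exact (hζ c u hc hu).2.2) (by
      intro c hc u hu
      exact ⟨ζ c u, (hζ c u hc hu).1, hζΦ c hc u hu⟩) (by
      rintro _ ⟨z, hz, rfl⟩
      obtain ⟨a, b, hab, hrates, -⟩ := h.fderiv_inCoordinates hz
      exact ⟨a, b, hab, hrates.norm_symm_le, hrates⟩) hκ (lt_min hρ₁ hρ₂)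
  have hest : ∀ {g : (A × F) × (B × G) → (A × F) × (B × G)} {v : A × F → B × G → B × G},
      (∃ δ > 0, ∀ c ∈ D, ∀ c' ∈ D, ∀ s ∈ Z, ∀ s' ∈ Z, ‖c - c'‖ < δ → ‖s - s'‖ < δ →
        ∃ a b, BlockRates r α β a b ∧
          ‖v c s - v c' s' - b.symm (s - s')‖ ≤ κ * max ‖c - c'‖ ‖s - s'‖ ∧
          ‖(g (c, v c s)).1 - (g (c', v c' s')).1 - a (c - c')‖ ≤
            κ * max ‖c - c'‖ ‖s - s'‖) →
      ∃ δ > 0, ∀ c ∈ D, ∀ c' ∈ D, ∀ s ∈ Z, ∀ s' ∈ Z, ‖c - c'‖ < δ → ‖s - s'‖ < δ →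
        BlockBound (v c s - v c' s') (s - s') r β (κ * max ‖c - c'‖ ‖s - s'‖) ∧
        BlockBound ((g (c, v c s)).1 - (g (c', v c' s')).1) (c - c') r α
          (κ * max ‖c - c'‖ ‖s - s'‖) := by
    rintro g v ⟨δ, hδ, hδ'⟩
    refine ⟨δ, hδ, fun c hc c' hc' s hs s' hs' h1 h2 => ?_⟩
    obtain ⟨a, b, hab, h3, h4⟩ := hδ' c hc c' hc' s hs s' hs' h1 h2
    exact ⟨blockBound_of_norm_sub_le h3 (hab.symm_fst_le _) (hab.symm_snd_le _),
      blockBound_of_norm_sub_le h4 (hab.fst_le _) (hab.snd_le _)⟩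
  constructor
  · obtain ⟨-, h2⟩ := hall (inCoordinates Φ Φ' F₀) fun x hx => by
      refine ⟨((contDiffOn_inCoordinates hmono).contDiffAt
        (hOo.mem_nhds (hLO hx))).differentiableAt one_ne_zero, ?_, ?_⟩
      · rw [sub_self, norm_zero]
        exact hε.le
      · rw [sub_self, norm_zero]
        exact hε.le
    obtain ⟨-, h3⟩ := h2 (fun c u => (Φ (ζ c u)).2) (fun c _ u _ => by
      rw [sub_self, norm_zero]
      exact hρ.le) (fun c hc u hu => by
      rw [← hζΦ c hc u hu, hval _ (hζ c u hc hu).1]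
      exact (hζ c u hc hu).2.2)
    refine ⟨fun c u => (Φ (ζ c u)).2, fun c u => (inCoordinates Φ Φ' F₀ (c, (Φ (ζ c u)).2)).1,
      fun c hc u hu => ?_, hest h3⟩
    obtain ⟨h4, h5, h6⟩ := hζ c u hc hu
    refine ⟨hRu _ h4, ?_, ζ c u, h4, (h.mem_source h4).1, hζΦ c hc u hu, (h.mem_source h4).2, ?_⟩
    · beta_reduce
      rw [← hζΦ c hc u hu, hval _ h4]
      exact hRc _ h4
    · beta_reduce
      rw [← hζΦ c hc u hu, hval _ h4]
      exact Prod.ext rfl h6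
  · obtain ⟨𝒰, h𝒰, hclose⟩ := exists_c1Nhds_inCoordinates Φ Φ' h.isOpen h.contMDiffOn hLc
      (fun y hy => ⟨(hLO hy).1, (hLO hy).2.1.1, (hLO hy).2.2⟩) hε
    refine ⟨Φ.symm '' Le, ?_, ?_, 𝒰, h𝒰, fun g hg hgU => ?_⟩
    · rintro _ ⟨y, hy, rfl⟩
      exact (hLO hy).2.1.2
    · exact hLc.image_of_continuousOn (Φ.contMDiffOn_invFun.continuousOn.mono
        fun y hy => (hLO hy).1)
    · obtain ⟨⟨v, hv, hvb⟩, h2⟩ := hall (inCoordinates Φ Φ' g) fun x hx =>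
        (hclose g hg hgU x hx).2
      obtain ⟨h3, h4⟩ := h2 v hv hvb
      refine ⟨v, fun c u => (inCoordinates Φ Φ' g (c, v c u)).1, fun c hc u hu => ?_, hest h4⟩
      obtain ⟨h5, h6, h7⟩ := h3 c hc u hu
      have hz := (hζ c u hc hu).1
      refine ⟨hρ₁W ?_, hρ₂W ?_, Φ.symm (c, v c u), ⟨_, h5, rfl⟩, Φ.map_target (hLO h5).1,
        Φ.right_inv (hLO h5).1, (hclose g hg hgU _ h5).1, Prod.ext rfl (hvb c hc u hu)⟩
      · refine Metric.mem_cthickening_of_dist_le _ ((Φ (ζ c u)).2) _ _ ⟨_, hz, rfl⟩ ?_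
        rw [dist_eq_norm]
        exact h6.trans (min_le_left _ _)
      · refine Metric.mem_cthickening_of_dist_le _ ((Φ' (F₀ (ζ c u))).1) _ _ ⟨_, hz, rfl⟩ ?_
        rw [dist_eq_norm, ← hval _ hz, hζΦ c hc u hu]
        exact h7.trans (min_le_right _ _)

end IsSkewExtension

end Branches

/-! ### Choice of the constants -/

section Constants

/-- The strict inequalities between the rates of a model that follow from domination: `a` and `b`
bound the rates in the fiber, and the stretching of the horseshoe is adapted to the rates of each
branch. -/
structure BranchModel.IsDominated {ι Cx Cq Ux Uq : Type*} (m : BranchModel ι Cx Cq Ux Uq)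
    (a b : ℝ) : Prop where
  strong_nonneg : ∀ i ∈ m.index, 0 ≤ m.strong i
  contr_nonneg : ∀ i ∈ m.index, 0 ≤ m.contr i
  inv_nonneg : ∀ i ∈ m.index, 0 ≤ m.inv i
  contr_le : ∀ i ∈ m.index, m.contr i ≤ a
  inv_le : ∀ i ∈ m.index, m.inv i ≤ b
  strong_lt_one : ∀ i ∈ m.index, m.strong i < 1
  contr_mul_inv_lt : ∀ i ∈ m.index, m.contr i * m.inv i < 1
  strong_mul_contr_lt : ∀ i ∈ m.index, m.strong i * m.contr i < 1
  strong_mul_inv_lt : ∀ i ∈ m.index, m.strong i * m.inv i < 1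

variable {ι₁ ι₂ X₁ X₂ Cx₁ Cq₁ Ux₁ Uq₁ Cx₂ Cq₂ Ux₂ Uq₂ : Type*}
  [NormedAddCommGroup Cx₁] [NormedAddCommGroup Cq₁]
  [NormedAddCommGroup Ux₁] [NormedAddCommGroup Uq₁] [NormedAddCommGroup Cx₂]
  [NormedAddCommGroup Cq₂] [NormedAddCommGroup Ux₂] [NormedAddCommGroup Uq₂]
  [NormedSpace ℝ Ux₁] [NormedSpace ℝ Uq₁] [NormedSpace ℝ Ux₂] [NormedSpace ℝ Uq₂]
  {m₂ : BranchModel ι₂ Cx₂ Cq₂ Ux₂ Uq₂} {m₁ : BranchModel ι₁ Cx₁ Cq₁ Ux₁ Uq₁}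

theorem eventually_le_one_sub {x : ℝ} (hx : x < 1) : ∀ᶠ η in 𝓝[>] (0 : ℝ), x ≤ 1 - η := by
  have h : ∀ᶠ η in 𝓝 (0 : ℝ), η < 1 - x := gt_mem_nhds (by linarith)
  filter_upwards [nhdsWithin_le_nhds h] with η hη
  linarith

theorem eventually_add_mul_add_le {x y : ℝ} (h : x * y < 1) :
    ∀ᶠ η in 𝓝[>] (0 : ℝ), (x + η) * (y + η) ≤ 1 - η := by
  have h1 : Tendsto (fun η : ℝ => (x + η) * (y + η) + η) (𝓝 0) (𝓝 ((x + 0) * (y + 0) + 0)) :=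
    Continuous.tendsto (by fun_prop) 0
  rw [add_zero, add_zero, add_zero] at h1
  filter_upwards [nhdsWithin_le_nhds (h1.eventually (gt_mem_nhds h))] with η hη
  linarith

theorem eventually_add_le_one_sub {x : ℝ} (hx : x < 1) :
    ∀ᶠ η in 𝓝[>] (0 : ℝ), x + η ≤ 1 - η := by
  have h : ∀ᶠ η in 𝓝 (0 : ℝ), η < (1 - x) / 2 := gt_mem_nhds (by linarith)
  filter_upwards [nhdsWithin_le_nhds h] with η hη
  linarith

theorem BranchModel.IsDominated.max_mul_max_lt {ι Cx Cq Ux Uq : Type*}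
    {m : BranchModel ι Cx Cq Ux Uq} {a b : ℝ} (h : m.IsDominated a b) {i : ι} (hi : i ∈ m.index) :
    max (m.strong i) (m.contr i) * max (m.strong i) (m.inv i) < 1 := by
  have h1 := h.strong_nonneg i hi
  have h2 := h.strong_lt_one i hi
  rcases max_choice (m.strong i) (m.contr i) with h3 | h3 <;>
    rcases max_choice (m.strong i) (m.inv i) with h4 | h4 <;> rw [h3, h4]
  · nlinarith
  · exact h.strong_mul_inv_lt i hi
  · rw [mul_comm]
    exact h.strong_mul_contr_lt i hi
  · exact h.contr_mul_inv_lt i hi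

/-- If the bounds `a` and `b'` of the rates of two models have product less than one, then either all
the contraction rates of the first model or all the rates of the inverse branches of the second one
are less than one. -/
theorem BranchModel.IsDominated.forall_max_lt_or {ι Cx Cq Ux Uq ι' Cx' Cq' Ux' Uq' : Type*}
    {m : BranchModel ι Cx Cq Ux Uq} {m' : BranchModel ι' Cx' Cq' Ux' Uq'} {a b a' b' : ℝ}
    (h : m.IsDominated a b) (h' : m'.IsDominated a' b') (hab : a * b' < 1) :
    (∀ i ∈ m.index, max (m.strong i) (m.contr i) < 1) ∨
      ∀ j ∈ m'.index, max (m'.strong j) (m'.inv j) < 1 := by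
  rcases lt_or_ge a 1 with ha | ha
  · exact Or.inl fun i hi => max_lt (h.strong_lt_one i hi) ((h.contr_le i hi).trans_lt ha)
  · refine Or.inr fun j hj => max_lt (h'.strong_lt_one j hj) ((h'.inv_le j hj).trans_lt ?_)
    by_contra hb
    nlinarith

/-- Joint orbits of arbitrary lengths, under strict inequalities between the rates. -/
theorem exists_joint_orbits_of_lt {w₁ w₂ Δ₁ Δ₂ l₁ l₁' l₂ l₂' a₁ b₁ a₂ b₂ : ℝ}
    (hc₂ : IsCompact m₂.fiber) (hconv₂ : Convex ℝ m₂.fiber) (hne₂ : m₂.fiber.Nonempty)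
    (hc₁ : IsCompact m₁.fiber) (hconv₁ : Convex ℝ m₁.fiber) (hne₁ : m₁.fiber.Nonempty)
    (hw₂ : ∀ s ∈ m₂.fiber, ∀ s' ∈ m₂.fiber, ‖(s - s').2‖ ≤ w₂)
    (hw₁ : ∀ s ∈ m₁.fiber, ∀ s' ∈ m₁.fiber, ‖(s - s').2‖ ≤ w₁)
    (hd₂ : m₂.IsDominated a₂ b₂) (hd₁ : m₁.IsDominated a₁ b₁) (ha₂ : 0 ≤ a₂) (ha₁ : 0 ≤ a₁)
    (h₂₁ : a₂ * b₁ < 1) (h₁₂ : a₁ * b₂ < 1)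
    (hs₂ : m₂.Selects Δ₂) (hs₁ : m₁.Selects Δ₁) (hΔ₂ : 0 < Δ₂) (hΔ₁ : 0 < Δ₁)
    (hl₂ : 0 ≤ l₂) (hl₂' : 0 ≤ l₂') (hl₁ : 0 ≤ l₁) (hl₁' : 0 ≤ l₁')
    (hlw₂ : l₂' * w₁ < Δ₂) (hlw₁ : l₁' * w₂ < Δ₁) :
    ∃ κ > 0, ∀ (d₂ : BranchDynamics ι₂ X₂ Cx₂ Cq₂ Ux₂ Uq₂)
      (d₁ : BranchDynamics ι₁ X₁ Cx₁ Cq₁ Ux₁ Uq₁), m₂.Realizes d₂ κ → m₁.Realizes d₁ κ →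
      ∀ (Rel : X₂ → X₁ → Prop) (c₂ : Ux₂ × Uq₂ → Ux₁ × Uq₁ → Cx₂ × Cq₂)
        (c₁ : Ux₁ × Uq₁ → Ux₂ × Uq₂ → Cx₁ × Cq₁), OrbitFamily m₂ d₂ m₁ d₁ Rel 0 0 c₂ c₁ →
      SmallScaleBlock m₂.fiber m₁.fiber c₂ l₂ l₂' κ →
      SmallScaleBlock m₁.fiber m₂.fiber c₁ l₁ l₁' κ → ∀ N : ℕ,
      ∃ z w, Rel z w ∧ (∀ j < N, d₂.map^[j] z ∈ d₂.K) ∧ ∀ j < N, d₁.map^[j] w ∈ d₁.K := by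
  set p₂ : ι₂ → ℝ := fun i => max (m₂.strong i) (m₂.contr i) with hp₂
  set q₂ : ι₂ → ℝ := fun i => max (m₂.strong i) (m₂.inv i) with hq₂
  set p₁ : ι₁ → ℝ := fun j => max (m₁.strong j) (m₁.contr j) with hp₁
  set q₁ : ι₁ → ℝ := fun j => max (m₁.strong j) (m₁.inv j) with hq₁
  have e1 : ∀ᶠ η in 𝓝[>] (0 : ℝ), ∀ i ∈ m₂.index, (p₂ i + η) * (q₂ i + η) ≤ 1 - η :=
    (Filter.eventually_all_finset _).2 fun i hi => eventually_add_mul_add_le (hd₂.max_mul_max_lt hi)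
  have e2 : ∀ᶠ η in 𝓝[>] (0 : ℝ), ∀ i ∈ m₁.index, (p₁ i + η) * (q₁ i + η) ≤ 1 - η :=
    (Filter.eventually_all_finset _).2 fun i hi => eventually_add_mul_add_le (hd₁.max_mul_max_lt hi)
  have e3 : ∀ᶠ η in 𝓝[>] (0 : ℝ), ∀ i ∈ m₂.index, ∀ j ∈ m₁.index,
      m₂.strong i * m₁.strong j ≤ 1 - η :=
    (Filter.eventually_all_finset _).2 fun i hi => (Filter.eventually_all_finset _).2 fun j hj =>
      eventually_le_one_sub (by
        have h1 := hd₂.strong_nonneg i hi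
        have h2 := hd₂.strong_lt_one i hi
        have h3 := hd₁.strong_lt_one j hj
        nlinarith)
  have e4 := eventually_le_one_sub h₂₁
  have e5 := eventually_le_one_sub h₁₂
  have e6 : ∀ᶠ η in 𝓝[>] (0 : ℝ), (∀ i ∈ m₂.index, p₂ i + η ≤ 1 - η) ∨
      ∀ j ∈ m₁.index, q₁ j + η ≤ 1 - η := by
    rcases hd₂.forall_max_lt_or hd₁ h₂₁ with h | h
    · exact Eventually.mono ((Filter.eventually_all_finset _).2 fun i hi =>
        eventually_add_le_one_sub (h i hi)) fun η hη => Or.inl hη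
    · exact Eventually.mono ((Filter.eventually_all_finset _).2 fun i hi =>
        eventually_add_le_one_sub (h i hi)) fun η hη => Or.inr hη
  have e7 : ∀ᶠ η in 𝓝[>] (0 : ℝ), (∀ i ∈ m₁.index, p₁ i + η ≤ 1 - η) ∨
      ∀ j ∈ m₂.index, q₂ j + η ≤ 1 - η := by
    rcases hd₁.forall_max_lt_or hd₂ h₁₂ with h | h
    · exact Eventually.mono ((Filter.eventually_all_finset _).2 fun i hi =>
        eventually_add_le_one_sub (h i hi)) fun η hη => Or.inl hη
    · exact Eventually.mono ((Filter.eventually_all_finset _).2 fun i hi =>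
        eventually_add_le_one_sub (h i hi)) fun η hη => Or.inr hη
  have e8 : ∀ᶠ η in 𝓝[>] (0 : ℝ), η < 1 := nhdsWithin_le_nhds (gt_mem_nhds one_pos)
  have e9 : ∀ᶠ η in 𝓝[>] (0 : ℝ), 0 < η := self_mem_nhdsWithin
  obtain ⟨η, f1, f2, f3, f4, f5, f6, f7, f8, f9⟩ := (e1.and (e2.and (e3.and (e4.and (e5.and
    (e6.and (e7.and (e8.and e9)))))))).exists
  obtain ⟨D₁, hD₁⟩ := (m₂.index.image p₂).exists_le
  obtain ⟨D₂, hD₂⟩ := (m₂.index.image q₂).exists_le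
  obtain ⟨D₃, hD₃⟩ := (m₁.index.image p₁).exists_le
  obtain ⟨D₄, hD₄⟩ := (m₁.index.image q₁).exists_le
  set D : ℝ := 1 + max 0 (max (max D₁ D₂) (max D₃ D₄)) with hD
  have g0 : 1 ≤ D := by
    have := le_max_left 0 (max (max D₁ D₂) (max D₃ D₄))
    linarith
  have gmax : ∀ x, x ≤ max (max D₁ D₂) (max D₃ D₄) → x + η ≤ D := fun x hx => by
    have := le_max_right 0 (max (max D₁ D₂) (max D₃ D₄))
    linarith
  have g1 : ∀ i ∈ m₂.index, p₂ i + η ≤ D := fun i hi => gmax _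
    ((hD₁ _ (Finset.mem_image_of_mem _ hi)).trans ((le_max_left _ _).trans (le_max_left _ _)))
  have g2 : ∀ i ∈ m₂.index, q₂ i + η ≤ D := fun i hi => gmax _
    ((hD₂ _ (Finset.mem_image_of_mem _ hi)).trans ((le_max_right _ _).trans (le_max_left _ _)))
  have g3 : ∀ i ∈ m₁.index, p₁ i + η ≤ D := fun i hi => gmax _
    ((hD₃ _ (Finset.mem_image_of_mem _ hi)).trans ((le_max_left _ _).trans (le_max_right _ _)))
  have g4 : ∀ i ∈ m₁.index, q₁ i + η ≤ D := fun i hi => gmax _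
    ((hD₄ _ (Finset.mem_image_of_mem _ hi)).trans ((le_max_right _ _).trans (le_max_right _ _)))
  set W : ℝ := max (Metric.diam m₂.fiber) (Metric.diam m₁.fiber) with hW
  refine exists_joint_orbits (D := D) (W := W) (lam := 1 - η) (A₂ := fun i => p₂ i + η)
    (B₂ := fun i => q₂ i + η) (A₁ := fun i => p₁ i + η) (B₁ := fun i => q₁ i + η)
    (w₁ := w₁) (w₂ := w₂) (η := η)
    ⟨hc₂.isComplete, hconv₂, hne₂, ?_, hw₂, hd₂.strong_nonneg, ?_, hd₂.contr_nonneg, ?_,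
      hd₂.inv_nonneg, ?_⟩
    ⟨hc₁.isComplete, hconv₁, hne₁, ?_, hw₁, hd₁.strong_nonneg, ?_, hd₁.contr_nonneg, ?_,
      hd₁.inv_nonneg, ?_⟩ g0 (by linarith) (by linarith) f3 ?_ ?_ hs₂ hs₁ hΔ₂ hΔ₁ hl₂ hl₂' hl₁ hl₁'
    hlw₂ hlw₁ f9 ?_ ?_ ?_ ?_ ?_ ?_ ?_ ?_ g3 g4 f2 g1 g2 f1 f6 f7
  · intro s hs s' hs'
    rw [← dist_eq_norm]
    exact (Metric.dist_le_diam_of_mem hc₂.isBounded hs hs').trans (le_max_left _ _)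
  · exact fun i hi => by linarith [g1 i hi, le_max_left (m₂.strong i) (m₂.contr i)]
  · exact fun i hi => by linarith [g1 i hi, le_max_right (m₂.strong i) (m₂.contr i)]
  · exact fun i hi => by linarith [g2 i hi, le_max_right (m₂.strong i) (m₂.inv i)]
  · intro s hs s' hs'
    rw [← dist_eq_norm]
    exact (Metric.dist_le_diam_of_mem hc₁.isBounded hs hs').trans (le_max_right _ _)
  · exact fun i hi => by linarith [g3 i hi, le_max_left (m₁.strong i) (m₁.contr i)]
  · exact fun i hi => by linarith [g3 i hi, le_max_right (m₁.strong i) (m₁.contr i)]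
  · exact fun i hi => by linarith [g4 i hi, le_max_right (m₁.strong i) (m₁.inv i)]
  · exact fun i hi j hj => (mul_le_mul (hd₂.contr_le i hi) (hd₁.inv_le j hj)
      (hd₁.inv_nonneg j hj) ha₂).trans f4
  · exact fun i hi j hj => (mul_le_mul (hd₁.contr_le j hj) (hd₂.inv_le i hi)
      (hd₂.inv_nonneg i hi) ha₁).trans f5
  · exact fun i _ => by gcongr; exact le_max_left _ _
  · exact fun i _ => by gcongr; exact le_max_right _ _
  · exact fun i _ => by gcongr; exact le_max_left _ _
  · exact fun i _ => by gcongr; exact le_max_right _ _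
  · exact fun i _ => by gcongr; exact le_max_left _ _
  · exact fun i _ => by gcongr; exact le_max_right _ _
  · exact fun i _ => by gcongr; exact le_max_left _ _
  · exact fun i _ => by gcongr; exact le_max_right _ _

end Constants

/-! ### Words of affine maps -/

section Words

theorem affineEquiv_apply {E : Type*} [NormedAddCommGroup E] [NormedSpace ℝ E] (f : E ≃ᵃ[ℝ] E)
    (x : E) : f x = f.linear x + f 0 := by
  have h := congrFun (AffineMap.decomp (f : E →ᵃ[ℝ] E)) x
  simpa using h

theorem exists_wordMap_eq_of_norm_lt {k m : ℕ} {f : Fin k → (Fin m → ℝ) ≃ᵃ[ℝ] (Fin m → ℝ)} {ν : ℝ}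
    (hν : 0 ≤ ν) (hf : ∀ i, ‖LinearMap.toContinuousLinearMap
      ((f i).linear : (Fin m → ℝ) →ₗ[ℝ] (Fin m → ℝ))‖ < ν) (w : List (Fin k)) :
    ∃ (T : (Fin m → ℝ) →L[ℝ] (Fin m → ℝ)) (t : Fin m → ℝ),
      (∀ x, wordMap (fun i => ⇑(f i)) w x = T x + t) ∧ ∀ x, ‖T x‖ ≤ ν ^ w.length * ‖x‖ := by
  induction w with
  | nil => exact ⟨ContinuousLinearMap.id ℝ _, 0, fun x => by simp [wordMap], fun x => by simp⟩
  | cons i w ih =>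
    obtain ⟨T, t, hT, hn⟩ := ih
    refine ⟨T.comp (LinearMap.toContinuousLinearMap
      ((f i).linear : (Fin m → ℝ) →ₗ[ℝ] (Fin m → ℝ))), T (f i 0) + t, fun x => ?_, fun x => ?_⟩
    · change wordMap _ w (f i x) = _
      rw [hT, affineEquiv_apply, map_add, add_assoc]
      rfl
    · have h1 := ContinuousLinearMap.le_of_opNorm_le _ (hf i).le x
      calc _ ≤ ν ^ w.length * ‖_‖ := hn _
        _ ≤ ν ^ w.length * (ν * ‖x‖) := by
          gcongr
          exact h1
        _ = _ := by
          rw [List.length_cons]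
          ring

theorem exists_wordMap_eq_of_norm_symm_lt {k m : ℕ} {f : Fin k → (Fin m → ℝ) ≃ᵃ[ℝ] (Fin m → ℝ)}
    {ν : ℝ} (hν : 0 ≤ ν) (hf : ∀ i, ‖LinearMap.toContinuousLinearMap
      ((f i).linear.symm : (Fin m → ℝ) →ₗ[ℝ] (Fin m → ℝ))‖ < ν) (w : List (Fin k)) :
    ∃ (S : (Fin m → ℝ) ≃L[ℝ] (Fin m → ℝ)) (s : Fin m → ℝ),
      (∀ x, wordMap (fun i => ⇑(f i)) w x = S x + s) ∧ ∀ x, ‖S.symm x‖ ≤ ν ^ w.length * ‖x‖ := by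
  induction w with
  | nil => exact ⟨ContinuousLinearEquiv.refl ℝ _, 0, fun x => by simp [wordMap], fun x => by simp⟩
  | cons i w ih =>
    obtain ⟨S, s, hS, hn⟩ := ih
    refine ⟨(f i).linear.toContinuousLinearEquiv.trans S, S (f i 0) + s, fun x => ?_, fun x => ?_⟩
    · change wordMap _ w (f i x) = _
      rw [hS, affineEquiv_apply, map_add, add_assoc]
      rfl
    · have h1 := ContinuousLinearMap.le_of_opNorm_le _ (hf i).le (S.symm x)
      calc _ ≤ ν * ‖S.symm x‖ := h1
        _ ≤ ν * (ν ^ w.length * ‖x‖) := by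
          gcongr
          exact hn x
        _ = _ := by
          rw [List.length_cons]
          ring

theorem wordMap_mem {κ α : Type*} {f : κ → α → α} {C C' : Set α} (hC : C' ⊆ C)
    (hf : ∀ i, f i '' C ⊆ C') {w : List κ} (hw : w ≠ []) {x : α} (hx : x ∈ C) :
    wordMap f w x ∈ C' := by
  induction w generalizing x with
  | nil => exact absurd rfl hw
  | cons i w ih =>
    have h1 : f i x ∈ C' := hf i ⟨x, hx, rfl⟩
    rcases eq_or_ne w [] with rfl | hw'
    · exact h1
    · exact ih hw' (hC h1)

theorem mem_of_wordMap_mem {κ α : Type*} {f : κ → α → α} {C C' : Set α} (hC : C' ⊆ C)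
    (hf : ∀ i, f i ⁻¹' C ⊆ C') {w : List κ} (hw : w ≠ []) {x : α} (hx : wordMap f w x ∈ C) :
    x ∈ C' := by
  induction w generalizing x with
  | nil => exact absurd rfl hw
  | cons i w ih =>
    rcases eq_or_ne w [] with rfl | hw'
    · exact hf i hx
    · exact hf i (hC (ih hw' hx))

theorem isCompact_unitCube (n : ℕ) : IsCompact (unitCube n) := isCompact_Icc

theorem convex_unitCube (n : ℕ) : Convex ℝ (unitCube n) := convex_Icc 0 1

theorem nonempty_unitCube (n : ℕ) : (unitCube n).Nonempty := ⟨0, le_rfl, zero_le_one⟩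

end Words

/-! ### Tower maps as skew extensions -/

section Tower

variable {d : ℕ} {M : Type*} [TopologicalSpace M] [ChartedSpace (EuclideanSpace ℝ (Fin d)) M]

theorem IsSplitting.swap {F G : Type*} [NormedAddCommGroup F] [NormedSpace ℝ F]
    [NormedAddCommGroup G] [NormedSpace ℝ G] [CompleteSpace F] [CompleteSpace G]
    {P : M → F} {Q : M → G} {N : Set M}
    (h : IsSplitting (𝓡 d) P Q N) : IsSplitting (𝓡 d) Q P N := by
  obtain ⟨h1, h2, h3⟩ := h
  refine ⟨h1, fun x hx y hy hxy => h2 hx hy ?_, fun x => ?_⟩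
  · simp only [Prod.mk.injEq] at hxy ⊢
    exact hxy.symm
  · exact IsLocalDiffeomorphAt.comp _ _ (h3 x) (isLocalDiffeomorphAt_of_hasFDerivAt
      (f := (Prod.swap : F × G → G × F)) (f' := ContinuousLinearEquiv.prodComm ℝ F G)
      (ContinuousLinearEquiv.prodComm ℝ F G).contDiff.contDiffAt
      (ContinuousLinearEquiv.hasFDerivAt (ContinuousLinearEquiv.prodComm ℝ F G)))

theorem IsRectangle.image_eq_prod {F G : Type*} [NormedAddCommGroup F] [NormedSpace ℝ F]
    [NormedAddCommGroup G] [NormedSpace ℝ G] {P : M → F} {Q : M → G} {R : Set M}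
    (h : IsRectangle (𝓡 d) P Q R) :
    InjOn (fun x => (P x, Q x)) R ∧ (fun x => (P x, Q x)) '' R = (P '' R) ×ˢ (Q '' R) := by
  obtain ⟨⟨W, hRW, hW⟩, h2⟩ := h
  exact ⟨hW.2.1.mono hRW, h2⟩

theorem norm_apply_le_inv_mul {E F : Type*} [Norm E] [NormedAddCommGroup F] {a : E → F} {μ : ℝ}
    (hμ : 0 < μ) (h : ∀ v, μ * ‖a v‖ ≤ ‖v‖) (v : E) : ‖a v‖ ≤ μ⁻¹ * ‖v‖ := by
  rw [inv_mul_eq_div, le_div_iff₀ hμ, mul_comm]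
  exact h v

theorem IsPreblendingMachine.exists_isSkewExtension {k m n p q : ℕ} {ν : ℝ}
    {A : AffineHorseshoe k m n ν} {𝓕 : LocalDiffeoFamily d k M} {N : Set M}
    {S : Finset (List (Fin k))} {R : List (Fin k) → Set M} {B : Set M} {P : M → Fin p → ℝ}
    {Q : M → Fin q → ℝ} (hD : IsPreblendingMachine 𝓕 N S R B P Q)
    {F : SkewSpace m n M → SkewSpace m n M} {U : Set (SkewSpace m n M)}
    (hF : IsTowerMap A 𝓕 S R F U) {Ψ : PartialDiffeomorph (𝓡 d)
      𝓘(ℝ, (Fin p → ℝ) × (Fin q → ℝ)) M ((Fin p → ℝ) × (Fin q → ℝ)) 1}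
    (hΨN : Ψ.source = N) (hΨ : Ψ.toFun = fun x => (P x, Q x)) {w : List (Fin k)} (hw : w ∈ S)
    {μ γ μ' γ' : ℝ} (hμ : 0 < μ) (hγ : 0 < γ) (hμ' : 0 < μ') (hγ' : 0 < γ')
    (hdom : Dominated (𝓡 d) P Q P Q μ γ (𝓕.word w) (R w))
    (hdom' : Dominated (𝓡 d) P Q P Q μ' γ' (𝓕.word w) (R w)) :
    ∃ (T : (Fin m → ℝ) →L[ℝ] (Fin m → ℝ)) (t : Fin m → ℝ)
      (Su : (Fin n → ℝ) ≃L[ℝ] (Fin n → ℝ)) (s : Fin n → ℝ),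
      (∀ x, wordMap (fun i => ⇑(A.stableMap i)) w x = T x + t) ∧
      (∀ x, wordMap (fun i => ⇑(A.unstableMap i)) w x = Su x + s) ∧
      skewRect (ContinuousLinearEquiv.refl ℝ ((Fin m → ℝ) × (Fin n → ℝ))) Su s (unitCube m)
        (unitCube n) (R w) = towerRect A R w ∧
      IsSkewExtension (ContinuousLinearEquiv.refl ℝ ((Fin m → ℝ) × (Fin n → ℝ))) Ψ Ψ T t Su s
        (𝓕.word w) (unitCube m) (unitCube n) (R w) (ν ^ w.length) (min μ⁻¹ μ'⁻¹) (min γ⁻¹ γ'⁻¹)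
        F U := by
  obtain ⟨T, t, hT, hTn⟩ := exists_wordMap_eq_of_norm_lt A.nu_pos.le A.stable_norm_lt w
  obtain ⟨Su, s, hS, hSn⟩ := exists_wordMap_eq_of_norm_symm_lt A.nu_pos.le A.unstable_norm_lt w
  have hrect : skewRect (ContinuousLinearEquiv.refl ℝ ((Fin m → ℝ) × (Fin n → ℝ))) Su s (unitCube m)
      (unitCube n) (R w) = towerRect A R w := by
    ext z
    change ((z.1.1 ∈ unitCube m ∧ Su z.1.2 + s ∈ unitCube n) ∧ z.2 ∈ R w) ↔
      ((z.1.1 ∈ unitCube m ∧ wordMap (fun i => ⇑(A.unstableMap i)) w z.1.2 ∈ unitCube n) ∧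
        z.2 ∈ R w)
    rw [hS]
  have hbranch : skewBranch (ContinuousLinearEquiv.refl ℝ ((Fin m → ℝ) × (Fin n → ℝ))) T t Su s
      (𝓕.word w) = towerBranch A 𝓕 w := by
    funext z
    change ((T z.1.1 + t, Su z.1.2 + s), 𝓕.word w z.2) =
      ((wordMap (fun i => ⇑(A.stableMap i)) w z.1.1,
        wordMap (fun i => ⇑(A.unstableMap i)) w z.1.2), 𝓕.word w z.2)
    rw [hS, hT]
  obtain ⟨⟨W, hRW, hWw, hWd, hWN⟩, -⟩ := hD.pb1 w hw
  have hΨP : ∀ x, Ψ x = (P x, Q x) := fun x => congrFun hΨ x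
  obtain ⟨hinj, himg⟩ := (hD.pb2_rectangle w hw).image_eq_prod
  refine ⟨T, t, Su, s, hT, hS, hrect, hF.isOpen, hF.contMDiffOn, ?_, ?_, isCompact_unitCube m,
    isCompact_unitCube n, hD.isCompact w hw, ?_, ?_, fun x hx => hWd.2.2 ⟨x, hRW hx⟩, ?_, ?_, hTn,
    hSn, fun x hx => ?_⟩
  · rw [hrect]
    exact hF.subset w hw
  · rw [hrect, hbranch]
    exact hF.agree w hw
  · rw [hΨN]
    exact hD.subset_open w hw
  · rw [hΨN]
    exact hWN.mono_left hRW
  · simp only [hΨP]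
    exact hinj
  · simp only [hΨP]
    exact himg
  · obtain ⟨a, b, hab, hinj, hrates⟩ := exists_prodMap_of_dominated hΨ hΨ (φ := 𝓕.word w) (x := x)
      (by
        rw [hΨN]
        exact hD.subset_open w hw hx)
      (by
        rw [hΨN]
        exact hWN (hRW hx)) (hWd.2.2 ⟨x, hRW hx⟩) hx hdom
    refine ⟨a, b, hab, hinj, fun v => ?_, fun v => ?_⟩
    · rcases min_choice μ⁻¹ μ'⁻¹ with h | h <;> rw [h]
      · exact norm_apply_le_inv_mul hμ (hrates _ _ hdom).1 v
      · exact norm_apply_le_inv_mul hμ' (hrates _ _ hdom').1 v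
    · have hsymm : ∀ {g}, (∀ w, g * ‖w‖ ≤ ‖b w‖) → ∀ w, g * ‖b.symm w‖ ≤ ‖w‖ := fun hg w => by
        simpa using hg (b.symm w)
      rcases min_choice γ⁻¹ γ'⁻¹ with h | h <;> rw [h]
      · exact norm_apply_le_inv_mul hγ (hsymm (hrates _ _ hdom).2) v
      · exact norm_apply_le_inv_mul hγ' (hsymm (hrates _ _ hdom').2) v

/-- The transition map as a skew extension; the factors of the base of its domain are interchanged,
and its domain carries the transposed coordinates of the second machine. -/
theorem IsTransitionTowerMap.exists_isSkewExtension {m n p q : ℕ} {ν : ℝ}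
    {A : AffineHorseshoe 1 m n ν} {φ : M → M} {R : Set M}
    {F : SkewSpace n m M → SkewSpace m n M} {V : Set (SkewSpace n m M)}
    (hF : IsTransitionTowerMap d A φ R F V) {P₂ P₁ : M → Fin p → ℝ} {Q₂ Q₁ : M → Fin q → ℝ}
    {Ψ Ψ' : PartialDiffeomorph (𝓡 d)
      𝓘(ℝ, (Fin p → ℝ) × (Fin q → ℝ)) M ((Fin p → ℝ) × (Fin q → ℝ)) 1}
    (hΨ : Ψ.toFun = fun x => (P₂ x, Q₂ x)) (hΨ' : Ψ'.toFun = fun x => (P₁ x, Q₁ x))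
    (hR : IsCompact R) (hRΨ : R ⊆ Ψ.source) (hRΨ' : MapsTo φ R Ψ'.source)
    (hφ : ∀ x ∈ R, IsLocalDiffeomorphAt (𝓡 d) (𝓡 d) 1 φ x)
    (hrect : IsRectangle (𝓡 d) P₂ (Q₁ ∘ φ) R) {μ γ : ℝ} (hμ : 0 < μ) (hγ : 0 < γ)
    (hdom : Dominated (𝓡 d) P₂ Q₂ P₁ Q₁ μ γ φ R) :
    ∃ (T : (Fin m → ℝ) →L[ℝ] (Fin m → ℝ)) (t : Fin m → ℝ)
      (Su : (Fin n → ℝ) ≃L[ℝ] (Fin n → ℝ)) (s : Fin n → ℝ),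
      (∀ x, wordMap (fun i => ⇑(A.stableMap i)) [0] x = T x + t) ∧
      (∀ x, wordMap (fun i => ⇑(A.unstableMap i)) [0] x = Su x + s) ∧
      skewRect (ContinuousLinearEquiv.prodComm ℝ (Fin n → ℝ) (Fin m → ℝ)) Su s (unitCube m)
        (unitCube n) R = transitionRect A R ∧
      IsSkewExtension (ContinuousLinearEquiv.prodComm ℝ (Fin n → ℝ) (Fin m → ℝ)) Ψ Ψ' T t Su s
        φ (unitCube m) (unitCube n) R ν μ⁻¹ γ⁻¹ F V := by
  obtain ⟨T, t, hT, hTn⟩ := exists_wordMap_eq_of_norm_lt A.nu_pos.le A.stable_norm_lt [0]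
  obtain ⟨Su, s, hS, hSn⟩ := exists_wordMap_eq_of_norm_symm_lt A.nu_pos.le A.unstable_norm_lt [0]
  simp only [List.length_cons, List.length_nil, zero_add, pow_one] at hTn hSn
  have hskew : skewRect (ContinuousLinearEquiv.prodComm ℝ (Fin n → ℝ) (Fin m → ℝ)) Su s
      (unitCube m) (unitCube n) R = transitionRect A R := by
    ext z
    change ((z.1.2 ∈ unitCube m ∧ Su z.1.1 + s ∈ unitCube n) ∧ z.2 ∈ R) ↔
      ((z.1.2 ∈ unitCube m ∧ wordMap (fun i => ⇑(A.unstableMap i)) [0] z.1.1 ∈ unitCube n) ∧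
        z.2 ∈ R)
    rw [hS]
  have hbranch : skewBranch (ContinuousLinearEquiv.prodComm ℝ (Fin n → ℝ) (Fin m → ℝ)) T t Su s
      φ = transitionBranch A φ := by
    funext z
    change ((T z.1.2 + t, Su z.1.1 + s), φ z.2) =
      ((wordMap (fun i => ⇑(A.stableMap i)) [0] z.1.2,
        wordMap (fun i => ⇑(A.unstableMap i)) [0] z.1.1), φ z.2)
    rw [hS, hT]
  have hΨP : ∀ x, Ψ x = (P₂ x, Q₂ x) := fun x => congrFun hΨ x
  have hΨP' : ∀ x, Ψ' x = (P₁ x, Q₁ x) := fun x => congrFun hΨ' x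
  obtain ⟨hinj, himg⟩ := hrect.image_eq_prod
  refine ⟨T, t, Su, s, hT, hS, hskew, hF.isOpen, hF.contMDiffOn, ?_, ?_, isCompact_unitCube m,
    isCompact_unitCube n, hR, hRΨ, hRΨ', hφ, ?_, ?_, hTn, hSn, fun x hx => ?_⟩
  · rw [hskew]
    exact hF.subset
  · rw [hskew, hbranch]
    exact hF.agree
  · simp only [hΨP, hΨP']
    exact hinj
  · simp only [hΨP, hΨP']
    exact himg
  · obtain ⟨a, b, hab, hinj, hrates⟩ := exists_prodMap_of_dominated hΨ hΨ' (φ := φ) (x := x)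
      (hRΨ hx) (hRΨ' hx) (hφ x hx) hx hdom
    refine ⟨a, b, hab, hinj, norm_apply_le_inv_mul hμ (hrates _ _ hdom).1,
      norm_apply_le_inv_mul hγ fun w => ?_⟩
    simpa using (hrates _ _ hdom).2 (b.symm w)

end Tower

/-! ### Branch models of tower maps -/

section Machine

variable {d : ℕ} {M : Type*} [TopologicalSpace M] [ChartedSpace (EuclideanSpace ℝ (Fin d)) M]
  {k m n p q : ℕ} {ν : ℝ} {A : AffineHorseshoe k m n ν} {𝓕 : LocalDiffeoFamily d k M} {N : Set M}
  {S : Finset (List (Fin k))} {R : List (Fin k) → Set M} {B : Set M} {P : M → Fin p → ℝ}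
  {Q : M → Fin q → ℝ}

/-- The branch model of the tower map over a preblending machine. -/
def machineModel (m n : ℕ) (ν : ℝ) (S : Finset (List (Fin k))) (R : List (Fin k) → Set M) (B : Set M)
    (P : M → Fin p → ℝ) (Q : M → Fin q → ℝ) (α β : List (Fin k) → ℝ) :
    BranchModel (List (Fin k)) (Fin m → ℝ) (Fin p → ℝ) (Fin n → ℝ) (Fin q → ℝ) where
  index := S
  dom w := unitCube m ×ˢ (P '' R w)
  base := unitCube m ×ˢ (P '' B)
  fiber := unitCube n ×ˢ (Q '' B)
  strong w := ν ^ w.length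
  contr := α
  inv := β

theorem IsSplitting.continuousOn {F G : Type*} [NormedAddCommGroup F] [NormedSpace ℝ F]
    [NormedAddCommGroup G] [NormedSpace ℝ G] {P : M → F} {Q : M → G} {N : Set M}
    (h : IsSplitting (𝓡 d) P Q N) : ContinuousOn P N ∧ ContinuousOn Q N :=
  ⟨(h.2.2.contMDiffOn).continuousOn.fst, (h.2.2.contMDiffOn).continuousOn.snd⟩

theorem IsPreblendingMachine.isCompact_image_region (hD : IsPreblendingMachine 𝓕 N S R B P Q) :
    IsCompact (Q '' B) ∧ (Q '' B).Nonempty := by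
  obtain ⟨w, hw⟩ : S.Nonempty := Finset.card_pos.1 (by linarith [hD.two_le_card])
  obtain ⟨⟨W, hRW, -, hWd, hWN⟩, -⟩ := hD.pb1 w hw
  rw [← (hD.pb2 w hw).2.1]
  refine ⟨(hD.isCompact w hw).image_of_continuousOn ?_, (hD.nonempty w hw).image _⟩
  exact hD.splitting.continuousOn.2.comp (hWd.2.2.contMDiffOn.continuousOn.mono hRW)
    (hWN.mono_left hRW)

theorem machineModel_selects {X : Type*} {R : List (Fin k) → Set X} {B : Set X}
    {P : X → Fin p → ℝ} {Q : X → Fin q → ℝ} {α β : List (Fin k) → ℝ} {Δ : ℝ}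
    (hΔ : IsLebesgueNumber (closure (P '' B)) S (fun w => interior (P '' R w)) Δ) :
    (machineModel m n ν S R B P Q α β).Selects Δ := by
  intro T hT e he heΔ hTe
  have hsub : Prod.snd '' T ⊆ closure (P '' B) := by
    rintro _ ⟨x, hx, rfl⟩
    exact subset_closure (hT hx).2
  have hdist : ∀ x ∈ Prod.snd '' T, ∀ y ∈ Prod.snd '' T, dist x y ≤ e := by
    rintro _ ⟨x, hx, rfl⟩ _ ⟨y, hy, rfl⟩
    rw [dist_eq_norm]
    exact hTe x hx y hy
  obtain ⟨w, hw, hTw⟩ := hΔ.2 _ hsub (Metric.isBounded_iff.2 ⟨e, fun x hx y hy => hdist x hx y hy⟩)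
    ((Metric.diam_le_of_forall_dist_le he hdist).trans_lt heΔ)
  exact ⟨w, hw, fun x hx => ⟨(hT hx).1, interior_subset (hTw ⟨x, hx, rfl⟩)⟩⟩

/-- A map with a branch for every word of a machine realizes the branch model of the machine. -/
theorem exists_realizes {Φ : PartialDiffeomorph (skewModel m n d)
      𝓘(ℝ, ((Fin m → ℝ) × (Fin p → ℝ)) × ((Fin n → ℝ) × (Fin q → ℝ))) (SkewSpace m n M)
      (((Fin m → ℝ) × (Fin p → ℝ)) × ((Fin n → ℝ) × (Fin q → ℝ))) 1}
    {α β : List (Fin k) → ℝ} {κ : ℝ} {g : SkewSpace m n M → SkewSpace m n M}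
    {K : Set (SkewSpace m n M)} (h : ∀ w ∈ S, ∃ Lz ⊆ K, HasBranch Φ Φ g Lz
      (unitCube m ×ˢ (P '' R w)) (unitCube n ×ˢ (Q '' B)) (interior (unitCube n ×ˢ (Q '' B)))
      (interior (unitCube m ×ˢ (P '' B))) (ν ^ w.length) (α w) (β w) κ) :
    ∃ D : BranchDynamics (List (Fin k)) (SkewSpace m n M) (Fin m → ℝ) (Fin p → ℝ) (Fin n → ℝ)
        (Fin q → ℝ), D.map = g ∧ D.K = K ∧ (D.point = fun c u => Φ.symm (c, u)) ∧
      (machineModel m n ν S R B P Q α β).Realizes D κ := by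
  have h' : ∀ w, ∃ (v : (Fin m → ℝ) × (Fin p → ℝ) → (Fin n → ℝ) × (Fin q → ℝ) →
      (Fin n → ℝ) × (Fin q → ℝ)) (f : (Fin m → ℝ) × (Fin p → ℝ) → (Fin n → ℝ) × (Fin q → ℝ) →
      (Fin m → ℝ) × (Fin p → ℝ)), w ∈ S →
      (∀ c ∈ unitCube m ×ˢ (P '' R w), ∀ s ∈ unitCube n ×ˢ (Q '' B),
        v c s ∈ unitCube n ×ˢ (Q '' B) ∧ f c s ∈ unitCube m ×ˢ (P '' B) ∧
        Φ.symm (c, v c s) ∈ K ∧ g (Φ.symm (c, v c s)) = Φ.symm (f c s, s)) ∧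
      ∃ δ > 0, ∀ c ∈ unitCube m ×ˢ (P '' R w), ∀ c' ∈ unitCube m ×ˢ (P '' R w),
        ∀ s ∈ unitCube n ×ˢ (Q '' B), ∀ s' ∈ unitCube n ×ˢ (Q '' B), ‖c - c'‖ < δ →
        ‖s - s'‖ < δ →
        BlockBound (v c s - v c' s') (s - s') (ν ^ w.length) (β w)
          (κ * max ‖c - c'‖ ‖s - s'‖) ∧
        BlockBound (f c s - f c' s') (c - c') (ν ^ w.length) (α w)
          (κ * max ‖c - c'‖ ‖s - s'‖) := by
    intro w
    by_cases hw : w ∈ S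
    · obtain ⟨Lz, hLK, v, f, h1, h2⟩ := h w hw
      refine ⟨v, f, fun _ => ⟨fun c hc s hs => ?_, h2⟩⟩
      obtain ⟨h3, h4, x, hx, hxs, hxe, hgs, hge⟩ := h1 c hc s hs
      have e1 : Φ.symm (c, v c s) = x := by
        rw [← hxe]
        exact Φ.left_inv hxs
      have e2 : Φ.symm (f c s, s) = g x := by
        rw [← hge]
        exact Φ.left_inv hgs
      rw [e1, e2]
      exact ⟨interior_subset h3, interior_subset h4, hLK hx, rfl⟩
    · exact ⟨fun _ u => u, fun c _ => c, fun h => absurd h hw⟩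
  choose v f hvf using h'
  exact ⟨⟨g, K, fun c u => Φ.symm (c, u), v, f⟩, rfl, rfl, rfl,
    fun w hw c hc s hs => ((hvf w hw).1 c hc s hs).1,
    fun w hw c hc s hs => ((hvf w hw).1 c hc s hs).2.1,
    fun w hw c hc s hs => ((hvf w hw).1 c hc s hs).2.2.1,
    fun w hw c hc s hs => ((hvf w hw).1 c hc s hs).2.2.2,
    fun w hw => (hvf w hw).2⟩

/-- A tower map has a branch for every word over the rectangle of the word, and maps that are `C¹`
close to it have branches near these rectangles. -/
theorem IsPreblendingMachine.exists_hasBranch [IsManifold (𝓡 d) 1 M]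
    (hD : IsPreblendingMachine 𝓕 N S R B P Q)
    {F : SkewSpace m n M → SkewSpace m n M} {U : Set (SkewSpace m n M)}
    (hF : IsTowerMap A 𝓕 S R F U) {Ψ : PartialDiffeomorph (𝓡 d)
      𝓘(ℝ, (Fin p → ℝ) × (Fin q → ℝ)) M ((Fin p → ℝ) × (Fin q → ℝ)) 1}
    (hΨN : Ψ.source = N) (hΨ : Ψ.toFun = fun x => (P x, Q x)) {w : List (Fin k)} (hw : w ∈ S)
    {μ γ μ' γ' : ℝ} (hμ : 0 < μ) (hγ : 0 < γ) (hμ' : 0 < μ') (hγ' : 0 < γ')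
    (hdom : Dominated (𝓡 d) P Q P Q μ γ (𝓕.word w) (R w))
    (hdom' : Dominated (𝓡 d) P Q P Q μ' γ' (𝓕.word w) (R w))
    {W : Set (SkewSpace m n M)} (hW : IsOpen W) (hRW : towerRect A R w ⊆ W) {κ : ℝ} (hκ : 0 < κ) :
    HasBranch (skewCoordinates (ContinuousLinearEquiv.refl ℝ ((Fin m → ℝ) × (Fin n → ℝ))) Ψ)
      (skewCoordinates (ContinuousLinearEquiv.refl ℝ ((Fin m → ℝ) × (Fin n → ℝ))) Ψ) F
      (towerRect A R w) (unitCube m ×ˢ (P '' R w)) (unitCube n ×ˢ (Q '' B))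
      (interior (unitCube n ×ˢ (Q '' B))) (interior (unitCube m ×ˢ (P '' B)))
      (ν ^ w.length) (min μ⁻¹ μ'⁻¹) (min γ⁻¹ γ'⁻¹) κ ∧
    ∃ Lz ⊆ W, IsCompact Lz ∧ ∃ 𝒰 ∈ @nhds _ (c1Topology (skewModel m n d) (skewModel m n d) U) F,
      ∀ g ∈ 𝒰, ContMDiffOn (skewModel m n d) (skewModel m n d) 1 g U →
        HasBranch (skewCoordinates (ContinuousLinearEquiv.refl ℝ ((Fin m → ℝ) × (Fin n → ℝ))) Ψ)
          (skewCoordinates (ContinuousLinearEquiv.refl ℝ ((Fin m → ℝ) × (Fin n → ℝ))) Ψ) g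
          Lz (unitCube m ×ˢ (P '' R w)) (unitCube n ×ˢ (Q '' B))
          (interior (unitCube n ×ˢ (Q '' B))) (interior (unitCube m ×ˢ (P '' B)))
          (ν ^ w.length) (min μ⁻¹ μ'⁻¹) (min γ⁻¹ γ'⁻¹) κ := by
  obtain ⟨T, t, Su, s, hT, hS, hrect, hext⟩ :=
    hD.exists_isSkewExtension hF hΨN hΨ hw hμ hγ hμ' hγ' hdom hdom'
  have hwne := hD.word_ne_nil w hw
  have hΨP : ∀ x, Ψ x = (P x, Q x) := fun x => congrFun hΨ x
  obtain ⟨hQ, hQB, hPB⟩ := hD.pb2 w hw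
  have key := hext.exists_hasBranch hW (by rwa [hrect])
    (Wu := interior (unitCube n ×ˢ (Q '' B))) isOpen_interior (fun z hz => by
      rw [interior_prod_eq]
      refine ⟨mem_of_wordMap_mem interior_subset A.unstable_inside hwne (x := z.1.2) ?_,
        hQ (subset_closure ⟨z.2, hz.2, ?_⟩)⟩
      · rw [hS]
        exact hz.1.2
      · change Q z.2 = (Ψ z.2).2
        rw [hΨP])
    (Wc := interior (unitCube m ×ˢ (P '' B))) isOpen_interior (fun z hz => by
      rw [interior_prod_eq, hext.apply_eq hz]
      refine ⟨?_, hPB (subset_closure ⟨z.2, hz.2, ?_⟩)⟩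
      · change T z.1.1 + t ∈ _
        rw [← hT]
        exact wordMap_mem interior_subset A.stable_inside hwne hz.1.1
      · change P (𝓕.word w z.2) = (Ψ (𝓕.word w z.2)).1
        rw [hΨP]) hκ
  have e1 : (fun x => (Ψ x).1) '' R w = P '' R w := by simp only [hΨP]
  have e2 : (fun x => (Ψ (𝓕.word w x)).2) '' R w = Q '' B := by
    simp only [hΨP]
    exact hQB
  rw [e1, e2, hrect] at key
  exact key

theorem IsTransitionTowerMap.exists_hasBranch [IsManifold (𝓡 d) 1 M] {ν : ℝ}
    {A : AffineHorseshoe 1 m n ν} {φ : M → M} {R : Set M}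
    {F : SkewSpace n m M → SkewSpace m n M} {V : Set (SkewSpace n m M)}
    (hF : IsTransitionTowerMap d A φ R F V) {P₂ P₁ : M → Fin p → ℝ} {Q₂ Q₁ : M → Fin q → ℝ}
    {Ψ Ψ' : PartialDiffeomorph (𝓡 d)
      𝓘(ℝ, (Fin p → ℝ) × (Fin q → ℝ)) M ((Fin p → ℝ) × (Fin q → ℝ)) 1}
    (hΨ : Ψ.toFun = fun x => (P₂ x, Q₂ x)) (hΨ' : Ψ'.toFun = fun x => (P₁ x, Q₁ x))
    (hR : IsCompact R) (hRΨ : R ⊆ Ψ.source) (hRΨ' : MapsTo φ R Ψ'.source)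
    (hφ : ∀ x ∈ R, IsLocalDiffeomorphAt (𝓡 d) (𝓡 d) 1 φ x)
    (hrect : IsRectangle (𝓡 d) P₂ (Q₁ ∘ φ) R) {B₂ B₁ : Set M}
    (hQ₂ : InsideInterior (Q₂ '' R) (Q₂ '' B₂)) (hP₂ : P₂ '' R = P₂ '' B₂)
    (hP₁ : InsideInterior ((P₁ ∘ φ) '' R) (P₁ '' B₁)) (hQ₁ : (Q₁ ∘ φ) '' R = Q₁ '' B₁)
    {μ γ : ℝ} (hμ : 0 < μ) (hγ : 0 < γ) (hdom : Dominated (𝓡 d) P₂ Q₂ P₁ Q₁ μ γ φ R)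
    {κ : ℝ} (hκ : 0 < κ) :
    HasBranch (skewCoordinates (ContinuousLinearEquiv.prodComm ℝ (Fin n → ℝ) (Fin m → ℝ)) Ψ)
      (skewCoordinates (ContinuousLinearEquiv.refl ℝ ((Fin m → ℝ) × (Fin n → ℝ))) Ψ') F
      (transitionRect A R) (unitCube m ×ˢ (P₂ '' B₂)) (unitCube n ×ˢ (Q₁ '' B₁))
      (interior (unitCube n ×ˢ (Q₂ '' B₂))) (interior (unitCube m ×ˢ (P₁ '' B₁)))
      ν μ⁻¹ γ⁻¹ κ ∧
    ∃ Lz ⊆ V, IsCompact Lz ∧ ∃ 𝒰 ∈ @nhds _ (c1Topology (skewModel n m d) (skewModel m n d) V) F,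
      ∀ g ∈ 𝒰, ContMDiffOn (skewModel n m d) (skewModel m n d) 1 g V →
        HasBranch (skewCoordinates (ContinuousLinearEquiv.prodComm ℝ (Fin n → ℝ) (Fin m → ℝ)) Ψ)
          (skewCoordinates (ContinuousLinearEquiv.refl ℝ ((Fin m → ℝ) × (Fin n → ℝ))) Ψ') g
          Lz (unitCube m ×ˢ (P₂ '' B₂)) (unitCube n ×ˢ (Q₁ '' B₁))
          (interior (unitCube n ×ˢ (Q₂ '' B₂))) (interior (unitCube m ×ˢ (P₁ '' B₁)))
          ν μ⁻¹ γ⁻¹ κ := by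
  obtain ⟨T, t, Su, s, hT, hS, hskew, hext⟩ :=
    hF.exists_isSkewExtension hΨ hΨ' hR hRΨ hRΨ' hφ hrect hμ hγ hdom
  have hΨP : ∀ x, Ψ x = (P₂ x, Q₂ x) := fun x => congrFun hΨ x
  have hΨP' : ∀ x, Ψ' x = (P₁ x, Q₁ x) := fun x => congrFun hΨ' x
  have hne : [(0 : Fin 1)] ≠ [] := List.cons_ne_nil _ _
  have key := hext.exists_hasBranch hF.isOpen (by
      rw [hskew]
      exact hF.subset)
    (Wu := interior (unitCube n ×ˢ (Q₂ '' B₂))) isOpen_interior (fun z hz => by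
      rw [interior_prod_eq]
      refine ⟨mem_of_wordMap_mem interior_subset A.unstable_inside hne (x := z.1.1) ?_,
        hQ₂ (subset_closure ⟨z.2, hz.2, ?_⟩)⟩
      · rw [hS]
        exact hz.1.2
      · change Q₂ z.2 = (Ψ z.2).2
        rw [hΨP])
    (Wc := interior (unitCube m ×ˢ (P₁ '' B₁))) isOpen_interior (fun z hz => by
      rw [interior_prod_eq, hext.apply_eq hz]
      refine ⟨?_, hP₁ (subset_closure ⟨z.2, hz.2, ?_⟩)⟩
      · change T z.1.2 + t ∈ _
        rw [← hT]
        exact wordMap_mem interior_subset A.stable_inside hne hz.1.1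
      · change P₁ (φ z.2) = (Ψ' (φ z.2)).1
        rw [hΨP']) hκ
  have e1 : (fun x => (Ψ x).1) '' R = P₂ '' B₂ := by
    simp only [hΨP]
    exact hP₂
  have e2 : (fun x => (Ψ' (φ x)).2) '' R = Q₁ '' B₁ := by
    simp only [hΨP']
    exact hQ₁
  rw [e1, e2, hskew] at key
  exact key

end Machine

/-! ### Intersections of stable sets -/

section Limit

theorem isClosed_iterate_mem {X : Type*} [TopologicalSpace X] {f : X → X} {K : Set X}
    (hK : IsClosed K) (hf : ContinuousOn f K) (N : ℕ) : IsClosed {x | ∀ j < N, f^[j] x ∈ K} := by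
  induction N with
  | zero => simp
  | succ N ih =>
    have h : {x | ∀ j < N + 1, f^[j] x ∈ K} = K ∩ f ⁻¹' {x | ∀ j < N, f^[j] x ∈ K} := by
      ext x
      constructor
      · intro hx
        refine ⟨hx 0 (Nat.succ_pos _), fun j hj => ?_⟩
        have := hx (j + 1) (by omega)
        rwa [iterate_succ_apply] at this
      · rintro ⟨h1, h2⟩ j hj
        cases j with
        | zero => exact h1
        | succ j =>
          rw [iterate_succ_apply]
          exact h2 j (by omega)
    rw [h]
    exact hf.preimage_isClosed_of_isClosed hK ih

/-- If orbits of arbitrary lengths in compact sets start from points of a compact set and their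
images, then there is such a pair of infinite orbits. -/
theorem exists_mem_maximalForwardInvariantSet {X Y : Type*} [TopologicalSpace X] [T2Space X]
    [TopologicalSpace Y] [T2Space Y] {f : X → X} {g : Y → Y} {h : X → Y} {K C : Set X} {K' : Set Y}
    (hK : IsCompact K) (hK' : IsCompact K') (hC : IsCompact C) (hf : ContinuousOn f K)
    (hg : ContinuousOn g K') (hh : ContinuousOn h C)
    (H : ∀ N : ℕ, ∃ z ∈ C, (∀ j < N, f^[j] z ∈ K) ∧ ∀ j < N, g^[j] (h z) ∈ K') :
    ∃ z ∈ C, z ∈ maximalForwardInvariantSet K f ∧ h z ∈ maximalForwardInvariantSet K' g := by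
  set T : ℕ → Set X := fun N => (C ∩ h ⁻¹' {y | ∀ j < N, g^[j] y ∈ K'}) ∩
    {x | ∀ j < N, f^[j] x ∈ K} with hT
  have hTc : ∀ N, IsClosed (T N) := fun N =>
    (hh.preimage_isClosed_of_isClosed hC.isClosed (isClosed_iterate_mem hK'.isClosed hg N)).inter
      (isClosed_iterate_mem hK.isClosed hf N)
  obtain ⟨z, hz⟩ := IsCompact.nonempty_iInter_of_sequence_nonempty_isCompact_isClosed T
    (fun N z hz => ⟨⟨hz.1.1, fun j hj => hz.1.2 j (by omega)⟩, fun j hj => hz.2 j (by omega)⟩)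
    (fun N => by
      obtain ⟨z, h1, h2, h3⟩ := H N
      exact ⟨z, ⟨h1, h3⟩, h2⟩)
    (hC.of_isClosed_subset (hTc 0) fun z hz => hz.1.1) hTc
  rw [mem_iInter] at hz
  exact ⟨z, (hz 0).1.1, fun n => (hz (n + 1)).2 n (by omega), fun n => (hz (n + 1)).1.2 n (by omega)⟩

end Limit

section Joint

variable {d dc ds du k₁ k₂ : ℕ} {M : Type*} [TopologicalSpace M] [T2Space M]
  [ChartedSpace (EuclideanSpace ℝ (Fin d)) M]

/-- Branches of perturbations `g₁`, `g₂` of the two tower maps and of a perturbation `g` of the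
transition map produce a point of the stable set of the second machine that the transition maps into
the stable set of the first one. -/
theorem exists_mem_stable_of_hasBranch {q : ℕ} {S₁ : Finset (List (Fin k₁))}
    {R₁ : List (Fin k₁) → Set M} {B₁ : Set M} {P₁ : M → Fin dc → ℝ} {Q₁ : M → Fin q → ℝ}
    {S₂ : Finset (List (Fin k₂))} {R₂ : List (Fin k₂) → Set M} {B₂ : Set M} {Q₂ : M → Fin q → ℝ}
    {P₂ : M → Fin dc → ℝ} {ν₁ ν₂ νs : ℝ} {α₁ β₁ : List (Fin k₁) → ℝ} {α₂ β₂ : List (Fin k₂) → ℝ}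
    {a b κ : ℝ}
    (Hκ : ∀ (d₂ : BranchDynamics (List (Fin k₂)) (SkewSpace du ds M) (Fin du → ℝ) (Fin q → ℝ)
        (Fin ds → ℝ) (Fin dc → ℝ))
      (d₁ : BranchDynamics (List (Fin k₁)) (SkewSpace ds du M) (Fin ds → ℝ) (Fin dc → ℝ)
        (Fin du → ℝ) (Fin q → ℝ)),
      (machineModel du ds ν₂ S₂ R₂ B₂ Q₂ P₂ α₂ β₂).Realizes d₂ κ →
      (machineModel ds du ν₁ S₁ R₁ B₁ P₁ Q₁ α₁ β₁).Realizes d₁ κ →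
      ∀ (Rel : SkewSpace du ds M → SkewSpace ds du M → Prop)
        (c₂ : (Fin ds → ℝ) × (Fin dc → ℝ) → (Fin du → ℝ) × (Fin q → ℝ) →
          (Fin du → ℝ) × (Fin q → ℝ))
        (c₁ : (Fin du → ℝ) × (Fin q → ℝ) → (Fin ds → ℝ) × (Fin dc → ℝ) →
          (Fin ds → ℝ) × (Fin dc → ℝ)),
      OrbitFamily (machineModel du ds ν₂ S₂ R₂ B₂ Q₂ P₂ α₂ β₂) d₂
        (machineModel ds du ν₁ S₁ R₁ B₁ P₁ Q₁ α₁ β₁) d₁ Rel 0 0 c₂ c₁ →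
      SmallScaleBlock (unitCube ds ×ˢ (P₂ '' B₂)) (unitCube du ×ˢ (Q₁ '' B₁)) c₂ νs b κ →
      SmallScaleBlock (unitCube du ×ˢ (Q₁ '' B₁)) (unitCube ds ×ˢ (P₂ '' B₂)) c₁ νs a κ →
      ∀ N : ℕ, ∃ z w, Rel z w ∧ (∀ j < N, d₂.map^[j] z ∈ d₂.K) ∧ ∀ j < N, d₁.map^[j] w ∈ d₁.K)
    {Φ₁ : PartialDiffeomorph (skewModel ds du d)
      𝓘(ℝ, ((Fin ds → ℝ) × (Fin dc → ℝ)) × ((Fin du → ℝ) × (Fin q → ℝ))) (SkewSpace ds du M)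
      (((Fin ds → ℝ) × (Fin dc → ℝ)) × ((Fin du → ℝ) × (Fin q → ℝ))) 1}
    {Φ₂ : PartialDiffeomorph (skewModel du ds d)
      𝓘(ℝ, ((Fin du → ℝ) × (Fin q → ℝ)) × ((Fin ds → ℝ) × (Fin dc → ℝ))) (SkewSpace du ds M)
      (((Fin du → ℝ) × (Fin q → ℝ)) × ((Fin ds → ℝ) × (Fin dc → ℝ))) 1}
    {Φt : PartialDiffeomorph (skewModel du ds d)
      𝓘(ℝ, ((Fin ds → ℝ) × (Fin dc → ℝ)) × ((Fin du → ℝ) × (Fin q → ℝ))) (SkewSpace du ds M)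
      (((Fin ds → ℝ) × (Fin dc → ℝ)) × ((Fin du → ℝ) × (Fin q → ℝ))) 1}
    (hΦ : ∀ x ∈ Φt.source, x ∈ Φ₂.source ∧ Φ₂ x = (Φt x).swap)
    {g₁ : SkewSpace ds du M → SkewSpace ds du M} {g₂ : SkewSpace du ds M → SkewSpace du ds M}
    {g : SkewSpace du ds M → SkewSpace ds du M} {K₁ : Set (SkewSpace ds du M)}
    {K₂ C : Set (SkewSpace du ds M)} (hK₁ : IsCompact K₁) (hK₂ : IsCompact K₂) (hC : IsCompact C)
    (hg₁ : ContinuousOn g₁ K₁) (hg₂ : ContinuousOn g₂ K₂) (hg : ContinuousOn g C)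
    (h₁ : ∀ w ∈ S₁, ∃ L ⊆ K₁, HasBranch Φ₁ Φ₁ g₁ L (unitCube ds ×ˢ (P₁ '' R₁ w))
      (unitCube du ×ˢ (Q₁ '' B₁)) (interior (unitCube du ×ˢ (Q₁ '' B₁)))
      (interior (unitCube ds ×ˢ (P₁ '' B₁))) (ν₁ ^ w.length) (α₁ w) (β₁ w) κ)
    (h₂ : ∀ w ∈ S₂, ∃ L ⊆ K₂, HasBranch Φ₂ Φ₂ g₂ L (unitCube du ×ˢ (Q₂ '' R₂ w))
      (unitCube ds ×ˢ (P₂ '' B₂)) (interior (unitCube ds ×ˢ (P₂ '' B₂)))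
      (interior (unitCube du ×ˢ (Q₂ '' B₂))) (ν₂ ^ w.length) (α₂ w) (β₂ w) κ)
    (h : HasBranch Φt Φ₁ g C (unitCube ds ×ˢ (P₂ '' B₂)) (unitCube du ×ˢ (Q₁ '' B₁))
      (interior (unitCube du ×ˢ (Q₂ '' B₂))) (interior (unitCube ds ×ˢ (P₁ '' B₁))) νs a b κ) :
    ∃ z ∈ C, z ∈ maximalForwardInvariantSet K₂ g₂ ∧ g z ∈ maximalForwardInvariantSet K₁ g₁ := by
  refine exists_mem_maximalForwardInvariantSet hK₂ hK₁ hC hg₂ hg₁ hg fun N => ?_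
  obtain ⟨d₁, hm₁, hk₁, hp₁, hr₁⟩ := exists_realizes h₁
  obtain ⟨d₂, hm₂, hk₂, hp₂, hr₂⟩ := exists_realizes h₂
  obtain ⟨v, f, hvf, δ, hδ, hest⟩ := h
  obtain ⟨z, w, ⟨hz, rfl⟩, hzN, hwN⟩ := Hκ d₂ d₁ hr₂ hr₁ (fun z w => z ∈ C ∧ w = g z) v
    (fun t s => f s t) (by
      intro s hs t ht
      obtain ⟨h1, h2, x, hx, hxs, hxe, hgs, hge⟩ := hvf s hs t ht
      refine ⟨interior_subset h1, interior_subset h2, x, g x, ⟨hx, rfl⟩, ?_, ?_, by simp, by simp⟩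
      · obtain ⟨h3, h4⟩ := hΦ x hxs
        rw [hxe] at h4
        have h5 : Φ₂.symm (Φ₂ x) = x := Φ₂.left_inv h3
        rw [h4] at h5
        rw [hp₂]
        exact h5.symm
      · have h5 : Φ₁.symm (Φ₁ (g x)) = g x := Φ₁.left_inv hgs
        rw [hge] at h5
        rw [hp₁]
        exact h5.symm)
    ⟨δ, hδ, fun s hs s' hs' t ht t' ht' h1 h2 => (hest s hs s' hs' t ht t' ht' h1 h2).1⟩
    ⟨δ, hδ, fun t ht t' ht' s hs s' hs' h1 h2 => by
      rw [max_comm]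
      exact (hest s hs s' hs' t ht t' ht' h2 h1).2⟩ N
  rw [hm₂, hk₂] at hzN
  rw [hm₁, hk₁] at hwN
  exact ⟨z, hz, hzN, hwN⟩

theorem inv_mul_inv_lt_one {x y : ℝ} (h : 1 < x * y) :
    x⁻¹ * y⁻¹ < 1 := by
  rw [← mul_inv]
  exact inv_lt_one_of_one_lt₀ h

/-- The rates of a machine whose horseshoe has adapted stretching. -/
theorem machineModel_isDominated {k m n p q : ℕ} {ν : ℝ} {X : Type*} {S : Finset (List (Fin k))}
    {R : List (Fin k) → Set X} {B : Set X} {P : X → Fin p → ℝ} {Q : X → Fin q → ℝ} {μ γ : ℝ}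
    {μ' γ' : List (Fin k) → ℝ} (hν0 : 0 < ν) (hν1 : ν < 1) (hne : ∀ w ∈ S, w ≠ []) (hμ : 0 < μ)
    (hγ : 0 < γ) (hμ' : ∀ w ∈ S, 0 < μ' w) (hγ' : ∀ w ∈ S, 0 < γ' w)
    (h1 : ∀ w ∈ S, ν ^ w.length < (μ' w)⁻¹) (h2 : ∀ w ∈ S, (μ' w)⁻¹ < γ' w)
    (h3 : ∀ w ∈ S, γ' w < (ν ^ w.length)⁻¹) :
    (machineModel m n ν S R B P Q (fun w => min μ⁻¹ (μ' w)⁻¹)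
      (fun w => min γ⁻¹ (γ' w)⁻¹)).IsDominated μ⁻¹ γ⁻¹ := by
  have key : ∀ w ∈ S, 0 < ν ^ w.length ∧ 0 < (μ' w)⁻¹ ∧ 0 < (γ' w)⁻¹ ∧
      (μ' w)⁻¹ * (γ' w)⁻¹ < 1 ∧ ν ^ w.length * (μ' w)⁻¹ < 1 ∧ ν ^ w.length * (γ' w)⁻¹ < 1 := by
    intro w hw
    have hν : 0 < ν ^ w.length := by positivity
    have hg := hγ' w hw
    have hm := hμ' w hw
    refine ⟨hν, by positivity, by positivity, ?_, ?_, ?_⟩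
    · rw [← div_eq_mul_inv, div_lt_one hg]
      exact h2 w hw
    · have h4 : (μ' w)⁻¹ < (ν ^ w.length)⁻¹ := (h2 w hw).trans (h3 w hw)
      calc _ < ν ^ w.length * (ν ^ w.length)⁻¹ := by gcongr
        _ = 1 := mul_inv_cancel₀ hν.ne'
    · rw [← div_eq_mul_inv, div_lt_one hg]
      exact (h1 w hw).trans (h2 w hw)
  refine ⟨fun w hw => (key w hw).1.le, fun w hw => ?_, fun w hw => ?_, fun w _ => min_le_left _ _,
    fun w _ => min_le_left _ _, fun w hw => ?_, fun w hw => ?_, fun w hw => ?_, fun w hw => ?_⟩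
  · exact le_min (by positivity) (key w hw).2.1.le
  · exact le_min (by positivity) (key w hw).2.2.1.le
  · exact pow_lt_one₀ hν0.le hν1 (by simpa using hne w hw)
  · refine lt_of_le_of_lt ?_ (key w hw).2.2.2.1
    exact mul_le_mul (min_le_right _ _) (min_le_right _ _)
      (le_min (by positivity) (key w hw).2.2.1.le) (key w hw).2.1.le
  · exact lt_of_le_of_lt (mul_le_mul_of_nonneg_left (min_le_right _ _) (key w hw).1.le)
      (key w hw).2.2.2.2.1
  · exact lt_of_le_of_lt (mul_le_mul_of_nonneg_left (min_le_right _ _) (key w hw).1.le)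
      (key w hw).2.2.2.2.2

end Joint

section Intersection

variable {d dc ds du k₁ k₂ q : ℕ} {M : Type*} [TopologicalSpace M] [T2Space M]
    [ChartedSpace (EuclideanSpace ℝ (Fin d)) M] [IsManifold (𝓡 d) 1 M]
    {N₁ N₂ : Set M} {𝓕₁ : LocalDiffeoFamily d k₁ M} {𝓕₂ : LocalDiffeoFamily d k₂ M}
    {S₁ : Finset (List (Fin k₁))} {R₁ : List (Fin k₁) → Set M} {B₁ : Set M}
    {P₁ : M → Fin dc → ℝ} {Q₁ : M → Fin q → ℝ}
    {S₂ : Finset (List (Fin k₂))} {R₂ : List (Fin k₂) → Set M} {B₂ : Set M}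
    {Q₂ : M → Fin q → ℝ} {P₂ : M → Fin dc → ℝ}
    {Rs Us : Set M} {φs : M → M} {ν₁ ν₂ νs : ℝ}
    {A₁ : AffineHorseshoe k₁ ds du ν₁} {A₂ : AffineHorseshoe k₂ du ds ν₂}
    {As : AffineHorseshoe 1 ds du νs}
    {F₁ : SkewSpace ds du M → SkewSpace ds du M} {U₁ : Set (SkewSpace ds du M)}
    {F₂ : SkewSpace du ds M → SkewSpace du ds M} {U₂ : Set (SkewSpace du ds M)}
    {Fs : SkewSpace du ds M → SkewSpace ds du M} {V : Set (SkewSpace du ds M)}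

/-- The stable sets of the two tower maps are connected by the transition map, and so are those of
nearby maps. -/
theorem exists_mem_machineStableSet (hD₁ : IsPreblendingMachine 𝓕₁ N₁ S₁ R₁ B₁ P₁ Q₁)
    (hD₂ : IsPreblendingMachine 𝓕₂ N₂ S₂ R₂ B₂ Q₂ P₂)
    (hB₁ : Convex ℝ (Q₁ '' B₁)) (hB₂ : Convex ℝ (P₂ '' B₂))
    (hT : IsAdaptedTransition 𝓕₁ N₁ S₁ R₁ B₁ P₁ Q₁ 𝓕₂ N₂ S₂ R₂ B₂ Q₂ P₂ Rs Us φs)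
    (hA₁ : AdaptedToMachine ν₁ 𝓕₁ S₁ R₁ P₁ Q₁) (hA₂ : AdaptedToMachine ν₂ 𝓕₂ S₂ R₂ Q₂ P₂)
    (hF₁ : IsTowerMap A₁ 𝓕₁ S₁ R₁ F₁ U₁) (hF₂ : IsTowerMap A₂ 𝓕₂ S₂ R₂ F₂ U₂)
    (hFs : IsTransitionTowerMap d As φs Rs Fs V) :
    (∃ z ∈ transitionRect As Rs, z ∈ machineStableSet A₂ S₂ R₂ F₂ ∧
      Fs z ∈ machineStableSet A₁ S₁ R₁ F₁) ∧
    ∀ (K₁ : Set (SkewSpace ds du M)) (K₂ : Set (SkewSpace du ds M)),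
      IsCompact K₁ → K₁ ⊆ U₁ → (⋃ w ∈ S₁, towerRect A₁ R₁ w) ⊆ interior K₁ →
      IsCompact K₂ → K₂ ⊆ U₂ → (⋃ w ∈ S₂, towerRect A₂ R₂ w) ⊆ interior K₂ →
      ∃ 𝒰₁ ∈ @nhds _ (c1Topology (skewModel ds du d) (skewModel ds du d) U₁) F₁,
      ∃ 𝒰₂ ∈ @nhds _ (c1Topology (skewModel du ds d) (skewModel du ds d) U₂) F₂,
      ∃ 𝒰s ∈ @nhds _ (c1Topology (skewModel du ds d) (skewModel ds du d) V) Fs,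
        ∀ G₁ ∈ 𝒰₁, ∀ G₂ ∈ 𝒰₂, ∀ Gs ∈ 𝒰s,
          ContMDiffOn (skewModel ds du d) (skewModel ds du d) 1 G₁ U₁ →
          ContMDiffOn (skewModel du ds d) (skewModel du ds d) 1 G₂ U₂ →
          ContMDiffOn (skewModel du ds d) (skewModel ds du d) 1 Gs V →
          ∃ z ∈ V, z ∈ maximalForwardInvariantSet K₂ G₂ ∧
            Gs z ∈ maximalForwardInvariantSet K₁ G₁ := by
  obtain ⟨μ₁, γ₁, μ₂, γ₂, μ, γ, hμ₁, hγ₁, hμ₂, hγ₂, hμ, hγ, h₁₂, h₂₁, hdom₁, hdom₂, hdoms,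
    Δ₁, Δ₂, hΔ₁, hΔ₂, hdiam₁, hdiam₂⟩ := hT.constants
  choose! m₁ g₁ hm₁ hg₁ hdom₁' had₁ had₁' had₁'' using hA₁
  choose! m₂ g₂ hm₂ hg₂ hdom₂' had₂ had₂' had₂'' using hA₂
  obtain ⟨w₀, hw₀⟩ : S₁.Nonempty := Finset.card_pos.1 (by linarith [hD₁.two_le_card])
  have : Nonempty M := (hD₁.nonempty w₀ hw₀).to_type
  obtain ⟨Ψ₁, hΨ₁N, hΨ₁⟩ := hD₁.splitting.exists_partialDiffeomorph
  obtain ⟨Ψ₂, hΨ₂N, hΨ₂⟩ := hD₂.splitting.exists_partialDiffeomorph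
  obtain ⟨Ψt, hΨtN, hΨt⟩ := hD₂.splitting.swap.exists_partialDiffeomorph
  obtain ⟨hQc, hQne⟩ := hD₁.isCompact_image_region
  obtain ⟨hPc, hPne⟩ := hD₂.isCompact_image_region
  have hdist : ∀ {n r : ℕ} {Z : Set (Fin r → ℝ)}, IsCompact Z → ∀ s ∈ unitCube n ×ˢ Z,
      ∀ s' ∈ unitCube n ×ˢ Z, ‖(s - s').2‖ ≤ Metric.diam Z := by
    intro n r Z hZ s hs s' hs'
    rw [Prod.snd_sub, ← dist_eq_norm]
    exact Metric.dist_le_diam_of_mem hZ.isBounded hs.2 hs'.2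
  obtain ⟨κ, hκ, Hκ⟩ := exists_joint_orbits_of_lt (X₁ := SkewSpace ds du M)
    (X₂ := SkewSpace du ds M)
    (m₂ := machineModel du ds ν₂ S₂ R₂ B₂ Q₂ P₂ (fun w => min μ₂⁻¹ (m₂ w)⁻¹)
      (fun w => min γ₂⁻¹ (g₂ w)⁻¹))
    (m₁ := machineModel ds du ν₁ S₁ R₁ B₁ P₁ Q₁ (fun w => min μ₁⁻¹ (m₁ w)⁻¹)
      (fun w => min γ₁⁻¹ (g₁ w)⁻¹))
    (l₂ := νs) (l₁ := νs) (l₂' := γ⁻¹) (l₁' := μ⁻¹)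
    ((isCompact_unitCube ds).prod hPc) ((convex_unitCube ds).prod hB₂)
    ((nonempty_unitCube ds).prod hPne) ((isCompact_unitCube du).prod hQc)
    ((convex_unitCube du).prod hB₁) ((nonempty_unitCube du).prod hQne) (hdist hPc) (hdist hQc)
    (machineModel_isDominated A₂.nu_pos A₂.nu_lt_one hD₂.word_ne_nil hμ₂ hγ₂ hm₂ hg₂
      had₂ had₂' had₂'')
    (machineModel_isDominated A₁.nu_pos A₁.nu_lt_one hD₁.word_ne_nil hμ₁ hγ₁ hm₁ hg₁
      had₁ had₁' had₁'')
    (by positivity) (by positivity) (inv_mul_inv_lt_one h₂₁) (inv_mul_inv_lt_one h₁₂)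
    (machineModel_selects hΔ₂) (machineModel_selects hΔ₁) hΔ₂.1 hΔ₁.1 As.nu_pos.le
    (by positivity) As.nu_pos.le (by positivity) hdiam₂ hdiam₁
  have hΦ : ∀ x ∈ (skewCoordinates (ContinuousLinearEquiv.prodComm ℝ (Fin du → ℝ) (Fin ds → ℝ))
      Ψt).source, x ∈ (skewCoordinates
        (ContinuousLinearEquiv.refl ℝ ((Fin du → ℝ) × (Fin ds → ℝ))) Ψ₂).source ∧
      skewCoordinates (ContinuousLinearEquiv.refl ℝ ((Fin du → ℝ) × (Fin ds → ℝ))) Ψ₂ x =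
        (skewCoordinates (ContinuousLinearEquiv.prodComm ℝ (Fin du → ℝ) (Fin ds → ℝ))
          Ψt x).swap := by
    intro x hx
    refine ⟨⟨mem_univ _, ?_⟩, ?_⟩
    · rw [hΨ₂N, ← hΨtN]
      exact hx.2
    · have e1 : Ψ₂ x.2 = (Q₂ x.2, P₂ x.2) := congrFun hΨ₂ x.2
      have e2 : Ψt x.2 = (P₂ x.2, Q₂ x.2) := congrFun hΨt x.2
      change ((x.1.1, (Ψ₂ x.2).1), (x.1.2, (Ψ₂ x.2).2)) =
        ((x.1.1, (Ψt x.2).2), (x.1.2, (Ψt x.2).1))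
      rw [e1, e2]
  have hs := hFs.exists_hasBranch hΨt hΨ₁ (hT.isCompact) (by
      rw [hΨtN]
      exact hT.subset_open) (by
      rw [hΨ₁N]
      exact hT.mapsTo.mono_left hT.subset_dom)
    (fun x hx => hT.embedding.2.2 ⟨x, hT.subset_dom hx⟩) hT.at3_rectangle hT.at3_a hT.at3_b
    hT.at3_c hT.at3_d hμ hγ hdoms hκ
  have hrect : ∀ {k m n p q : ℕ} {ν : ℝ} {A : AffineHorseshoe k m n ν}
      {𝓕 : LocalDiffeoFamily d k M} {N : Set M} {S : Finset (List (Fin k))}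
      {R : List (Fin k) → Set M} {B : Set M} {P : M → Fin p → ℝ} {Q : M → Fin q → ℝ},
      IsPreblendingMachine 𝓕 N S R B P Q → ∀ w ∈ S, IsCompact (towerRect A R w) := by
    intro k m n p q ν A 𝓕 N S R B P Q hD w hw
    obtain ⟨Su, s, hS, -⟩ := exists_wordMap_eq_of_norm_symm_lt A.nu_pos.le A.unstable_norm_lt w
    refine ((isCompact_unitCube m).prod ?_).prod (hD.isCompact w hw)
    have e : wordMap (fun i => ⇑(A.unstableMap i)) w ⁻¹' unitCube n =
        (fun y => Su.symm (y - s)) '' unitCube n := by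
      ext x
      constructor
      · intro hx
        refine ⟨Su x + s, ?_, by simp⟩
        rw [← hS]
        exact hx
      · rintro ⟨y, hy, rfl⟩
        rw [mem_preimage, hS]
        simpa using hy
    rw [e]
    exact (isCompact_unitCube n).image (by fun_prop)
  constructor
  · have hC : IsCompact (transitionRect As Rs) := by
      obtain ⟨T, t, Su, s, -, -, hskew, hext⟩ := hFs.exists_isSkewExtension hΨt hΨ₁ (hT.isCompact)
        (by
          rw [hΨtN]
          exact hT.subset_open) (by
          rw [hΨ₁N]
          exact hT.mapsTo.mono_left hT.subset_dom)
        (fun x hx => hT.embedding.2.2 ⟨x, hT.subset_dom hx⟩) hT.at3_rectangle hμ hγ hdoms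
      rw [← hskew]
      exact hext.isCompact
    refine exists_mem_stable_of_hasBranch Hκ hΦ
      (S₁.isCompact_biUnion fun w hw => hrect hD₁ w hw)
      (S₂.isCompact_biUnion fun w hw => hrect hD₂ w hw) hC
      (hF₁.contMDiffOn.continuousOn.mono (iUnion₂_subset hF₁.subset))
      (hF₂.contMDiffOn.continuousOn.mono (iUnion₂_subset hF₂.subset))
      (hFs.contMDiffOn.continuousOn.mono hFs.subset) (fun w hw => ?_) (fun w hw => ?_) hs.1
    · exact ⟨_, subset_biUnion_of_mem (u := towerRect A₁ R₁) hw,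
        (hD₁.exists_hasBranch hF₁ hΨ₁N hΨ₁ hw hμ₁ hγ₁ (hm₁ w hw) (hg₁ w hw) (hdom₁ w hw)
          (hdom₁' w hw) isOpen_univ (subset_univ _) hκ).1⟩
    · exact ⟨_, subset_biUnion_of_mem (u := towerRect A₂ R₂) hw,
        (hD₂.exists_hasBranch hF₂ hΨ₂N hΨ₂ hw hμ₂ hγ₂ (hm₂ w hw) (hg₂ w hw) (hdom₂ w hw)
          (hdom₂' w hw) isOpen_univ (subset_univ _) hκ).1⟩
  · intro K₁ K₂ hK₁ hK₁U hK₁R hK₂ hK₂U hK₂R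
    obtain ⟨Ls, hLsV, hLs, 𝒰s, h𝒰s, hbs⟩ := hs.2
    have hb₁ := fun w (hw : w ∈ S₁) => (hD₁.exists_hasBranch hF₁ hΨ₁N hΨ₁ hw hμ₁ hγ₁ (hm₁ w hw)
      (hg₁ w hw) (hdom₁ w hw) (hdom₁' w hw) (W := interior K₁) isOpen_interior
      ((subset_biUnion_of_mem (u := towerRect A₁ R₁) hw).trans hK₁R) hκ).2
    have hb₂ := fun w (hw : w ∈ S₂) => (hD₂.exists_hasBranch hF₂ hΨ₂N hΨ₂ hw hμ₂ hγ₂ (hm₂ w hw)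
      (hg₂ w hw) (hdom₂ w hw) (hdom₂' w hw) (W := interior K₂) isOpen_interior
      ((subset_biUnion_of_mem (u := towerRect A₂ R₂) hw).trans hK₂R) hκ).2
    choose! L₁ hL₁ _ 𝒰₁ h𝒰₁ hb₁ using hb₁
    choose! L₂ hL₂ _ 𝒰₂ h𝒰₂ hb₂ using hb₂
    refine ⟨⋂ w ∈ S₁, 𝒰₁ w, (Filter.biInter_finset_mem S₁).2 h𝒰₁, ⋂ w ∈ S₂, 𝒰₂ w,
      (Filter.biInter_finset_mem S₂).2 h𝒰₂, 𝒰s, h𝒰s, fun G₁ hG₁ G₂ hG₂ Gs hGs hc₁ hc₂ hcs => ?_⟩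
    rw [mem_iInter₂] at hG₁ hG₂
    obtain ⟨z, hz, h⟩ := exists_mem_stable_of_hasBranch Hκ hΦ hK₁ hK₂ hLs
      (hc₁.continuousOn.mono hK₁U) (hc₂.continuousOn.mono hK₂U) (hcs.continuousOn.mono hLsV)
      (fun w hw => ⟨L₁ w, (hL₁ w hw).trans interior_subset, hb₁ w hw G₁ (hG₁ w hw) hc₁⟩)
      (fun w hw => ⟨L₂ w, (hL₂ w hw).trans interior_subset, hb₂ w hw G₂ (hG₂ w hw) hc₂⟩)
      (hbs Gs hGs hcs)
    exact ⟨z, hLsV hz, h⟩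

end Intersection

/-! ### Cone invariance of skew extensions -/

section Cones

/-- A linear map that is close to a block diagonal one maps cones into narrower cones, if the product
of the rates of the blocks is less than `1`. -/
theorem exists_cone_bounds_of_close {C U : Type*} [NormedAddCommGroup C] [NormedSpace ℝ C]
    [NormedAddCommGroup U] [NormedSpace ℝ U] {α β θ : ℝ} (hα : 0 ≤ α) (hβ : 0 ≤ β)
    (hαβ : α * β < 1) (hθ : 0 < θ) :
    ∃ ε > 0, ∃ θ' > 0, θ' < θ ∧ ∀ (D : C × U →L[ℝ] C × U) (a : C →L[ℝ] C) (b : U ≃L[ℝ] U),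
      (∀ v, ‖a v‖ ≤ α * ‖v‖) → (∀ v, ‖b.symm v‖ ≤ β * ‖v‖) →
      ‖D - a.prodMap (b : U →L[ℝ] U)‖ ≤ ε → ∀ v,
        (‖(D v).2‖ ≤ θ * ‖(D v).1‖ → ‖v.2‖ ≤ θ' * ‖v.1‖) ∧
        (‖v.1‖ ≤ θ * ‖v.2‖ → ‖(D v).1‖ ≤ θ' * ‖(D v).2‖) := by
  obtain ⟨q, hq1, hq2⟩ := exists_between hαβ
  have hαβ0 : 0 ≤ α * β := mul_nonneg hα hβ
  have hq0 : 0 < q := hαβ0.trans_lt hq1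
  -- the error `ε` enlarges the slopes by a quantity that has to fit between `α * β * θ` and `q * θ`
  obtain ⟨ε, hε, hε1, hε2⟩ : ∃ ε > 0, β * (ε * (1 + θ)) < 1 ∧
      β * θ * α + β * (ε * (1 + θ)) ≤ q * θ * (1 - β * (ε * (1 + θ))) := by
    have h1 : Tendsto (fun ε : ℝ => β * (ε * (1 + θ))) (𝓝[>] 0) (𝓝 0) := by
      have : Continuous fun ε : ℝ => β * (ε * (1 + θ)) := by fun_prop
      simpa using (this.tendsto 0).mono_left nhdsWithin_le_nhds
    have h2 : Tendsto (fun ε : ℝ => q * θ * (1 - β * (ε * (1 + θ))) - β * (ε * (1 + θ)))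
        (𝓝[>] 0) (𝓝 (q * θ)) := by
      simpa using (((tendsto_const_nhds (x := (1 : ℝ))).sub h1).const_mul (q * θ)).sub h1
    have h3 : β * θ * α < q * θ := by nlinarith
    obtain ⟨ε, h4, h5, h6⟩ := (((tendsto_order.1 h1).2 1 one_pos).and
      (((tendsto_order.1 h2).1 _ h3).and self_mem_nhdsWithin)).exists
    exact ⟨ε, h6, h4, by linarith⟩
  refine ⟨ε, hε, q * θ, by positivity, by nlinarith, fun D a b ha hb hD v => ?_⟩
  have he : ‖D v - (a v.1, b v.2)‖ ≤ ε * ‖v‖ :=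
    (ContinuousLinearMap.le_of_opNorm_le _ hD v)
  have hv : ‖v‖ ≤ ‖v.1‖ + ‖v.2‖ :=
    max_le (le_add_of_nonneg_right (norm_nonneg _)) (le_add_of_nonneg_left (norm_nonneg _))
  have he' : ‖D v - (a v.1, b v.2)‖ ≤ ε * (‖v.1‖ + ‖v.2‖) := he.trans (by gcongr)
  have h1 : ‖(D v).1‖ ≤ α * ‖v.1‖ + ε * (‖v.1‖ + ‖v.2‖) := by
    have h := (norm_fst_le (D v - (a v.1, b v.2))).trans he'
    have h' : (D v).1 = a v.1 + (D v - (a v.1, b v.2)).1 := by simp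
    rw [h']
    exact (norm_add_le _ _).trans (add_le_add (ha _) h)
  have h2 : ‖v.2‖ ≤ β * (‖(D v).2‖ + ε * (‖v.1‖ + ‖v.2‖)) := by
    have h := (norm_snd_le (D v - (a v.1, b v.2))).trans he'
    have h' : b v.2 = (D v).2 - (D v - (a v.1, b v.2)).2 := by simp
    have h3 : v.2 = b.symm (b v.2) := (b.symm_apply_apply _).symm
    calc ‖v.2‖ = ‖b.symm (b v.2)‖ := by rw [← h3]
      _ ≤ β * ‖b v.2‖ := hb _
      _ ≤ _ := by
        rw [h']
        gcongr
        exact (norm_sub_le _ _).trans (by gcongr)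
  have hpos : 0 < 1 - β * (ε * (1 + θ)) := by linarith
  have hx := norm_nonneg v.1
  have hy := norm_nonneg v.2
  constructor
  · intro h
    refine le_of_mul_le_mul_left ?_ hpos
    have h3 : ‖v.2‖ ≤ β * (θ * (α * ‖v.1‖ + ε * (‖v.1‖ + ‖v.2‖)) + ε * (‖v.1‖ + ‖v.2‖)) :=
      h2.trans (by
        gcongr
        exact h.trans (by gcongr))
    nlinarith [mul_le_mul_of_nonneg_right hε2 hx]
  · intro h
    have h3 : ‖v.1‖ + ‖v.2‖ ≤ (1 + θ) * ‖v.2‖ := by linarith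
    have h4 : ‖v.2‖ * (1 - β * (ε * (1 + θ))) ≤ β * ‖(D v).2‖ := by
      have : β * (ε * (‖v.1‖ + ‖v.2‖)) ≤ β * (ε * ((1 + θ) * ‖v.2‖)) := by gcongr
      linarith
    have h5 : ‖(D v).1‖ ≤ (α * θ + ε * (1 + θ)) * ‖v.2‖ := by
      have h6 : α * ‖v.1‖ ≤ α * (θ * ‖v.2‖) := by gcongr
      have h7 : ε * (‖v.1‖ + ‖v.2‖) ≤ ε * ((1 + θ) * ‖v.2‖) := by gcongr
      linarith
    refine le_of_mul_le_mul_right ?_ hpos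
    have h8 : 0 ≤ α * θ + ε * (1 + θ) := by positivity
    calc ‖(D v).1‖ * (1 - β * (ε * (1 + θ)))
        ≤ (α * θ + ε * (1 + θ)) * ‖v.2‖ * (1 - β * (ε * (1 + θ))) := by gcongr
      _ = (α * θ + ε * (1 + θ)) * (‖v.2‖ * (1 - β * (ε * (1 + θ)))) := by ring
      _ ≤ (α * θ + ε * (1 + θ)) * (β * ‖(D v).2‖) := by gcongr
      _ = (β * θ * α + β * (ε * (1 + θ))) * ‖(D v).2‖ := by ring
      _ ≤ q * θ * (1 - β * (ε * (1 + θ))) * ‖(D v).2‖ := by gcongr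
      _ = _ := by ring

variable {A B F G : Type*}
  [NormedAddCommGroup A] [NormedSpace ℝ A] [NormedAddCommGroup B] [NormedSpace ℝ B]
  [NormedAddCommGroup F] [NormedSpace ℝ F] [NormedAddCommGroup G] [NormedSpace ℝ G]

theorem BlockRates.norm_apply_le {r α β : ℝ} {a : A × F →L[ℝ] A × F} {b : (B × G) ≃L[ℝ] (B × G)}
    (h : BlockRates r α β a b) (v : A × F) : ‖a v‖ ≤ max 0 (max r α) * ‖v‖ := by
  have hm := le_max_right (0 : ℝ) (max r α)
  refine max_le ((h.fst_le v).trans ?_) ((h.snd_le v).trans ?_)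
  · exact mul_le_mul ((le_max_left _ _).trans hm) (norm_fst_le v) (norm_nonneg _) (le_max_left _ _)
  · exact mul_le_mul ((le_max_right _ _).trans hm) (norm_snd_le v) (norm_nonneg _) (le_max_left _ _)

variable {E H : Type*} [NormedAddCommGroup E] [NormedSpace ℝ E] [TopologicalSpace H]
  {I : ModelWithCorners ℝ E H} {M : Type*} [TopologicalSpace M] [ChartedSpace H M]
  {Ψ : PartialDiffeomorph I 𝓘(ℝ, F × G) M (F × G) 1}
  {T : A →L[ℝ] A} {t : A} {S : B ≃L[ℝ] B} {s : B} {φ : M → M} {Hs : Set A} {Vu : Set B}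
  {R : Set M} {r α β : ℝ} {F₀ : (A × B) × M → (A × B) × M} {U : Set ((A × B) × M)}

local notation "Φₛ" => skewCoordinates (ContinuousLinearEquiv.refl ℝ (A × B))

/-- The derivatives of the components of the skew coordinates, the second one with its factors
interchanged: a split blending machine has the unstable coordinate `(Q, y)` in place of `(y, Q)`. -/
theorem tangentDeriv_skewCoordinates {z : (A × B) × M} (hz : z ∈ (Φₛ Ψ).source)
    (v : TangentSpace (𝓘(ℝ, A × B).prod I) z) :
    tangentDeriv (𝓘(ℝ, A × B).prod I) (fun z => (Φₛ Ψ z).1) z v =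
      (mfderiv (𝓘(ℝ, A × B).prod I) 𝓘(ℝ, (A × F) × (B × G)) (Φₛ Ψ) z v :
        (A × F) × (B × G)).1 ∧
    tangentDeriv (𝓘(ℝ, A × B).prod I) (fun z => (Φₛ Ψ z).2.swap) z v =
      (mfderiv (𝓘(ℝ, A × B).prod I) 𝓘(ℝ, (A × F) × (B × G)) (Φₛ Ψ) z v :
        (A × F) × (B × G)).2.swap := by
  have hm : MDifferentiableAt (𝓘(ℝ, A × B).prod I) 𝓘(ℝ, (A × F) × (B × G)) (Φₛ Ψ) z :=
    (Φₛ Ψ).mdifferentiableAt one_ne_zero hz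
  constructor
  · exact (tangentDeriv_of_prodMk (P := fun z => (Φₛ Ψ z).1) (Q := fun z => (Φₛ Ψ z).2) hm v).1
  · set K : (A × F) × (B × G) →L[ℝ] G × B :=
      ((ContinuousLinearEquiv.prodComm ℝ B G : B × G →L[ℝ] G × B)).comp
        (ContinuousLinearMap.snd ℝ (A × F) (B × G))
    have h1 := mfderiv_comp_apply (I := 𝓘(ℝ, A × B).prod I) (I' := 𝓘(ℝ, (A × F) × (B × G)))
      (I'' := 𝓘(ℝ, G × B)) z (g := K) K.differentiableAt.mdifferentiableAt hm v
    rw [mfderiv_eq_fderiv, K.fderiv] at h1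
    exact h1

variable [FiniteDimensional ℝ A] [FiniteDimensional ℝ B] [FiniteDimensional ℝ F]
  [FiniteDimensional ℝ G]

namespace IsSkewExtension

/-- A skew extension whose branch is injective is, near its rectangle, a diffeomorphism onto its image
that satisfies the cone invariance condition, if the product of the rates is less than `1`. -/
theorem exists_coneInvariance [T2Space M] [IsManifold I 1 M]
    (h : IsSkewExtension (ContinuousLinearEquiv.refl ℝ (A × B)) Ψ Ψ T t S s φ Hs Vu R r α β F₀ U)
    (hT : Injective T) (hφ : InjOn φ R) (hαβ : max 0 (max r α) * max 0 (max r β) < 1) {θ : ℝ}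
    (hθ : 0 < θ) :
    ∃ W, skewRect (ContinuousLinearEquiv.refl ℝ (A × B)) S s Hs Vu R ⊆ W ∧ W ⊆ (Φₛ Ψ).source ∧
      IsDiffeoOntoImage (𝓘(ℝ, A × B).prod I) (𝓘(ℝ, A × B).prod I) F₀ W ∧
      MapsTo F₀ W (Φₛ Ψ).source ∧
      ConeInvariance (𝓘(ℝ, A × B).prod I) (fun z => (Φₛ Ψ z).1) (fun z => (Φₛ Ψ z).2.swap)
        (fun z => (Φₛ Ψ z).1) (fun z => (Φₛ Ψ z).2.swap) θ F₀ W := by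
  set Φ := Φₛ Ψ with hΦ
  set Rs := skewRect (ContinuousLinearEquiv.refl ℝ (A × B)) S s Hs Vu R with hRs
  obtain ⟨ε, hε, θ', hθ'0, hθ', hcone⟩ := exists_cone_bounds_of_close (C := A × F) (U := B × G)
    (le_max_left 0 (max r α)) (le_max_left 0 (max r β)) hαβ hθ
  -- the derivative of the coordinate expression is continuous
  set O := U ∩ (Φ.source ∩ F₀ ⁻¹' Φ.source) with hO
  have hOo : IsOpen O := by
    have h1 := h.contMDiffOn.continuousOn.isOpen_inter_preimage h.isOpen Φ.open_source
    have h2 : O = (U ∩ F₀ ⁻¹' Φ.source) ∩ Φ.source := by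
      rw [hO]
      ext z
      simp only [mem_inter_iff]
      tauto
    rw [h2]
    exact h1.inter Φ.open_source
  set O' := {y | y ∈ Φ.target ∧ Φ.symm y ∈ U ∧ F₀ (Φ.symm y) ∈ Φ.source} with hO'
  have hO'o : IsOpen O' := isOpen_inCoordinates_domain h.isOpen h.contMDiffOn.continuousOn
  have hOO' : MapsTo Φ O O' := by
    rintro z ⟨h1, h2, h3⟩
    have h4 : Φ.symm (Φ z) = z := Φ.left_inv h2
    exact ⟨Φ.map_source h2, by rwa [h4], by rwa [h4]⟩
  have hder : ContinuousOn (fun z => fderiv ℝ (inCoordinates Φ Φ F₀) (Φ z)) O :=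
    ((contDiffOn_inCoordinates h.contMDiffOn).continuousOn_fderiv_of_isOpen hO'o le_rfl).comp
      (Φ.contMDiffOn_toFun.continuousOn.mono fun z hz => hz.2.1) hOO'
  have hRO : Rs ⊆ O := fun z hz => ⟨h.subset hz, h.mem_source hz⟩
  set N := ⋃ z₀ ∈ Rs, O ∩ (fun z => fderiv ℝ (inCoordinates Φ Φ F₀) (Φ z)) ⁻¹'
    Metric.ball (fderiv ℝ (inCoordinates Φ Φ F₀) (Φ z₀)) ε with hN
  have hNo : IsOpen N := isOpen_biUnion fun z₀ _ =>
    hder.isOpen_inter_preimage hOo Metric.isOpen_ball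
  have hRN : Rs ⊆ N := fun z hz => mem_biUnion hz ⟨hRO hz, Metric.mem_ball_self hε⟩
  have hinj : InjOn F₀ Rs := by
    intro z hz z' hz' heq
    rw [h.apply_eq hz, h.apply_eq hz'] at heq
    simp only [skewBranch, Prod.mk.injEq, add_left_inj, EmbeddingLike.apply_eq_iff_eq] at heq
    exact Prod.ext (Prod.ext (hT heq.1.1) heq.1.2) (hφ hz.2 hz'.2 heq.2)
  obtain ⟨W, hRW, hWN, hW⟩ := exists_isDiffeoOntoImage (I := 𝓘(ℝ, A × B).prod I)
    (I' := 𝓘(ℝ, A × B).prod I) (f := F₀) h.isCompact hNo hRN hinj fun z hz => by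
      obtain ⟨a, b, hab, -, hai⟩ := h.fderiv_inCoordinates hz
      refine isLocalDiffeomorphAt_of_inCoordinates (Φ := Φ) (Φ' := Φ)
        (T := (LinearEquiv.ofInjectiveEndo (a : A × F →ₗ[ℝ] A × F)
          (hai hT)).toContinuousLinearEquiv.prodCongr b)
        h.isOpen h.contMDiffOn (h.mem_source hz).1 (h.subset hz) (h.mem_source hz).2 ?_
      rw [hab]
      rfl
  have hWO : W ⊆ O := hWN.trans (iUnion₂_subset fun _ _ => inter_subset_left)
  refine ⟨W, hRW, fun z hz => (hWO hz).2.1, hW, fun z hz => (hWO hz).2.2, θ', hθ'0, hθ',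
    fun z hz v => ?_⟩
  obtain ⟨z₀, hz₀, hzO, hz₀z⟩ := mem_iUnion₂.1 (hWN hz)
  obtain ⟨a, b, hab, hrates, -⟩ := h.fderiv_inCoordinates hz₀
  have hclose : ‖fderiv ℝ (inCoordinates Φ Φ F₀) (Φ z) - a.prodMap (b : B × G →L[ℝ] B × G)‖ ≤
      ε := by
    rw [← hab, ← dist_eq_norm]
    exact (Metric.mem_ball.1 hz₀z).le
  have hb : ∀ w, ‖b.symm w‖ ≤ max 0 (max r β) * ‖w‖ := fun w =>
    ContinuousLinearMap.le_of_opNorm_le _ hrates.norm_symm_le w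
  have hFd : MDifferentiableAt (𝓘(ℝ, A × B).prod I) (𝓘(ℝ, A × B).prod I) F₀ z :=
    (h.contMDiffOn.mdifferentiableOn one_ne_zero z hzO.1).mdifferentiableAt
      (h.isOpen.mem_nhds hzO.1)
  have hv := (fderiv_inCoordinates_mfderiv (Φ := Φ) (Φ' := Φ) hzO.2.1 hFd hzO.2.2).2 v
  have hbound := hcone _ a b hrates.norm_apply_le hb hclose
    (mfderiv (𝓘(ℝ, A × B).prod I) 𝓘(ℝ, (A × F) × (B × G)) Φ z v : (A × F) × (B × G))
  rw [hv] at hbound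
  obtain ⟨e1, e2⟩ := tangentDeriv_skewCoordinates (Ψ := Ψ) hzO.2.1 v
  obtain ⟨e3, e4⟩ := tangentDeriv_skewCoordinates (Ψ := Ψ) hzO.2.2
    (mfderiv (𝓘(ℝ, A × B).prod I) (𝓘(ℝ, A × B).prod I) F₀ z v)
  have hswap : ∀ u : B × G, ‖u.swap‖ = ‖u‖ := fun u => max_comm _ _
  have n1 := congrArg norm e1
  have n2 := (congrArg norm e2).trans (hswap _)
  have n3 := congrArg norm e3
  have n4 := (congrArg norm e4).trans (hswap _)
  constructor
  · intro hc
    exact n2.trans_le ((hbound.1 (n4.symm.trans_le (hc.trans_eq (congrArg (θ * ·) n3)))).trans_eq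
      (congrArg (θ' * ·) n1.symm))
  · intro hc
    exact n3.trans_le ((hbound.2 (n1.symm.trans_le (hc.trans_eq (congrArg (θ * ·) n2)))).trans_eq
      (congrArg (θ' * ·) n4.symm))

/-- The rectangle of a skew extension is a rectangle for the stable-center coordinate at the initial
point and the unstable coordinate at the image point. -/
theorem isRectangle_coordinates [IsManifold I 1 M]
    (h : IsSkewExtension (ContinuousLinearEquiv.refl ℝ (A × B)) Ψ Ψ T t S s φ Hs Vu R r α β F₀ U) :
    IsRectangle (𝓘(ℝ, A × B).prod I) (fun z => (Φₛ Ψ z).1)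
      ((fun z => (Φₛ Ψ z).2.swap) ∘ F₀)
      (skewRect (ContinuousLinearEquiv.refl ℝ (A × B)) S s Hs Vu R) := by
  set Φ := Φₛ Ψ with hΦ
  set Rs := skewRect (ContinuousLinearEquiv.refl ℝ (A × B)) S s Hs Vu R with hRs
  constructor
  · obtain ⟨W, hRW, -, hW⟩ := exists_isDiffeoOntoImage (I := 𝓘(ℝ, A × B).prod I)
      (I' := 𝓘(ℝ, (A × F) × (G × B))) (f := fun z => ((Φ z).1, (Φ (F₀ z)).2.swap)) h.isCompact
      h.isOpen h.subset (fun z hz z' hz' heq => by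
        simp only [Prod.mk.injEq] at heq
        exact h.injOn_coordinates hz hz' (Prod.ext heq.1 (Prod.swap_injective heq.2)))
      fun z hz => by
        obtain ⟨a, b, hab, -, -⟩ := h.fderiv_inCoordinates hz
        have hleft : Φ.symm (Φ z) = z := Φ.left_inv (h.mem_source hz).1
        have hmem : Φ z ∈ {y | y ∈ Φ.target ∧ Φ.symm y ∈ U ∧ F₀ (Φ.symm y) ∈ Φ.source} :=
          ⟨Φ.map_source (h.mem_source hz).1, by
            rw [hleft]
            exact h.subset hz, by
            rw [hleft]
            exact (h.mem_source hz).2⟩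
        have h1 : ContDiffAt ℝ 1 (inCoordinates Φ Φ F₀) (Φ z) :=
          (contDiffOn_inCoordinates h.contMDiffOn).contDiffAt
            ((isOpen_inCoordinates_domain h.isOpen h.contMDiffOn.continuousOn).mem_nhds hmem)
        have h2 : HasFDerivAt (inCoordinates Φ Φ F₀) (a.prodMap (b : B × G →L[ℝ] B × G)) (Φ z) := by
          rw [← hab]
          exact (h1.differentiableAt one_ne_zero).hasFDerivAt
        set K : (B × G) ≃L[ℝ] (G × B) := b.trans (ContinuousLinearEquiv.prodComm ℝ B G) with hK
        have h3 : HasFDerivAt (fun y => (y.1, (inCoordinates Φ Φ F₀ y).2.swap))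
            (((ContinuousLinearEquiv.refl ℝ (A × F)).prodCongr K :
              ((A × F) × (B × G)) ≃L[ℝ] ((A × F) × (G × B))) :
              (A × F) × (B × G) →L[ℝ] (A × F) × (G × B)) (Φ z) :=
          (hasFDerivAt_fst (𝕜 := ℝ) (p := Φ z)).prodMk
            ((ContinuousLinearEquiv.prodComm ℝ B G).hasFDerivAt.comp (Φ z) h2.snd)
        have h4 : ContDiffAt ℝ 1 (fun y => (y.1, (inCoordinates Φ Φ F₀ y).2.swap)) (Φ z) :=
          contDiffAt_fst.prodMk
            ((ContinuousLinearEquiv.prodComm ℝ B G).contDiff.contDiffAt.comp (Φ z) h1.snd)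
        refine (IsLocalDiffeomorphAt.comp _ _
          (Φ.isLocalDiffeomorphAt_of_mem (h.mem_source hz).1)
          (isLocalDiffeomorphAt_of_hasFDerivAt h4 h3)).congr_of_eventuallyEq ?_
        filter_upwards [Φ.open_source.mem_nhds (h.mem_source hz).1] with z' hz'
        have h5 : Φ.symm (Φ z') = z' := Φ.left_inv hz'
        change _ = ((Φ z').1, (Φ (F₀ (Φ.symm (Φ z')))).2.swap)
        rw [h5]
    exact ⟨W, hRW, hW⟩
  · refine Subset.antisymm ?_ ?_
    · rintro _ ⟨z, hz, rfl⟩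
      exact ⟨⟨z, hz, rfl⟩, ⟨z, hz, rfl⟩⟩
    · rintro ⟨_, _⟩ ⟨⟨z, hz, rfl⟩, ⟨z', hz', rfl⟩⟩
      obtain ⟨z'', hz'', e1, e2⟩ := h.exists_coordinates_eq (c := (Φ z).1) (u := (Φ (F₀ z')).2)
        (by
          rw [(h.coordinates_apply hz).1]
          exact ⟨hz.1.1, z.2, hz.2, rfl⟩) (by
          rw [(h.coordinates_apply hz').2]
          exact ⟨hz'.1.2, z'.2, hz'.2, rfl⟩)
      exact ⟨z'', hz'', Prod.ext e1 (congrArg Prod.swap e2)⟩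

end IsSkewExtension

theorem isSplitting_skewCoordinates :
    IsSplitting (𝓘(ℝ, A × B).prod I) (fun z => (Φₛ Ψ z).1) (fun z => (Φₛ Ψ z).2.swap)
      (univ ×ˢ Ψ.source) := by
  refine ⟨(Φₛ Ψ).open_source, fun z hz z' hz' heq => ?_, fun z => ?_⟩
  · simp only [Prod.mk.injEq] at heq
    exact (Φₛ Ψ).injOn hz hz' (Prod.ext heq.1 (Prod.swap_injective heq.2))
  · set K : ((A × F) × (B × G)) ≃L[ℝ] ((A × F) × (G × B)) :=
      (ContinuousLinearEquiv.refl ℝ (A × F)).prodCongr (ContinuousLinearEquiv.prodComm ℝ B G)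
    exact IsLocalDiffeomorphAt.comp _ _ ((Φₛ Ψ).isLocalDiffeomorphAt_of_mem z.2)
      (isLocalDiffeomorphAt_of_hasFDerivAt (f := K) (f' := K) K.contDiff.contDiffAt K.hasFDerivAt)

end Cones

/-! ### The associated split blending machine -/

section SplitBlending

theorem injective_wordMap {κ α : Type*} {f : κ → α → α} (hf : ∀ i, Injective (f i)) (w : List κ) :
    Injective (wordMap f w) := by
  induction w with
  | nil => exact injective_id
  | cons i w ih => exact ih.comp (hf i)

theorem image_prodMk_fst_fst {X X' Y Z F : Type*} {s : Set X} {t : Set Y} (ht : t.Nonempty)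
    (R : Set Z) (f : X → X') (P : Z → F) :
    (fun z : (X × Y) × Z => (f z.1.1, P z.2)) '' ((s ×ˢ t) ×ˢ R) = (f '' s) ×ˢ (P '' R) := by
  obtain ⟨y, hy⟩ := ht
  refine Subset.antisymm ?_ ?_
  · rintro _ ⟨z, ⟨⟨h1, h2⟩, h3⟩, rfl⟩
    exact ⟨⟨_, h1, rfl⟩, ⟨_, h3, rfl⟩⟩
  · rintro ⟨_, _⟩ ⟨⟨x, hx, rfl⟩, ⟨z, hz, rfl⟩⟩
    exact ⟨((x, y), z), ⟨⟨hx, hy⟩, hz⟩, rfl⟩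

theorem image_prodMk_fst_snd {X Y Y' Z F : Type*} {s : Set X} (hs : s.Nonempty) {t : Set Y}
    (R : Set Z) (f : Y → Y') (Q : Z → F) :
    (fun z : (X × Y) × Z => (Q z.2, f z.1.2)) '' ((s ×ˢ t) ×ˢ R) = (Q '' R) ×ˢ (f '' t) := by
  obtain ⟨x, hx⟩ := hs
  refine Subset.antisymm ?_ ?_
  · rintro _ ⟨z, ⟨⟨h1, h2⟩, h3⟩, rfl⟩
    exact ⟨⟨_, h3, rfl⟩, ⟨_, h2, rfl⟩⟩
  · rintro ⟨_, _⟩ ⟨⟨z, hz, rfl⟩, ⟨y, hy, rfl⟩⟩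
    exact ⟨((x, y), z), ⟨⟨hx, hy⟩, hz⟩, rfl⟩

theorem image_comp_snd {X Z F : Type*} {s : Set X} (hs : s.Nonempty) (R : Set Z) (P : Z → F) :
    (fun z : X × Z => P z.2) '' (s ×ˢ R) = P '' R := by
  obtain ⟨x, hx⟩ := hs
  refine Subset.antisymm ?_ ?_
  · rintro _ ⟨z, ⟨h1, h3⟩, rfl⟩
    exact ⟨_, h3, rfl⟩
  · rintro _ ⟨z, hz, rfl⟩
    exact ⟨(x, z), ⟨hx, hz⟩, rfl⟩

theorem isSplitting_fst_snd (E F : Type*) [NormedAddCommGroup E] [NormedSpace ℝ E]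
    [NormedAddCommGroup F] [NormedSpace ℝ F] :
    IsSplitting 𝓘(ℝ, E × F) (Prod.fst : E × F → E) (Prod.snd : E × F → F) univ :=
  ⟨isOpen_univ, fun _ _ _ _ h => h, fun x =>
    (Diffeomorph.refl 𝓘(ℝ, E × F) (E × F) 1).isLocalDiffeomorph x⟩

/-- The larger one of the rates `r`, `μ⁻¹` of the stable-center block of an adapted branch is less
than the inverse of the larger one of the rates `r`, `γ⁻¹` of its unstable block. -/
theorem max_mul_max_lt_one {r μ γ : ℝ} (hr : 0 < r) (hr1 : r < 1) (hμ : 0 < μ) (hγ : 0 < γ)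
    (h1 : r < μ⁻¹) (h2 : μ⁻¹ < γ) (h3 : γ < r⁻¹) :
    max 0 (max r μ⁻¹) * max 0 (max r γ⁻¹) < 1 := by
  have hμ' : 0 < μ⁻¹ := inv_pos.2 hμ
  have hγ' : 0 < γ⁻¹ := inv_pos.2 hγ
  rw [max_eq_right (hr.le.trans (le_max_left _ _)), max_eq_right (hr.le.trans (le_max_left _ _))]
  have e1 : γ * γ⁻¹ = 1 := mul_inv_cancel₀ hγ.ne'
  have e2 : r⁻¹ * r = 1 := inv_mul_cancel₀ hr.ne'
  rcases max_choice r μ⁻¹ with h | h <;> rcases max_choice r γ⁻¹ with h' | h' <;> rw [h, h']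
  · nlinarith
  · nlinarith
  · nlinarith
  · nlinarith

variable {d : ℕ} {M : Type*} [TopologicalSpace M] [T2Space M]
  [ChartedSpace (EuclideanSpace ℝ (Fin d)) M] [IsManifold (𝓡 d) 1 M]
  {k m n p q : ℕ} {ν : ℝ} {A : AffineHorseshoe k m n ν} {𝓕 : LocalDiffeoFamily d k M} {N : Set M}
  {S : Finset (List (Fin k))} {R : List (Fin k) → Set M} {B : Set M} {P : M → Fin p → ℝ}
  {Q : M → Fin q → ℝ}

/-- The cone width `θ` has to be small only for the condition on the Lebesgue number: the cone
invariance holds for all widths, since the blocks of the derivative dominate each other. -/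
theorem IsPreblendingMachine.exists_isAssociatedSplitBlendingMachine
    (hD : IsPreblendingMachine 𝓕 N S R B P Q) {F : SkewSpace m n M → SkewSpace m n M}
    {U : Set (SkewSpace m n M)} (hF : IsTowerMap A 𝓕 S R F U)
    (hA : AdaptedToMachine ν 𝓕 S R P Q) {Δ : ℝ}
    (hΔ : IsLebesgueNumber (closure (P '' B)) S (fun w => interior (P '' R w)) Δ) :
    ∃ θ₀ > 0, ∀ θ, 0 < θ → θ ≤ θ₀ →
      IsAssociatedSplitBlendingMachine (d := d) A N S R B P Q F θ := by
  have hcm := nonempty_unitCube m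
  have hcn := nonempty_unitCube n
  obtain ⟨w₀, hw₀⟩ : S.Nonempty := Finset.card_pos.1 (by linarith [hD.two_le_card])
  have : Nonempty M := (hD.nonempty w₀ hw₀).to_type
  obtain ⟨Ψ, hΨN, hΨ⟩ := hD.splitting.exists_partialDiffeomorph
  have hΨP : ∀ x, Ψ x = (P x, Q x) := fun x => congrFun hΨ x
  obtain ⟨hQc, hQne⟩ := hD.isCompact_image_region
  have hBne : B.Nonempty := hQne.of_image
  set Φ := skewCoordinates (ContinuousLinearEquiv.refl ℝ ((Fin m → ℝ) × (Fin n → ℝ))) Ψ with hΦ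
  have hcs : (fun z : SkewSpace m n M => (Φ z).1) = fun z => (z.1.1, P z.2) := by
    funext z
    change (z.1.1, (Ψ z.2).1) = _
    rw [hΨP]
  have hu : (fun z : SkewSpace m n M => (Φ z).2.swap) = fun z => (Q z.2, z.1.2) := by
    funext z
    change ((Ψ z.2).2, z.1.2) = _
    rw [hΨP]
  have hsrc : Φ.source = univ ×ˢ N := by
    rw [← hΨN]
    rfl
  have hsplit := isSplitting_skewCoordinates (A := Fin m → ℝ) (B := Fin n → ℝ) (Ψ := Ψ)
  rw [hcs, hu, hΨN] at hsplit
  have key : ∀ w ∈ S, IsCompact (towerRect A R w) ∧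
      (∀ θ, 0 < θ → ∃ W, towerRect A R w ⊆ W ∧ W ⊆ univ ×ˢ N ∧
        IsDiffeoOntoImage (skewModel m n d) (skewModel m n d) F W ∧ MapsTo F W (univ ×ˢ N) ∧
        ConeInvariance (skewModel m n d) (fun z : SkewSpace m n M => (z.1.1, P z.2))
          (fun z : SkewSpace m n M => (Q z.2, z.1.2)) (fun z : SkewSpace m n M => (z.1.1, P z.2))
          (fun z : SkewSpace m n M => (Q z.2, z.1.2)) θ F W) ∧
      IsRectangle (skewModel m n d) (fun z : SkewSpace m n M => (z.1.1, P z.2))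
        ((fun z : SkewSpace m n M => (Q z.2, z.1.2)) ∘ F) (towerRect A R w) := by
    intro w hw
    obtain ⟨μ, γ, hμ, hγ, hdom, h1, h2, h3⟩ := hA w hw
    obtain ⟨T, t, Su, s, hT, hS, hrect, hext⟩ :=
      hD.exists_isSkewExtension hF hΨN hΨ hw hμ hγ hμ hγ hdom hdom
    simp only [min_self] at hext
    have hTinj : Injective T := by
      intro x y hxy
      have h := injective_wordMap (fun i => (A.stableMap i).injective) w (a₁ := x) (a₂ := y)
      rw [hT, hT, hxy] at h
      exact h rfl
    obtain ⟨⟨W, hRW, -, hWd, -⟩, -⟩ := hD.pb1 w hw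
    have hr1 : ν ^ w.length < 1 := pow_lt_one₀ A.nu_pos.le A.nu_lt_one
      (List.length_pos_iff.2 (hD.word_ne_nil w hw)).ne'
    have hr := max_mul_max_lt_one (pow_pos A.nu_pos w.length) hr1 hμ hγ h1 h2 h3
    refine ⟨hrect ▸ hext.isCompact, fun θ hθ => ?_, ?_⟩
    · have h := hext.exists_coneInvariance hTinj (hWd.2.1.mono hRW) hr hθ
      rw [← hΦ, hcs, hu, hsrc, hrect] at h
      exact h
    · have h := hext.isRectangle_coordinates
      rw [← hΦ, hcs, hu, hrect] at h
      exact h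
  -- the images of the rectangles under the components of the coordinates
  have hleg : ∀ w, (wordMap (fun i => ⇑(A.unstableMap i)) w ⁻¹' unitCube n).Nonempty ∧
      IsClosed (wordMap (fun i => ⇑(A.unstableMap i)) w ⁻¹' unitCube n) ∧
      wordMap (fun i => ⇑(A.unstableMap i)) w '' (wordMap (fun i => ⇑(A.unstableMap i)) w ⁻¹'
        unitCube n) = unitCube n := by
    intro w
    obtain ⟨Su, s, hS, -⟩ := exists_wordMap_eq_of_norm_symm_lt A.nu_pos.le A.unstable_norm_lt w
    have hsurj : Surjective (wordMap (fun i => ⇑(A.unstableMap i)) w) := fun y =>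
      ⟨Su.symm (y - s), by rw [hS]; simp⟩
    have hcont : Continuous (wordMap (fun i => ⇑(A.unstableMap i)) w) := by
      rw [funext hS]
      fun_prop
    exact ⟨hcn.preimage hsurj, (isCompact_unitCube n).isClosed.preimage hcont,
      image_preimage_eq _ hsurj⟩
  have hcsZ : (fun z : SkewSpace m n M => (z.1.1, P z.2)) '' ((unitCube m ×ˢ unitCube n) ×ˢ B) =
      unitCube m ×ˢ (P '' B) := by
    simpa using image_prodMk_fst_fst hcn B id P
  have huZ : (fun z : SkewSpace m n M => (Q z.2, z.1.2)) '' ((unitCube m ×ˢ unitCube n) ×ˢ B) =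
      (Q '' B) ×ˢ unitCube n := by
    simpa using image_prodMk_fst_snd hcm B id Q
  have hcsR : ∀ w, (fun z : SkewSpace m n M => (z.1.1, P z.2)) '' towerRect A R w =
      unitCube m ×ˢ (P '' R w) := fun w => by
    have h := image_prodMk_fst_fst (s := unitCube m) (hleg w).1 (R w) id P
    rw [image_id] at h
    exact h
  have huR : ∀ w, (fun z : SkewSpace m n M => (Q z.2, z.1.2)) '' towerRect A R w =
      (Q '' R w) ×ˢ (wordMap (fun i => ⇑(A.unstableMap i)) w ⁻¹' unitCube n) := fun w => by
    have h := image_prodMk_fst_snd hcm (t := wordMap (fun i => ⇑(A.unstableMap i)) w ⁻¹' unitCube n)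
      (R w) id Q
    rw [image_id] at h
    exact h
  have hFw : ∀ w ∈ S, ∀ z ∈ towerRect A R w, F z = towerBranch A 𝓕 w z := fun w hw z hz =>
    congrArg Bundle.TotalSpace.proj (hF.agree w hw ⟨z, 0⟩ hz)
  have hcsF : ∀ w ∈ S, ((fun z : SkewSpace m n M => (z.1.1, P z.2)) ∘ F) '' towerRect A R w =
      (wordMap (fun i => ⇑(A.stableMap i)) w '' unitCube m) ×ˢ ((P ∘ 𝓕.word w) '' R w) := by
    intro w hw
    rw [← image_prodMk_fst_fst (hleg w).1 (R w) (wordMap (fun i => ⇑(A.stableMap i)) w)]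
    refine image_congr fun z hz => ?_
    rw [comp_apply, hFw w hw z hz]
    rfl
  have huF : ∀ w ∈ S, ((fun z : SkewSpace m n M => (Q z.2, z.1.2)) ∘ F) '' towerRect A R w =
      ((Q ∘ 𝓕.word w) '' R w) ×ˢ unitCube n := by
    intro w hw
    conv_rhs => rw [← (hleg w).2.2]
    rw [← image_prodMk_fst_snd hcm (R w) (wordMap (fun i => ⇑(A.unstableMap i)) w)]
    refine image_congr fun z hz => ?_
    rw [comp_apply, hFw w hw z hz]
    rfl
  have hcZ : (Prod.snd ∘ fun z : SkewSpace m n M => (z.1.1, P z.2)) ''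
      ((unitCube m ×ˢ unitCube n) ×ˢ B) = P '' B :=
    image_comp_snd (hcm.prod hcn) B P
  have hcR : (fun w => interior ((Prod.snd ∘ fun z : SkewSpace m n M => (z.1.1, P z.2)) ''
      towerRect A R w)) = fun w => interior (P '' R w) :=
    funext fun w => congrArg interior (image_comp_snd (hcm.prod (hleg w).1) (R w) P)
  set D := Metric.diam ((Q '' B) ×ˢ unitCube n) with hDdef
  have hD0 : 0 ≤ D := Metric.diam_nonneg
  refine ⟨min (1 / 2) (Δ / (2 * (D + 1))), lt_min (by norm_num)
    (div_pos hΔ.1 (by positivity)), fun θ hθ hθ₀ => ?_⟩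
  exact
    { two_le_card := hD.two_le_card
      isCompact := fun w hw => (key w hw).1
      stableCenterSplitting := hsplit
      centerSplitting := isSplitting_fst_snd _ _
      superposition_subset := prod_mono (subset_univ _) hD.region_subset
      superposition_rectangle := by
        refine ⟨⟨_, prod_mono (subset_univ _) hD.region_subset, hsplit⟩, ?_⟩
        rw [hcsZ, huZ]
        refine Subset.antisymm ?_ ?_
        · rintro _ ⟨z, ⟨⟨h1, h2⟩, h3⟩, rfl⟩
          exact ⟨⟨h1, ⟨_, h3, rfl⟩⟩, ⟨⟨_, h3, rfl⟩, h2⟩⟩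
        · rintro ⟨⟨x, y⟩, ⟨y', x'⟩⟩ ⟨⟨h1, h2⟩, h3, h4⟩
          have h5 : (y, y') ∈ (fun x => (P x, Q x)) '' B := by
            rw [hD.region_rectangle.2]
            exact ⟨h2, h3⟩
          obtain ⟨b, hb, hbe⟩ := h5
          obtain ⟨rfl, rfl⟩ := Prod.mk.inj hbe
          exact ⟨((x, x'), b), ⟨⟨h1, h4⟩, hb⟩, rfl⟩
      theta_pos := hθ
      theta_lt_one := (hθ₀.trans (min_le_left _ _)).trans_lt (by norm_num)
      bm1 := fun w hw => (key w hw).2.1 θ hθ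
      bm2_rectangle := fun w hw => (key w hw).2.2
      bm2 := fun w hw => by
        obtain ⟨hQ, hQB, hPB⟩ := hD.pb2 w hw
        have hwne := hD.word_ne_nil w hw
        rw [hcsZ, huZ, huR, hcsF w hw, huF w hw]
        refine ⟨?_, by rw [hQB], ?_⟩
        · rw [InsideInterior, closure_prod_eq, interior_prod_eq, (hleg w).2.1.closure_eq]
          exact prod_mono hQ fun x hx =>
            mem_of_wordMap_mem interior_subset A.unstable_inside hwne hx
        · obtain ⟨T, t, hT, -⟩ := exists_wordMap_eq_of_norm_lt A.nu_pos.le A.stable_norm_lt w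
          have hcl : IsClosed (wordMap (fun i => ⇑(A.stableMap i)) w '' unitCube m) := by
            rw [funext hT]
            exact ((isCompact_unitCube m).image (by fun_prop)).isClosed
          rw [InsideInterior, closure_prod_eq, interior_prod_eq, hcl.closure_eq]
          refine prod_mono ?_ hPB
          rintro _ ⟨x, hx, rfl⟩
          exact wordMap_mem interior_subset A.stable_inside hwne hx
      bm3 := fun w hw => by
        rw [image_comp, image_comp, hcsZ, hcsR, fst_image_prod _ (hBne.image P),
          fst_image_prod _ ((hD.nonempty w hw).image P)]
        refine ⟨⟨⟨univ, subset_univ _, isSplitting_fst_snd _ _⟩, ?_⟩, Subset.rfl⟩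
        rw [fst_image_prod _ ((hD.nonempty w hw).image P), snd_image_prod hcm]
        exact image_id _
      bm4_cover := by
        rw [hcZ]
        exact hD.pb3.trans (iUnion₂_mono fun w _ => (congrFun hcR w).symm.subset)
      bm4_lebesgue := by
        rw [hcZ, hcR, huZ]
        refine ⟨Δ, 1, hΔ, fun y => ?_, ?_⟩
        · rw [fderiv_snd]
          exact ContinuousLinearMap.norm_snd_le _ _ _
        · have h1 : θ * (2 * (D + 1)) ≤ Δ :=
            (le_div_iff₀ (by positivity)).1 (hθ₀.trans (min_le_right _ _))
          have h2 : 0 ≤ θ * D := mul_nonneg hθ.le hD0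
          rw [← hDdef]
          linarith }

end SplitBlending

end

theorem mainTheorem5
    (d dc ds du k₁ k₂ : ℕ) (hd : 2 ≤ d) (hdc : 0 < dc) (hdcd : dc < d)
    (hds : 0 < ds) (hdu : 0 < du) (hk₁ : 2 ≤ k₁) (hk₂ : 2 ≤ k₂)
    (M : Type*) [TopologicalSpace M] [T2Space M] [SecondCountableTopology M]
    [ChartedSpace (EuclideanSpace ℝ (Fin d)) M] [IsManifold (𝓡 d) 1 M]
    (N₁ N₂ : Set M)
    -- the families of local diffeomorphisms and the two preblending machines
    (𝓕₁ : LocalDiffeoFamily d k₁ M) (𝓕₂ : LocalDiffeoFamily d k₂ M)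
    (S₁ : Finset (List (Fin k₁))) (R₁ : List (Fin k₁) → Set M) (B₁ : Set M)
    (P₁ : M → Fin dc → ℝ) (Q₁ : M → Fin (d - dc) → ℝ)
    (hD₁ : IsPreblendingMachine 𝓕₁ N₁ S₁ R₁ B₁ P₁ Q₁)
    (S₂ : Finset (List (Fin k₂))) (R₂ : List (Fin k₂) → Set M) (B₂ : Set M)
    (Q₂ : M → Fin (d - dc) → ℝ) (P₂ : M → Fin dc → ℝ)
    (hD₂ : IsPreblendingMachine 𝓕₂ N₂ S₂ R₂ B₂ Q₂ P₂)
    -- the unstable sides of the two preblending regions are convex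
    (hB₁ : Convex ℝ (Q₁ '' B₁)) (hB₂ : Convex ℝ (P₂ '' B₂))
    -- the adapted transition
    (Rs Us : Set M) (φs : M → M)
    (hT : IsAdaptedTransition 𝓕₁ N₁ S₁ R₁ B₁ P₁ Q₁ 𝓕₂ N₂ S₂ R₂ B₂ Q₂ P₂ Rs Us φs)
    -- the horseshoe maps, with adapted stretchings
    (ν₁ ν₂ νs : ℝ) (A₁ : AffineHorseshoe k₁ ds du ν₁) (A₂ : AffineHorseshoe k₂ du ds ν₂)
    (As : AffineHorseshoe 1 ds du νs)
    (hA₁ : AdaptedToMachine ν₁ 𝓕₁ S₁ R₁ P₁ Q₁)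
    (hA₂ : AdaptedToMachine ν₂ 𝓕₂ S₂ R₂ Q₂ P₂)
    (hAs : AdaptedStretching (𝓡 d) νs P₂ Q₂ P₁ Q₁ φs Rs)
    -- the tower maps
    (F₁ : SkewSpace ds du M → SkewSpace ds du M) (U₁ : Set (SkewSpace ds du M))
    (hF₁ : IsTowerMap A₁ 𝓕₁ S₁ R₁ F₁ U₁)
    (F₂ : SkewSpace du ds M → SkewSpace du ds M) (U₂ : Set (SkewSpace du ds M))
    (hF₂ : IsTowerMap A₂ 𝓕₂ S₂ R₂ F₂ U₂)
    (Fs : SkewSpace du ds M → SkewSpace ds du M) (V : Set (SkewSpace du ds M))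
    (hFs : IsTransitionTowerMap d As φs Rs Fs V) :
    (∃ θ₀ : ℝ, 0 < θ₀ ∧ ∀ θ : ℝ, 0 < θ → θ ≤ θ₀ →
      IsAssociatedSplitBlendingMachine (d := d) A₁ N₁ S₁ R₁ B₁ P₁ Q₁ F₁ θ ∧
      IsAssociatedSplitBlendingMachine (d := d) A₂ N₂ S₂ R₂ B₂ Q₂ P₂ F₂ θ ∧
      (machineStableSet A₁ S₁ R₁ F₁ ∩
        Fs '' (transitionRect As Rs ∩ machineStableSet A₂ S₂ R₂ F₂)).Nonempty) ∧
    ∀ (K₁ : Set (SkewSpace ds du M)) (K₂ : Set (SkewSpace du ds M)),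
      IsCompact K₁ → K₁ ⊆ U₁ → (⋃ w ∈ S₁, towerRect A₁ R₁ w) ⊆ interior K₁ →
      IsCompact K₂ → K₂ ⊆ U₂ → (⋃ w ∈ S₂, towerRect A₂ R₂ w) ⊆ interior K₂ →
      ∃ 𝒰₁ ∈ @nhds _ (c1Topology (skewModel ds du d) (skewModel ds du d) U₁) F₁,
      ∃ 𝒰₂ ∈ @nhds _ (c1Topology (skewModel du ds d) (skewModel du ds d) U₂) F₂,
      ∃ 𝒰s ∈ @nhds _ (c1Topology (skewModel du ds d) (skewModel ds du d) V) Fs,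
        ∀ G₁ ∈ 𝒰₁, ∀ G₂ ∈ 𝒰₂, ∀ Gs ∈ 𝒰s,
          ContMDiffOn (skewModel ds du d) (skewModel ds du d) 1 G₁ U₁ →
          ContMDiffOn (skewModel du ds d) (skewModel du ds d) 1 G₂ U₂ →
          ContMDiffOn (skewModel du ds d) (skewModel ds du d) 1 Gs V →
          (maximalForwardInvariantSet K₁ G₁ ∩
            Gs '' (V ∩ maximalForwardInvariantSet K₂ G₂)).Nonempty := by
  obtain ⟨h, hrobust⟩ := exists_mem_machineStableSet hD₁ hD₂ hB₁ hB₂ hT hA₁ hA₂ hF₁ hF₂ hFs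
  obtain ⟨μ₁, γ₁, μ₂, γ₂, μ, γ, -, -, -, -, -, -, -, -, -, -, -, Δ₁, Δ₂, hΔ₁, hΔ₂, -, -⟩ :=
    hT.constants
  obtain ⟨θ₁, hθ₁, h₁⟩ := hD₁.exists_isAssociatedSplitBlendingMachine hF₁ hA₁ hΔ₁
  obtain ⟨θ₂, hθ₂, h₂⟩ := hD₂.exists_isAssociatedSplitBlendingMachine hF₂ hA₂ hΔ₂
  constructor
  · refine ⟨min θ₁ θ₂, lt_min hθ₁ hθ₂, fun θ hθ hθ₀ => ⟨h₁ θ hθ (hθ₀.trans (min_le_left _ _)),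
      h₂ θ hθ (hθ₀.trans (min_le_right _ _)), ?_⟩⟩
    obtain ⟨z, hz, hz₂, hz₁⟩ := h
    exact ⟨Fs z, hz₁, z, ⟨hz, hz₂⟩, rfl⟩
  · intro K₁ K₂ hK₁ hK₁U hK₁R hK₂ hK₂U hK₂R
    obtain ⟨𝒰₁, h𝒰₁, 𝒰₂, h𝒰₂, 𝒰s, h𝒰s, hall⟩ := hrobust K₁ K₂ hK₁ hK₁U hK₁R hK₂ hK₂U hK₂R
    refine ⟨𝒰₁, h𝒰₁, 𝒰₂, h𝒰₂, 𝒰s, h𝒰s, fun G₁ hG₁ G₂ hG₂ Gs hGs hc₁ hc₂ hcs => ?_⟩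
    obtain ⟨z, hz, hz₂, hz₁⟩ := hall G₁ hG₁ G₂ hG₂ Gs hGs hc₁ hc₂ hcs
    exact ⟨Gs z, hz₁, z, ⟨hz, hz₂⟩, rfl⟩
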